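/- Let $\beta>0$ and $R>0$. Let $Q$ be a symmetric, nonnegative generalized kernel on the unit square $S=[0,1]^2$: a bounded symmetric bilinear form $(f,g)\mapsto\iint_S Q(x_1,x_2)f(x_1)g(x_2)\,dA$ on $C[0,1]$ with $\iint_S Q\,f f\,dA\ge 0$ for all $f$ (for example $Q(x_1,x_2)=q(x_1)\delta(x_1-x_2)$ with $q\ge 0$ integrable). For $z^0\in L^2[0,1]$ and a locally square-integrable control $u:[0,\infty)\to\mathbb R$, let $z\in C([0,\infty);L^2[0,1])\cap L^2_{loc}([0,\infty);C[0,1])$ be the weak solution (equation tested with $C^2$ functions of $x$ on $[0,1]$ and integrated by parts twice) of $$z_t=z_{xx},\quad z(x,0)=z^0(x),\quad z_x(0,t)=0,\quad z_x(1,t)=\beta\,(u(t)-z(1,t)),$$ with cost $$J(z^0,u)=\int_0^\infty\Big(\iint_S Q(x_1,x_2)z(x_1,t)z(x_2,t)\,dA+R\,u(t)^2\Big)dt\in[0,\infty].$$ Let $P$ be a continuous symmetric function on $S$. Call $P$ a weak solution of the Riccati PDE $$\nabla^2P(x_1,x_2)+Q(x_1,x_2)=\beta^2R^{-1}P(x_1,1)P(1,x_2)$$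 with boundary conditions $\partial P/\partial x_i=0$ at $x_i=0$ and $\partial P/\partial x_i=-\beta P$ at $x_i=1$ if for every $\theta\in C^2[0,1]$ the equation holds after multiplication by $\theta(x_1)\theta(x_2)$ and integration over $S$, where $\iint_S\nabla^2P\,\theta\theta\,dA$ is evaluated by integrating by parts twice in each variable and inserting the boundary conditions. Put $K(x)=-\beta R^{-1}P(x,1)$. **(1)** If $P$ is a weak solution, then for every $z^0\in L^2[0,1]$ the closed loop system, i.e. $u(t)=\int_0^1K(x)z(x,t)\,dx$, has exactly one trajectory. If this trajectory tends to $0$ in $L^2[0,1]$ as $t\to\infty$ (that is, if the feedback is admissible from $z^0$), then the optimal cost from $z^0$, the minimum of $J(z^0,u)$ over all $u$, is $$\iint_S P(x_1,x_2)z^0(x_1)z^0(x_2)\,dA\ \ge 0;$$ it is attained by the feedback $u(t)=\int_0^1K(x)z(x,t)\,dx=-\beta R^{-1}\int_0^1P(x,1)z(x,t)\,dx$, and a control is optimal if and only if it satisfies this relation along its own trajectory for almost every $t>0$. If $\iint_S P\,f f\,dA\ge0$ for all $f\in L^2[0,1]$, then the closed loop trajectory tends to $0$ from every $z^0$. **(2)**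 For $n\ge0$ let $\nu_n$ be the root of $\nu\sin\nu=\beta\cos\nu$ in $(n\pi,(n+\tfrac12)\pi)$, $\lambda_n=-\nu_n^2$, $\phi_n(x)=c_n\cos\nu_nx$ with $c_n=\operatorname{sign}(\cos\nu_n)\sqrt{4\nu_n/(2\nu_n+\sin2\nu_n)}$, and $P_{n_1,n_2}=\iint_S P(x_1,x_2)\phi_{n_1}(x_1)\phi_{n_2}(x_2)\,dA$, $Q_{n_1,n_2}=\iint_S Q(x_1,x_2)\phi_{n_1}(x_1)\phi_{n_2}(x_2)\,dA$. Then $P(x_1,x_2)=\sum_{n_1,n_2}P_{n_1,n_2}\phi_{n_1}(x_1)\phi_{n_2}(x_2)$ in $L^2(S)$, $P_{n_1,n_2}=P_{n_2,n_1}$, and $P$ is a weak solution of the Riccati PDE with its boundary conditions if and only if, for all $n_1,n_2\ge0$, $$(\lambda_{n_1}+\lambda_{n_2})P_{n_1,n_2}+Q_{n_1,n_2}=\beta^2R^{-1}\sum_{m_1,m_2=0}^\infty P_{n_1,m_1}P_{n_2,m_2}\,\phi_{m_1}(1)\phi_{m_2}(1),$$ the double series being absolutely convergent. -/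

import Mathlib

open MeasureTheory Set Filter Topology

noncomputable section

namespace HeatLQR

/-- The rod `[0,1]`, with Lebesgue measure. -/
abbrev Rod : Type := ↥unitInterval

/-- The state space `L²[0,1]`. -/
abbrev L2 : Type := Lp ℝ 2 (volume : Measure Rod)

/-- `z` (a curve in `L²[0,1]`, with continuous representative `Z t` of `z t` for a.e. `t > 0`) is the
temperature of the rod with initial temperature `z0` under the locally square-integrable
control `u`: it is the weak solution, in `C([0,∞); L²) ∩ L²_loc([0,∞); C[0,1])`, of
`z_t = z_xx`, `z(·,0) = z0`, `z_x(0,t) = 0`, `z_x(1,t) = β (u(t) - z(1,t))`.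
In the field `weak` the equation has been multiplied by `θ`, integrated over `[0,1] × [0,t]`, and
integrated by parts twice in `x`, with `z_x` at `x = 0, 1` replaced by its prescribed values. -/
structure IsTrajectory (β : ℝ) (z0 : L2) (u : ℝ → ℝ) (z : ℝ → L2) (Z : ℝ → C(Rod, ℝ)) :
    Prop where
  control : ∀ T : ℝ, MemLp u 2 (volume.restrict (Ioc 0 T))
  continuousOn : ContinuousOn z (Ici 0)
  initial : z 0 = z0
  representative : ∀ᵐ t ∂(volume.restrict (Ioi (0 : ℝ))),
    ContinuousMap.toLp 2 (volume : Measure Rod) ℝ (Z t) = z t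
  memLp : ∀ T : ℝ, MemLp Z 2 (volume.restrict (Ioc 0 T))
  weak : ∀ θ : ℝ → ℝ, ContDiff ℝ 2 θ → ∀ t : ℝ, 0 ≤ t →
    (∫ x : Rod, θ x * z t x) - (∫ x : Rod, θ x * z0 x) =
      ∫ s in (0 : ℝ)..t,
        ((∫ x : Rod, deriv (deriv θ) x * Z s x)
          + deriv θ 0 * Z s 0 - deriv θ 1 * Z s 1 + θ 1 * (β * (u s - Z s 1)))

/-- The criterion `∫₀^∞ (∬ Q z z + R u²) dt`, a number in `[0,∞]`. The generalized function `Q` is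
given by the bilinear form `(f, g) ↦ ∬ Q(x₁,x₂) f(x₁) g(x₂) dA`. -/
def cost (Q : C(Rod, ℝ) →L[ℝ] C(Rod, ℝ) →L[ℝ] ℝ) (R : ℝ) (u : ℝ → ℝ) (Z : ℝ → C(Rod, ℝ)) :
    ENNReal :=
  ∫⁻ t in Ioi (0 : ℝ), ENNReal.ofReal (Q (Z t) (Z t) + R * u t ^ 2)

/-- `∬ P(x₁,x₂) f(x₁) f(x₂) dA`. -/
def quadForm (P : C(Rod × Rod, ℝ)) (f : L2) : ℝ :=
  ∫ p : Rod × Rod, P p * f p.1 * f p.2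

/-- The pairing of `∇²P` with `θ(x₁) θ(x₂)` for a kernel `P` that is only continuous: the value of
`∬ ∇²P(x₁,x₂) θ(x₁) θ(x₂) dA` after two integrations by parts in each variable, where the normal
derivatives of `P` on the boundary are replaced according to the boundary conditions
`∂P/∂xᵢ = 0` at `xᵢ = 0` and `∂P/∂xᵢ = -β P` at `xᵢ = 1`. -/
def weakLaplacian (β : ℝ) (P : C(Rod × Rod, ℝ)) (θ : ℝ → ℝ) : ℝ :=
  (∫ x₂ : Rod, ((∫ x₁ : Rod, P (x₁, x₂) * deriv (deriv θ) x₁)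
      + P (0, x₂) * deriv θ 0 - P (1, x₂) * deriv θ 1 - β * P (1, x₂) * θ 1) * θ x₂)
  + (∫ x₁ : Rod, ((∫ x₂ : Rod, P (x₁, x₂) * deriv (deriv θ) x₂)
      + P (x₁, 0) * deriv θ 0 - P (x₁, 1) * deriv θ 1 - β * P (x₁, 1) * θ 1) * θ x₁)

/-- A function on the real line, continuous, restricted to the rod. -/
def onRod (θ : ℝ → ℝ) (hθ : Continuous θ) : C(Rod, ℝ) :=
  ⟨fun x => θ x, hθ.comp continuous_subtype_val⟩

/-- `P` is a weak solution of the Riccati equation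
`∇²P(x₁,x₂) + Q(x₁,x₂) = β² R⁻¹ P(x₁,1) P(1,x₂)` with the Neumann conditions at `xᵢ = 0` and the
Robin conditions at `xᵢ = 1`. -/
def IsWeakRiccatiSolution (β R : ℝ) (Q : C(Rod, ℝ) →L[ℝ] C(Rod, ℝ) →L[ℝ] ℝ)
    (P : C(Rod × Rod, ℝ)) : Prop :=
  ∀ (θ : ℝ → ℝ) (hθ : ContDiff ℝ 2 θ),
    weakLaplacian β P θ + Q (onRod θ hθ.continuous) (onRod θ hθ.continuous) =
      ∫ p : Rod × Rod, β ^ 2 * R⁻¹ * P (p.1, 1) * P (1, p.2) * θ p.1 * θ p.2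

/-- The gain `K(x) = -β R⁻¹ P(x,1)`. -/
def gain (β R : ℝ) (P : C(Rod × Rod, ℝ)) (x : Rod) : ℝ := -β * R⁻¹ * P (x, 1)

/-- The control `u(t) = ∫ K(x) z(x,t) dx` along the curve `z`. -/
def feedback (K : Rod → ℝ) (z : ℝ → L2) (t : ℝ) : ℝ := ∫ x : Rod, K x * z t x

theorem exists_frequency {β : ℝ} (hβ : 0 < β) (n : ℕ) :
    ∃ ν ∈ Ioo ((n : ℝ) * Real.pi) (((n : ℝ) + 1 / 2) * Real.pi),
      ν * Real.sin ν = β * Real.cos ν := by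
  have hpi := Real.pi_pos
  have hn : (0 : ℝ) ≤ n := Nat.cast_nonneg n
  have hle : (n : ℝ) * Real.pi ≤ ((n : ℝ) + 1 / 2) * Real.pi := by nlinarith
  have hc : ContinuousOn (fun ν : ℝ => (-1) ^ n * (ν * Real.sin ν - β * Real.cos ν))
      (Icc ((n : ℝ) * Real.pi) (((n : ℝ) + 1 / 2) * Real.pi)) := by fun_prop
  have hsq : ((-1 : ℝ) ^ n) * (-1) ^ n = 1 := by rw [← mul_pow]; simp
  have e : ((n : ℝ) + 1 / 2) * Real.pi = (n : ℝ) * Real.pi + Real.pi / 2 := by ring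
  have h0 : (-1 : ℝ) ^ n * ((n * Real.pi) * Real.sin (n * Real.pi)
      - β * Real.cos (n * Real.pi)) = -β := by
    rw [Real.sin_nat_mul_pi, Real.cos_nat_mul_pi]
    linear_combination (-β) * hsq
  have h1 : (-1 : ℝ) ^ n * ((((n : ℝ) + 1 / 2) * Real.pi) * Real.sin (((n : ℝ) + 1 / 2) * Real.pi)
      - β * Real.cos (((n : ℝ) + 1 / 2) * Real.pi)) = ((n : ℝ) + 1 / 2) * Real.pi := by
    rw [e, Real.sin_add_pi_div_two, Real.cos_add_pi_div_two, Real.sin_nat_mul_pi,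
      Real.cos_nat_mul_pi]
    linear_combination (n * Real.pi + Real.pi / 2) * hsq
  have := intermediate_value_Ioo hle hc
  have h0m : (0 : ℝ) ∈ (fun ν : ℝ => (-1 : ℝ) ^ n * (ν * Real.sin ν - β * Real.cos ν)) ''
      Ioo ((n : ℝ) * Real.pi) (((n : ℝ) + 1 / 2) * Real.pi) := by
    apply this
    simp only [mem_Ioo]
    rw [h0, h1]
    exact ⟨by linarith, by positivity⟩
  obtain ⟨ν, hν, hz⟩ := h0m
  refine ⟨ν, hν, ?_⟩
  have : ν * Real.sin ν - β * Real.cos ν = 0 := by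
    rcases mul_eq_zero.mp hz with h | h
    · exact absurd h (pow_ne_zero _ (by norm_num))
    · exact h
  linarith

open Classical in
/-- `ν_n`, the root of `ν sin ν = β cos ν` in `(nπ, (n+1/2)π)` (for `β > 0`). -/
def frequency (β : ℝ) (n : ℕ) : ℝ :=
  if h : ∃ ν ∈ Ioo ((n : ℝ) * Real.pi) (((n : ℝ) + 1 / 2) * Real.pi),
      ν * Real.sin ν = β * Real.cos ν then h.choose else 0

theorem frequency_spec {β : ℝ} (hβ : 0 < β) (n : ℕ) :
    frequency β n ∈ Ioo ((n : ℝ) * Real.pi) (((n : ℝ) + 1 / 2) * Real.pi) ∧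
      frequency β n * Real.sin (frequency β n) = β * Real.cos (frequency β n) := by
  have h := exists_frequency hβ n
  rw [frequency, dif_pos h]
  exact h.choose_spec

/-- The open loop eigenvalue `λ_n = -ν_n²`. -/
def eigenvalue (β : ℝ) (n : ℕ) : ℝ := -frequency β n ^ 2

/-- The normalized open loop eigenfunction `φ_n(x) = c_n cos (ν_n x)`, where
`c_n = sign (cos ν_n) √(4 ν_n / (2 ν_n + sin (2 ν_n)))`. -/
def eigenfunction (β : ℝ) (n : ℕ) : C(Rod, ℝ) :=
  ⟨fun x => Real.sign (Real.cos (frequency β n)) *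
      Real.sqrt (4 * frequency β n / (2 * frequency β n + Real.sin (2 * frequency β n))) *
      Real.cos (frequency β n * x), by fun_prop⟩

/-- `φ_m(x₁) φ_n(x₂)`. -/
def eigenfunctionProd (β : ℝ) (m n : ℕ) : C(Rod × Rod, ℝ) :=
  ⟨fun p => eigenfunction β m p.1 * eigenfunction β n p.2, by fun_prop⟩

/-- The coordinate `P_{m,n} = ∬ P(x₁,x₂) φ_m(x₁) φ_n(x₂) dA`. -/
def coeff (β : ℝ) (P : C(Rod × Rod, ℝ)) (m n : ℕ) : ℝ :=
  ∫ p : Rod × Rod, P p * eigenfunction β m p.1 * eigenfunction β n p.2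

/-- The algebraic Riccati equation for the infinite matrix `p = (p_{m,n})`, where
`Q_{m,n} = ∬ Q(x₁,x₂) φ_m(x₁) φ_n(x₂) dA`:
`(λ_m + λ_n) p_{m,n} + Q_{m,n} = β² R⁻¹ ∑_{i,j} p_{m,i} p_{n,j} φ_i(1) φ_j(1)`,
all the double series being (absolutely) convergent. -/
def IsAlgebraicRiccatiSolution (β R : ℝ) (Q : C(Rod, ℝ) →L[ℝ] C(Rod, ℝ) →L[ℝ] ℝ)
    (p : ℕ → ℕ → ℝ) : Prop :=
  ∀ m n : ℕ,
    Summable (fun i : ℕ × ℕ =>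
      p m i.1 * p n i.2 * eigenfunction β i.1 1 * eigenfunction β i.2 1) ∧
    (eigenvalue β m + eigenvalue β n) * p m n + Q (eigenfunction β m) (eigenfunction β n) =
      β ^ 2 * R⁻¹ * ∑' i : ℕ × ℕ,
        p m i.1 * p n i.2 * eigenfunction β i.1 1 * eigenfunction β i.2 1

end HeatLQR

end

/-!
Everything is done in the orthonormal basis `φ_n` of eigenfunctions of `∂ₓ²` with the boundary
conditions `y'(0) = 0`, `y'(1) = -β y(1)`. It is complete (`eigenbasis`) because the Green
function `1/β + 1 - max(x,y)` of this boundary value problem defines an injective, compact,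
symmetric operator whose eigenvectors are found by solving `-Y'' = μ⁻¹ Y` explicitly.

*The Riccati equation.* Green's identity (`robinForm_symm`) turns the weak equation into the
equations `(λ_m + λ_n) P_{m,n} + Q_{m,n} = β² R⁻¹ κ_m κ_n` with `κ_n = ∫ P(1,x) φ_n(x) dx`:
polarization gives them from the weak equation, and conversely the expansion of a `C²` test
function converges absolutely. Since `κ_m κ_n` and `Q_{m,n}` are bounded, `P_{m,n} = O(1/|λ_n|)`,
and `∑ 1/|λ_n|` is finite; so `κ_n = ∑_i P_{n,i} φ_i(1)`, which is the algebraic equation.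
Starting from the algebraic equation, the same summability follows from the convergence of its
double series, as the numbers `φ_i(1)` stay away from zero (`isWeakRiccatiSolution_iff`).

*The dynamics.* A trajectory is the same as a continuous curve in `L²` whose coordinates solve
`z_n' = λ_n z_n + β φ_n(1) u` (`HasModalDynamics`). The energy inequality for these equations,
summed over `n`, bounds `‖z‖²` by a multiple of `∫ u²` and shows that `∑ |λ_n| z_n²` is locally
integrable in time; by the Cauchy–Schwarz inequality the expansion of `z(t)` then converges
uniformly for almost every `t`. Consequences are uniqueness for feedback controls by Grönwall's
inequality, existence by a contraction argument in an exponentially weighted norm, and the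
convergence `z(t) → 0` for every square-integrable control (`HasModalDynamics.tendsto_zero`).

*Optimality.* Along any trajectory, completion of squares gives
`∫₀ᵗ (∬ Q z z + R u²) = ∬ P z⁰ z⁰ - ∬ P z(t) z(t) + ∫₀ᵗ R (u - ∫ K z)²`
(`IsModalRiccatiSolution.integral_cost`), proved for truncated expansions by the product rule and
carried over by dominated convergence. A control of finite cost is square-integrable, hence takes
the state to zero, so that its cost exceeds `∬ P z⁰ z⁰` by exactly `∫₀^∞ R (u - ∫ K z)²`. If `P`
is nonnegative, the identity bounds the cost of the closed loop by `∬ P z⁰ z⁰`, and the closed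
loop is stable for the same reason.
-/

noncomputable section

namespace HeatLQR

/-! ### The embedding into `L²` and integral operators with continuous kernels -/

/-- The embedding of the continuous functions into `L²[0,1]`. -/
def toL2 : C(Rod, ℝ) →L[ℝ] L2 := ContinuousMap.toLp 2 (volume : Measure Rod) ℝ

theorem coeFn_toL2 (f : C(Rod, ℝ)) : ⇑(toL2 f) =ᵐ[volume] f :=
  ContinuousMap.coeFn_toLp (p := 2) (𝕜 := ℝ) volume f

/-- Every nonempty relatively open subset of the rod meets `(0,1)`, hence has positive measure. -/
instance isOpenPosMeasure_rod : (volume : Measure Rod).IsOpenPosMeasure := by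
  refine ⟨fun U hU hne h0 => ?_⟩
  obtain ⟨V, hV, rfl⟩ := isOpen_induced_iff.mp hU
  obtain ⟨x, hx⟩ := hne
  have hxV : (x : ℝ) ∈ V := hx
  have hcl : (x : ℝ) ∈ closure (Ioo (0 : ℝ) 1) := by
    rw [closure_Ioo zero_ne_one]; exact x.2
  obtain ⟨y, hyV, hy⟩ := mem_closure_iff.mp hcl V hV hxV
  have hpos : 0 < volume (V ∩ Ioo (0 : ℝ) 1) :=
    (hV.inter isOpen_Ioo).measure_pos _ ⟨y, hyV, hy⟩
  have hle : volume (V ∩ Ioo (0 : ℝ) 1) ≤ volume (((↑) : Rod → ℝ) ⁻¹' V) := by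
    rw [unitInterval.volume_apply]
    refine measure_mono ?_
    rintro z ⟨hz, hz'⟩
    exact ⟨⟨z, Ioo_subset_Icc_self hz'⟩, hz, rfl⟩
  exact absurd (h0 ▸ hle) (not_le.mpr hpos)

theorem toL2_injective : Function.Injective toL2 :=
  ContinuousMap.toLp_injective (volume : Measure Rod)

theorem norm_toL2_le (f : C(Rod, ℝ)) : ‖toL2 f‖ ≤ ‖f‖ := by
  have h := ContinuousMap.toLp_norm_le (p := 2) (𝕜 := ℝ) (E := ℝ) (volume : Measure Rod)
  have h1 : ‖toL2‖ ≤ 1 := by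
    refine h.trans ?_
    have : measureUnivNNReal (volume : Measure Rod) = 1 := by
      simp [measureUnivNNReal]
    simp [this]
  simpa using (toL2.le_opNorm f).trans (mul_le_mul_of_nonneg_right h1 (norm_nonneg f))

theorem inner_toL2 (f : C(Rod, ℝ)) (g : L2) : inner ℝ (toL2 f) g = ∫ x : Rod, f x * g x := by
  rw [L2.inner_def]
  refine integral_congr_ae ?_
  filter_upwards [coeFn_toL2 f] with x hx
  simp [hx, mul_comm]

theorem inner_toL2_toL2 (f g : C(Rod, ℝ)) :
    inner ℝ (toL2 f) (toL2 g) = ∫ x : Rod, f x * g x := by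
  rw [inner_toL2]
  refine integral_congr_ae ?_
  filter_upwards [coeFn_toL2 g] with x hx
  simp [hx]

theorem integrable_of_continuous {f : Rod → ℝ} (hf : Continuous f) : Integrable f :=
  hf.integrable_of_hasCompactSupport (HasCompactSupport.of_compactSpace f)

theorem integral_rod (f : ℝ → ℝ) : ∫ x : Rod, f x = ∫ x in (0 : ℝ)..1, f x := by
  rw [intervalIntegral.integral_of_le zero_le_one, ← integral_Icc_eq_integral_Ioc]
  exact unitInterval.measurePreserving_coe.integral_comp unitInterval.measurableEmbedding_coe f

/-- The integral operator `f ↦ ∫ k(·,y) f(y) dy`, from `L²[0,1]` to `C[0,1]`, written as the inner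
product with the slices `k(x,·)`. -/
def kernelOp (k : C(Rod × Rod, ℝ)) : L2 →L[ℝ] C(Rod, ℝ) :=
  LinearMap.mkContinuous
    { toFun := fun f => ⟨fun x => inner ℝ (toL2 (k.curry x)) f,
        Continuous.inner (𝕜 := ℝ) (E := L2) (toL2.continuous.comp k.curry.continuous)
          (continuous_const (y := f))⟩
      map_add' := fun f g => by ext x; exact inner_add_right (𝕜 := ℝ) (E := L2) _ _ _
      map_smul' := fun c f => by ext x; exact inner_smul_right (𝕜 := ℝ) (E := L2) _ _ _ }
    ‖k.curry‖ (fun f => by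
      refine (ContinuousMap.norm_le _ (by positivity)).mpr fun x => ?_
      refine (norm_inner_le_norm (𝕜 := ℝ) (E := L2) _ _).trans ?_
      gcongr
      exact (norm_toL2_le _).trans (k.curry.norm_coe_le_norm x))

theorem kernelOp_apply (k : C(Rod × Rod, ℝ)) (f : L2) (x : Rod) :
    kernelOp k f x = inner ℝ (toL2 (k.curry x)) f := rfl

theorem kernelOp_apply_eq_integral (k : C(Rod × Rod, ℝ)) (f : L2) (x : Rod) :
    kernelOp k f x = ∫ y : Rod, k (x, y) * f y := by
  rw [kernelOp_apply, inner_toL2]; rfl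

theorem kernelOp_toL2_apply (k : C(Rod × Rod, ℝ)) (f : C(Rod, ℝ)) (x : Rod) :
    kernelOp k (toL2 f) x = ∫ y : Rod, k (x, y) * f y := by
  rw [kernelOp_apply, inner_toL2_toL2]; rfl

/-- Integral operators with a continuous kernel are compact, by the Arzelà–Ascoli theorem: the
image of the unit ball inherits the modulus of continuity of `x ↦ k(x,·)`. -/
theorem isCompactOperator_kernelOp (k : C(Rod × Rod, ℝ)) : IsCompactOperator (kernelOp k) := by
  refine (isCompactOperator_iff_isCompact_closure_image_closedBall
    ((kernelOp k : L2 →L[ℝ] C(Rod, ℝ)) : L2 →ₗ[ℝ] C(Rod, ℝ)) zero_lt_one).mpr ?_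
  let e := ContinuousMap.isometryEquivBoundedOfCompact Rod ℝ
  let A : Set (BoundedContinuousFunction Rod ℝ) := e '' (kernelOp k '' Metric.closedBall 0 1)
  have key : IsCompact (closure A) := by
    refine BoundedContinuousFunction.arzela_ascoli (Icc (-‖k.curry‖) ‖k.curry‖) isCompact_Icc A
      ?_ ?_
    · rintro _ x ⟨_, ⟨f, hf, rfl⟩, rfl⟩
      rw [mem_Icc, ← abs_le]
      change ‖kernelOp k f x‖ ≤ _
      rw [kernelOp_apply]
      refine (norm_inner_le_norm _ _).trans ?_
      have h1 : ‖f‖ ≤ 1 := by simpa using hf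
      calc ‖toL2 (k.curry x)‖ * ‖f‖ ≤ ‖k.curry‖ * 1 := by
            gcongr
            exact (norm_toL2_le _).trans (k.curry.norm_coe_le_norm x)
        _ = _ := mul_one _
    · intro x₀
      refine Metric.equicontinuousAt_of_continuity_modulus
        (fun x => ‖k.curry x₀ - k.curry x‖) ?_ _ (Eventually.of_forall ?_)
      · have : Continuous fun x => ‖k.curry x₀ - k.curry x‖ :=
          (continuous_const.sub k.curry.continuous).norm
        simpa using this.tendsto x₀
      · rintro x ⟨_, ⟨_, ⟨f, hf, rfl⟩, rfl⟩⟩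
        have h1 : ‖f‖ ≤ 1 := by simpa using hf
        change dist (kernelOp k f x₀) (kernelOp k f x) ≤ _
        rw [dist_eq_norm, kernelOp_apply, kernelOp_apply, ← inner_sub_left, ← map_sub]
        refine (norm_inner_le_norm _ _).trans ?_
        calc ‖toL2 (k.curry x₀ - k.curry x)‖ * ‖f‖ ≤ ‖k.curry x₀ - k.curry x‖ * 1 := by
              gcongr
              exact norm_toL2_le _
          _ = _ := mul_one _
  have h2 : closure A = e '' closure (kernelOp k '' Metric.closedBall 0 1) :=
    (e.toHomeomorph.image_closure _).symm
  rw [h2] at key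
  exact e.toHomeomorph.isCompact_image.mp key

theorem integrable_kernel_mul (k : C(Rod × Rod, ℝ)) {f g : Rod → ℝ} (hf : Integrable f)
    (hg : Integrable g) : Integrable (fun p : Rod × Rod => k p * f p.1 * g p.2) := by
  have h := (hf.mul_prod hg).bdd_mul (c := ‖k‖) k.continuous.aestronglyMeasurable
    (Eventually.of_forall fun p => k.norm_coe_le_norm p)
  simpa only [mul_assoc] using! h

theorem integral_kernel_mul (k : C(Rod × Rod, ℝ)) {f g : Rod → ℝ} (hf : Integrable f)
    (hg : Integrable g) :
    ∫ p : Rod × Rod, k p * f p.1 * g p.2 = ∫ x : Rod, (∫ y : Rod, k (x, y) * g y) * f x := by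
  rw [Measure.volume_eq_prod, integral_prod _ (integrable_kernel_mul k hf hg)]
  refine integral_congr_ae (Eventually.of_forall fun x => ?_)
  simp only
  rw [← integral_mul_const]
  refine integral_congr_ae (Eventually.of_forall fun y => ?_)
  simp only
  ring

theorem integral_kernel_mul' (k : C(Rod × Rod, ℝ)) {f g : Rod → ℝ} (hf : Integrable f)
    (hg : Integrable g) :
    ∫ p : Rod × Rod, k p * f p.1 * g p.2 = ∫ y : Rod, (∫ x : Rod, k (x, y) * f x) * g y := by
  rw [Measure.volume_eq_prod, integral_prod_symm _ (integrable_kernel_mul k hf hg)]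
  refine integral_congr_ae (Eventually.of_forall fun x => ?_)
  simp only
  rw [← integral_mul_const]

theorem L2.integrable (f : L2) : Integrable f := (Lp.memLp f).integrable (by norm_num)

theorem inner_kernelOp (k : C(Rod × Rod, ℝ)) (f g : L2) :
    inner ℝ (toL2 (kernelOp k g)) f = ∫ p : Rod × Rod, k p * f p.1 * g p.2 := by
  rw [integral_kernel_mul k (L2.integrable f) (L2.integrable g), inner_toL2]
  simp only [kernelOp_apply_eq_integral]

theorem quadForm_eq_inner (P : C(Rod × Rod, ℝ)) (f : L2) :
    quadForm P f = inner ℝ (toL2 (kernelOp P f)) f :=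
  (inner_kernelOp P f f).symm

theorem inner_kernelOp_toL2 (k : C(Rod × Rod, ℝ)) (f g : C(Rod, ℝ)) :
    inner ℝ (toL2 (kernelOp k (toL2 g))) (toL2 f) = ∫ p : Rod × Rod, k p * f p.1 * g p.2 := by
  rw [integral_kernel_mul k (integrable_of_continuous f.continuous)
    (integrable_of_continuous g.continuous), inner_toL2_toL2]
  simp only [kernelOp_toL2_apply]

theorem inner_kernelOp_symm {k : C(Rod × Rod, ℝ)} (hk : ∀ x y, k (x, y) = k (y, x)) (f g : L2) :
    inner ℝ (toL2 (kernelOp k g)) f = inner ℝ (toL2 (kernelOp k f)) g := by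
  rw [inner_kernelOp, integral_kernel_mul' k (L2.integrable f) (L2.integrable g), inner_toL2]
  simp only [kernelOp_apply_eq_integral, hk]

/-! ### Eigenvalues and eigenfunctions of the Robin Laplacian -/

section Frequencies

variable {β : ℝ}

theorem frequency_pos (hβ : 0 < β) (n : ℕ) : 0 < frequency β n := by
  have h := (frequency_spec hβ n).1.1
  have := Real.pi_pos
  exact lt_of_le_of_lt (by positivity) h

theorem cos_frequency_ne_zero (hβ : 0 < β) (n : ℕ) : Real.cos (frequency β n) ≠ 0 := by
  intro h
  have h1 := (frequency_spec hβ n).2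
  rw [h, mul_zero] at h1
  have h2 := (mul_eq_zero.mp h1).resolve_left (frequency_pos hβ n).ne'
  have := Real.sin_sq_add_cos_sq (frequency β n)
  rw [h, h2] at this
  norm_num at this

theorem frequency_strictMono (hβ : 0 < β) : StrictMono (frequency β) := by
  refine strictMono_nat_of_lt_succ fun n => ?_
  have h1 := (frequency_spec hβ n).1.2
  have h2 := (frequency_spec hβ (n + 1)).1.1
  have := Real.pi_pos
  push_cast at h2
  nlinarith

theorem eigenvalue_neg (hβ : 0 < β) (n : ℕ) : eigenvalue β n < 0 := by
  have := frequency_pos hβ n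
  unfold eigenvalue
  nlinarith

theorem abs_eigenvalue_pos (hβ : 0 < β) (n : ℕ) : 0 < |eigenvalue β n| :=
  abs_pos.mpr (eigenvalue_neg hβ n).ne

theorem abs_eigenvalue_mono (hβ : 0 < β) {m n : ℕ} (h : m ≤ n) :
    |eigenvalue β m| ≤ |eigenvalue β n| := by
  have h1 := frequency_pos hβ m
  have h2 := (frequency_strictMono hβ).monotone h
  rw [abs_of_neg (eigenvalue_neg hβ m), abs_of_neg (eigenvalue_neg hβ n)]
  unfold eigenvalue
  nlinarith

theorem eigenvalue_injective (hβ : 0 < β) : Function.Injective (eigenvalue β) := by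
  intro m n h
  unfold eigenvalue at h
  have h1 := frequency_pos hβ m
  have h2 := frequency_pos hβ n
  refine (frequency_strictMono hβ).injective ?_
  exact (sq_eq_sq₀ h1.le h2.le).mp (neg_injective h)

theorem summable_inv_abs_eigenvalue (hβ : 0 < β) : Summable fun n => |eigenvalue β n|⁻¹ := by
  rw [← summable_nat_add_iff 1]
  have hs : Summable fun n : ℕ => (((n + 1 : ℕ) : ℝ) ^ 2)⁻¹ :=
    (summable_nat_add_iff 1).mpr (Real.summable_nat_pow_inv.mpr one_lt_two)
  refine hs.of_nonneg_of_le (fun n => by positivity) fun n => ?_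
  rw [abs_of_neg (eigenvalue_neg hβ _)]
  unfold eigenvalue
  rw [neg_neg]
  have h1 := (frequency_spec hβ (n + 1)).1.1
  have h3 : (0 : ℝ) < ((n + 1 : ℕ) : ℝ) := by positivity
  have h2 : ((n + 1 : ℕ) : ℝ) ≤ ((n + 1 : ℕ) : ℝ) * Real.pi := by
    nlinarith [Real.pi_gt_three]
  gcongr
  linarith

/-- The normalizing factor `c_n` of the eigenfunction `φ_n`. -/
def eigenScale (β : ℝ) (n : ℕ) : ℝ :=
  Real.sign (Real.cos (frequency β n)) *
    Real.sqrt (4 * frequency β n / (2 * frequency β n + Real.sin (2 * frequency β n)))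

/-- The eigenfunction `φ_n` as a function on the whole line. -/
def eigenfunctionExt (β : ℝ) (n : ℕ) (x : ℝ) : ℝ := eigenScale β n * Real.cos (frequency β n * x)

theorem eigenfunction_apply (n : ℕ) (x : Rod) :
    eigenfunction β n x = eigenfunctionExt β n x := rfl

theorem sin_two_frequency_nonneg (hβ : 0 < β) (n : ℕ) : 0 ≤ Real.sin (2 * frequency β n) := by
  have h1 := (frequency_spec hβ n).2
  have h2 := frequency_pos hβ n
  have h3 : 0 ≤ frequency β n * Real.sin (2 * frequency β n) := by
    have : frequency β n * Real.sin (2 * frequency β n) =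
        2 * β * Real.cos (frequency β n) ^ 2 := by
      rw [Real.sin_two_mul]
      linear_combination 2 * Real.cos (frequency β n) * h1
    rw [this]
    positivity
  exact nonneg_of_mul_nonneg_right h3 h2

theorem eigenScale_sq (hβ : 0 < β) (n : ℕ) : eigenScale β n ^ 2 =
    4 * frequency β n / (2 * frequency β n + Real.sin (2 * frequency β n)) := by
  have h1 := frequency_pos hβ n
  have h2 := sin_two_frequency_nonneg hβ n
  have h3 : Real.sign (Real.cos (frequency β n)) ^ 2 = 1 := by
    rcases Real.sign_apply_eq_of_ne_zero _ (cos_frequency_ne_zero hβ n) with h | h <;>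
      rw [h] <;> norm_num
  rw [eigenScale, mul_pow, h3, one_mul, Real.sq_sqrt (by positivity)]

theorem eigenScale_sq_le (hβ : 0 < β) (n : ℕ) : eigenScale β n ^ 2 ≤ 2 := by
  have h1 := frequency_pos hβ n
  have h2 := sin_two_frequency_nonneg hβ n
  rw [eigenScale_sq hβ, div_le_iff₀ (by positivity)]
  linarith

theorem one_le_eigenScale_sq (hβ : 0 < β) (n : ℕ) : 1 ≤ eigenScale β n ^ 2 := by
  have h1 := frequency_pos hβ n
  have h2 := sin_two_frequency_nonneg hβ n
  have h3 := Real.sin_le (x := 2 * frequency β n) (by positivity)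
  rw [eigenScale_sq hβ, le_div_iff₀ (by positivity)]
  linarith

theorem abs_eigenfunction_le (hβ : 0 < β) (n : ℕ) (x : Rod) : |eigenfunction β n x| ≤ 2 := by
  rw [eigenfunction_apply, eigenfunctionExt, abs_mul]
  have h1 : |eigenScale β n| ≤ 2 := abs_le_of_sq_le_sq (by
    linarith [eigenScale_sq_le hβ n]) (by norm_num)
  have h2 := Real.abs_cos_le_one (frequency β n * x)
  nlinarith [abs_nonneg (eigenScale β n), abs_nonneg (Real.cos (frequency β n * x))]

theorem norm_eigenfunction_le (hβ : 0 < β) (n : ℕ) : ‖eigenfunction β n‖ ≤ 2 :=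
  (ContinuousMap.norm_le _ (by norm_num)).mpr (abs_eigenfunction_le hβ n)

/-- The boundary values `φ_n(1)` stay away from zero. -/
theorem exists_le_abs_eigenfunction_one (hβ : 0 < β) :
    ∃ δ > 0, ∀ n, δ ≤ |eigenfunction β n 1| := by
  have h0 := frequency_pos hβ 0
  -- by the frequency equation `cos² ν_n = ν_n² / (ν_n² + β²)`, which increases with `n`
  refine ⟨Real.sqrt (frequency β 0 ^ 2 / (frequency β 0 ^ 2 + β ^ 2)), by positivity, fun n => ?_⟩
  refine Real.sqrt_le_iff.mpr ⟨abs_nonneg _, ?_⟩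
  have h1 := (frequency_spec hβ n).2
  have h2 := (frequency_strictMono hβ).monotone (Nat.zero_le n)
  have h3 := one_le_eigenScale_sq hβ n
  have h4 := Real.sin_sq_add_cos_sq (frequency β n)
  have h5 : Real.cos (frequency β n) ^ 2 * (frequency β n ^ 2 + β ^ 2) = frequency β n ^ 2 := by
    have := congrArg (· ^ 2) h1
    simp only [mul_pow] at this
    linear_combination (frequency β n ^ 2) * h4 - this
  have h6 : Real.cos (frequency β n) ^ 2 ≤ |eigenfunction β n 1| ^ 2 := by
    rw [sq_abs, eigenfunction_apply, eigenfunctionExt, mul_pow]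
    simp only [Icc.coe_one, mul_one]
    nlinarith [sq_nonneg (Real.cos (frequency β n))]
  refine le_trans ?_ h6
  rw [div_le_iff₀ (by positivity)]
  have h7 : Real.cos (frequency β n) ^ 2 ≤ 1 := Real.cos_sq_le_one _
  have h8 : 0 ≤ (1 - Real.cos (frequency β n) ^ 2) *
      (frequency β n ^ 2 - frequency β 0 ^ 2) :=
    mul_nonneg (by linarith) (by nlinarith)
  nlinarith

end Frequencies

/-- The functional `Z ↦ ∫ θ'' Z + θ'(0) Z(0) - (θ'(1) + β θ(1)) Z(1)`: the pairing of `∂ₓ² Z` with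
`θ` after two integrations by parts, when `Z` satisfies the homogeneous boundary conditions. -/
def robinForm (β : ℝ) (θ : ℝ → ℝ) (hθ : ContDiff ℝ 2 θ) : C(Rod, ℝ) →L[ℝ] ℝ :=
  (innerSL ℝ (toL2 (onRod (deriv (deriv θ)) (by
    have h1 : ContDiff ℝ 1 (deriv θ) := hθ.deriv'
    exact h1.continuous_deriv le_rfl)))).comp toL2
    + deriv θ 0 • ContinuousMap.evalCLM ℝ (0 : Rod)
    - (deriv θ 1 + β * θ 1) • ContinuousMap.evalCLM ℝ (1 : Rod)

theorem robinForm_apply (β : ℝ) (θ : ℝ → ℝ) (hθ : ContDiff ℝ 2 θ) (Z : C(Rod, ℝ)) :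
    robinForm β θ hθ Z = (∫ x : Rod, deriv (deriv θ) x * Z x) + deriv θ 0 * Z 0
      - (deriv θ 1 + β * θ 1) * Z 1 := by
  simp only [robinForm, sub_apply, add_apply, ContinuousLinearMap.comp_apply, smul_apply,
    innerSL_apply_apply, inner_toL2_toL2, ContinuousMap.evalCLM_apply, smul_eq_mul]
  rfl

theorem hasDerivAt_of_contDiff_two {θ : ℝ → ℝ} (hθ : ContDiff ℝ 2 θ) (x : ℝ) :
    HasDerivAt θ (deriv θ x) x ∧ HasDerivAt (deriv θ) (deriv (deriv θ) x) x := by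
  have h1 : ContDiff ℝ 1 (deriv θ) := hθ.deriv'
  exact ⟨(hθ.differentiable (by norm_num) x).hasDerivAt,
    (h1.differentiable (by norm_num) x).hasDerivAt⟩

/-- Green's identity for the Laplacian with Robin boundary conditions. -/
theorem robinForm_symm (β : ℝ) {θ η : ℝ → ℝ} (hθ : ContDiff ℝ 2 θ) (hη : ContDiff ℝ 2 η) :
    robinForm β θ hθ (onRod η hη.continuous) = robinForm β η hη (onRod θ hθ.continuous) := by
  have c1 : Continuous (deriv (deriv θ)) := ContDiff.continuous_deriv (n := 1) hθ.deriv' le_rfl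
  have c2 : Continuous (deriv (deriv η)) := ContDiff.continuous_deriv (n := 1) hη.deriv' le_rfl
  rw [robinForm_apply, robinForm_apply]
  change (∫ x : Rod, deriv (deriv θ) x * η x) + deriv θ 0 * η (0 : ℝ)
      - (deriv θ 1 + β * θ 1) * η (1 : ℝ) = (∫ x : Rod, deriv (deriv η) x * θ x)
      + deriv η 0 * θ (0 : ℝ) - (deriv η 1 + β * η 1) * θ (1 : ℝ)
  rw [integral_rod (fun x => deriv (deriv θ) x * η x),
    integral_rod (fun x => deriv (deriv η) x * θ x)]
  have i1 : IntervalIntegrable (fun x => deriv (deriv θ) x * η x) volume 0 1 :=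
    (c1.mul hη.continuous).intervalIntegrable _ _
  have i2 : IntervalIntegrable (fun x => deriv (deriv η) x * θ x) volume 0 1 :=
    (c2.mul hθ.continuous).intervalIntegrable _ _
  have key : ∫ x in (0 : ℝ)..1, (deriv (deriv θ) x * η x - deriv (deriv η) x * θ x) =
      (deriv θ 1 * η 1 - deriv η 1 * θ 1) - (deriv θ 0 * η 0 - deriv η 0 * θ 0) := by
    refine intervalIntegral.integral_eq_sub_of_hasDerivAt
      (f := fun x => deriv θ x * η x - deriv η x * θ x) (fun x _ => ?_) (i1.sub i2)
    obtain ⟨a1, a2⟩ := hasDerivAt_of_contDiff_two hθ x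
    obtain ⟨b1, b2⟩ := hasDerivAt_of_contDiff_two hη x
    convert! (a2.mul b1).sub (b2.mul a1) using 1
    ring
  rw [intervalIntegral.integral_sub i1 i2] at key
  linarith

section Eigenfunctions

variable {β : ℝ}

theorem contDiff_eigenfunctionExt (n : ℕ) : ContDiff ℝ 2 (eigenfunctionExt β n) := by
  unfold eigenfunctionExt
  fun_prop

theorem deriv_eigenfunctionExt (n : ℕ) : deriv (eigenfunctionExt β n) =
    fun x => -(eigenScale β n * frequency β n * Real.sin (frequency β n * x)) := by
  funext x
  have h := (((hasDerivAt_id x).const_mul (frequency β n)).cos).const_mul (eigenScale β n)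
  refine (h.congr_deriv ?_).deriv
  simp
  ring

theorem deriv_deriv_eigenfunctionExt (n : ℕ) (x : ℝ) :
    deriv (deriv (eigenfunctionExt β n)) x = eigenvalue β n * eigenfunctionExt β n x := by
  rw [deriv_eigenfunctionExt]
  have h := ((((hasDerivAt_id x).const_mul (frequency β n)).sin).const_mul
    (eigenScale β n * frequency β n)).neg
  refine (h.congr_deriv ?_).deriv
  simp [eigenvalue, eigenfunctionExt]
  ring

/-- For the test function `φ_n` the boundary terms of `robinForm` vanish. -/
theorem robinForm_eigenfunctionExt (hβ : 0 < β) (n : ℕ) (Z : C(Rod, ℝ)) :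
    robinForm β (eigenfunctionExt β n) (contDiff_eigenfunctionExt n) Z =
      eigenvalue β n * inner ℝ (toL2 (eigenfunction β n)) (toL2 Z) := by
  have h1 : deriv (eigenfunctionExt β n) 1 + β * eigenfunctionExt β n 1 = 0 := by
    simp only [deriv_eigenfunctionExt, eigenfunctionExt, mul_one]
    linear_combination (-eigenScale β n) * (frequency_spec hβ n).2
  have h0 : deriv (eigenfunctionExt β n) 0 = 0 := by
    rw [deriv_eigenfunctionExt]
    simp
  rw [robinForm_apply, h1, h0, inner_toL2_toL2, ← integral_const_mul]
  simp only [deriv_deriv_eigenfunctionExt, eigenfunction_apply, zero_mul, add_zero, sub_zero,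
    mul_assoc]

/-- As `φ_n` satisfies the boundary conditions, `∂ₓ² φ_n = λ_n φ_n` also holds weakly, for test
functions `θ` that satisfy none. -/
theorem robinForm_eigenfunction (hβ : 0 < β) {θ : ℝ → ℝ} (hθ : ContDiff ℝ 2 θ) (n : ℕ) :
    robinForm β θ hθ (eigenfunction β n) =
      eigenvalue β n * inner ℝ (toL2 (eigenfunction β n)) (toL2 (onRod θ hθ.continuous)) := by
  rw [← robinForm_eigenfunctionExt hβ n]
  exact robinForm_symm β hθ (contDiff_eigenfunctionExt n)

theorem norm_toL2_eigenfunction (hβ : 0 < β) (n : ℕ) : ‖toL2 (eigenfunction β n)‖ = 1 := by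
  have h : inner ℝ (toL2 (eigenfunction β n)) (toL2 (eigenfunction β n)) = 1 := by
    have hν := frequency_pos hβ n
    have hs := sin_two_frequency_nonneg hβ n
    rw [inner_toL2_toL2]
    change ∫ x : Rod, eigenfunctionExt β n x * eigenfunctionExt β n x = 1
    rw [integral_rod (fun x => eigenfunctionExt β n x * eigenfunctionExt β n x)]
    have key : ∫ x in (0 : ℝ)..1, eigenfunctionExt β n x * eigenfunctionExt β n x =
        eigenScale β n ^ 2 * ((2 * frequency β n * 1 + Real.sin (2 * frequency β n * 1)) /
          (4 * frequency β n)) - eigenScale β n ^ 2 *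
          ((2 * frequency β n * 0 + Real.sin (2 * frequency β n * 0)) / (4 * frequency β n)) := by
      refine intervalIntegral.integral_eq_sub_of_hasDerivAt
        (f := fun x => eigenScale β n ^ 2 * ((2 * frequency β n * x +
          Real.sin (2 * frequency β n * x)) / (4 * frequency β n))) (fun x _ => ?_)
        (((contDiff_eigenfunctionExt n).continuous.mul
          (contDiff_eigenfunctionExt n).continuous).intervalIntegrable _ _)
      have h1 := (hasDerivAt_id x).const_mul (2 * frequency β n)
      have h2 := ((h1.add h1.sin).div_const (4 * frequency β n)).const_mul (eigenScale β n ^ 2)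
      refine h2.congr_deriv ?_
      have h3 : Real.cos (2 * frequency β n * x) = 2 * Real.cos (frequency β n * x) ^ 2 - 1 := by
        rw [mul_assoc, Real.cos_two_mul]
      simp only [id, mul_one, h3, eigenfunctionExt]
      field_simp
      ring
    rw [key, eigenScale_sq hβ]
    simp only [mul_one, mul_zero, Real.sin_zero, add_zero, zero_div, sub_zero]
    have : 2 * frequency β n + Real.sin (2 * frequency β n) ≠ 0 := by positivity
    rw [div_mul_div_comm, mul_comm, div_self (mul_ne_zero this (by positivity))]
  rw [real_inner_self_eq_norm_sq] at h
  exact (pow_eq_one_iff_of_nonneg (norm_nonneg _) two_ne_zero).mp h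

/-- Orthogonality: the symmetry of the Robin Laplacian gives `(λ_m - λ_n) ⟪φ_m, φ_n⟫ = 0`, and the
eigenvalues are distinct. -/
theorem orthonormal_eigenfunction (hβ : 0 < β) :
    Orthonormal ℝ fun n => toL2 (eigenfunction β n) := by
  refine ⟨norm_toL2_eigenfunction hβ, fun m n hmn => ?_⟩
  have h1 := robinForm_eigenfunction hβ (contDiff_eigenfunctionExt (β := β) m) n
  have h2 := robinForm_eigenfunctionExt hβ m (eigenfunction β n)
  have h3 : onRod (eigenfunctionExt β m) (contDiff_eigenfunctionExt (β := β) m).continuous =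
      eigenfunction β m := rfl
  rw [h3, real_inner_comm, h2] at h1
  have h4 : eigenvalue β m - eigenvalue β n ≠ 0 :=
    sub_ne_zero.mpr fun h => hmn (eigenvalue_injective hβ h)
  refine (mul_eq_zero.mp (?_ : (eigenvalue β m - eigenvalue β n) * _ = 0)).resolve_left h4
  linear_combination h1

end Eigenfunctions

/-! ### The Green operator and completeness of the eigenfunctions -/

/-- Product rule for two functions that are primitives of integrable functions. -/
theorem mul_sub_mul_eq_integral {x y f g : ℝ → ℝ} {a b : ℝ} (hab : a ≤ b)
    (hf : IntervalIntegrable f volume a b) (hg : IntervalIntegrable g volume a b)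
    (hx : ∀ t ∈ Icc a b, x t = x a + ∫ s in a..t, f s)
    (hy : ∀ t ∈ Icc a b, y t = y a + ∫ s in a..t, g s) :
    x b * y b - x a * y a = ∫ s in a..b, (f s * y s + x s * g s) := by
  have h1 := hf.absolutelyContinuousOnInterval_intervalIntegral (c := a) (by simp)
  have h2 := hg.absolutelyContinuousOnInterval_intervalIntegral (c := a) (by simp)
  have c1 : AbsolutelyContinuousOnInterval (fun _ : ℝ => x a) a b :=
    contDiffOn_const.absolutelyContinuousOnInterval
  have c2 : AbsolutelyContinuousOnInterval (fun _ : ℝ => y a) a b :=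
    contDiffOn_const.absolutelyContinuousOnInterval
  have key := (c1.fun_add h1).integral_deriv_mul_eq_sub (c2.fun_add h2)
  rw [hx b (right_mem_Icc.mpr hab), hy b (right_mem_Icc.mpr hab)]
  simp only [intervalIntegral.integral_same, add_zero] at key
  rw [← key]
  refine intervalIntegral.integral_congr_ae ?_
  filter_upwards [hf.ae_hasDerivAt_integral, hg.ae_hasDerivAt_integral] with s hs1 hs2 hs
  have hs' : s ∈ uIcc a b := uIoc_subset_uIcc hs
  have d1 := ((hs1 hs' a (by simp)).const_add (x a)).deriv
  have d2 := ((hs2 hs' a (by simp)).const_add (y a)).deriv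
  have hs3 : s ∈ Icc a b := by rwa [uIcc_of_le hab] at hs'
  rw [hx s hs3, hy s hs3]
  erw [d1, d2]

theorem ae_eq_zero_of_primitive_eq_zero {g : ℝ → ℝ} {a b : ℝ}
    (hg : IntervalIntegrable g volume a b)
    (h : ∀ x ∈ Ioo a b, ∫ s in a..x, g s = 0) : ∀ᵐ x, x ∈ Ioo a b → g x = 0 := by
  filter_upwards [hg.ae_hasDerivAt_integral] with x hx hxI
  have hab : a ≤ b := (hxI.1.trans hxI.2).le
  have h1 := hx (by rw [uIcc_of_le hab]; exact Ioo_subset_Icc_self hxI) a (by simp)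
  have h2 : HasDerivAt (fun x => ∫ s in a..x, g s) 0 x :=
    (hasDerivAt_const x (0 : ℝ)).congr_of_eventuallyEq
      (eventually_of_mem (Ioo_mem_nhds hxI.1 hxI.2) h)
  exact h1.unique h2

/-- The Green function of `-∂ₓ²` with the boundary conditions `y'(0) = 0`, `y'(1) = -β y(1)`. -/
def greenKernel (β : ℝ) : C(Rod × Rod, ℝ) :=
  ⟨fun p => 1 / β + 1 - max (p.1 : ℝ) (p.2 : ℝ), by fun_prop⟩

/-- A function on the rod, extended to the line by its boundary values. -/
def rodExtend (f : Rod → ℝ) (s : ℝ) : ℝ := f (projIcc 0 1 zero_le_one s)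

theorem rodExtend_coe (f : Rod → ℝ) (x : Rod) : rodExtend f x = f x := by
  rw [rodExtend, projIcc_val]

theorem continuous_rodExtend {f : Rod → ℝ} (hf : Continuous f) : Continuous (rodExtend f) :=
  hf.comp continuous_projIcc

theorem intervalIntegrable_rodExtend {f : Rod → ℝ} (hf : Integrable f) :
    IntervalIntegrable (rodExtend f) volume 0 1 := by
  rw [intervalIntegrable_iff_integrableOn_Icc_of_le zero_le_one]
  have h := unitInterval.measurePreserving_coe.integrable_comp_emb
    unitInterval.measurableEmbedding_coe (g := rodExtend f)
  refine h.mp ?_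
  simpa only [Function.comp_def, rodExtend_coe] using! hf

/-- With `A` the primitive of `f`, the solution `w` of `-w'' = f` under the Robin conditions is
`A(1)/β + ∫_x^1 A`. -/
theorem kernelOp_greenKernel {β : ℝ} (f : L2) (x : Rod) :
    kernelOp (greenKernel β) f x = (∫ s in (0 : ℝ)..1, rodExtend f s) / β
      + ∫ r in (x : ℝ)..1, ∫ s in (0 : ℝ)..r, rodExtend f s := by
  have hf := intervalIntegrable_rodExtend (L2.integrable f)
  have hx0 : (0 : ℝ) ≤ x := x.2.1
  have hx1 : (x : ℝ) ≤ 1 := x.2.2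
  have hf1 : IntervalIntegrable (rodExtend f) volume 0 x :=
    hf.mono_set (by rw [uIcc_of_le hx0, uIcc_of_le zero_le_one]; exact Icc_subset_Icc_right hx1)
  have hf2 : IntervalIntegrable (rodExtend f) volume x 1 :=
    hf.mono_set (by rw [uIcc_of_le hx1, uIcc_of_le zero_le_one]; exact Icc_subset_Icc_left hx0)
  have e1 : kernelOp (greenKernel β) f x =
      ∫ s in (0 : ℝ)..1, (1 / β + 1 - max (x : ℝ) s) * rodExtend f s := by
    rw [kernelOp_apply_eq_integral,
      ← integral_rod (fun s => (1 / β + 1 - max (x : ℝ) s) * rodExtend f s)]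
    simp only [rodExtend_coe]
    rfl
  have c : Continuous fun s : ℝ => 1 / β + 1 - max (x : ℝ) s := by fun_prop
  have e2 : ∫ s in (0 : ℝ)..x, (1 / β + 1 - max (x : ℝ) s) * rodExtend f s =
      (1 / β + 1 - x) * ∫ s in (0 : ℝ)..x, rodExtend f s := by
    rw [← intervalIntegral.integral_const_mul]
    refine intervalIntegral.integral_congr fun s hs => ?_
    rw [uIcc_of_le hx0] at hs
    simp only [max_eq_left hs.2]
  have e3 : ∫ s in (x : ℝ)..1, (1 / β + 1 - max (x : ℝ) s) * rodExtend f s =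
      ∫ s in (x : ℝ)..1, (1 / β + 1 - s) * rodExtend f s := by
    refine intervalIntegral.integral_congr fun s hs => ?_
    rw [uIcc_of_le hx1] at hs
    simp only [max_eq_right hs.1]
  have hadd : ∀ t ∈ Icc (x : ℝ) 1, ∫ s in (0 : ℝ)..t, rodExtend f s =
      (∫ s in (0 : ℝ)..x, rodExtend f s) + ∫ s in (x : ℝ)..t, rodExtend f s := fun t ht =>
    (intervalIntegral.integral_add_adjacent_intervals hf1 (hf2.mono_set (by
      rw [uIcc_of_le hx1, uIcc_of_le ht.1]; exact Icc_subset_Icc_right ht.2))).symm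
  have e4 := mul_sub_mul_eq_integral (x := fun s => 1 / β + 1 - s) (f := fun _ => -1)
    (y := fun r => ∫ s in (0 : ℝ)..r, rodExtend f s) (g := rodExtend f) hx1
    intervalIntegrable_const hf2 (fun t _ => by
      rw [intervalIntegral.integral_const]; simp) hadd
  have cA : ContinuousOn (fun r => ∫ s in (0 : ℝ)..r, rodExtend f s) (uIcc (x : ℝ) 1) := by
    have := intervalIntegral.continuousOn_primitive_interval'
      (μ := volume) hf (a := 0) (by simp)
    refine this.mono ?_
    rw [uIcc_of_le hx1, uIcc_of_le zero_le_one]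
    exact Icc_subset_Icc_left hx0
  have i1 : IntervalIntegrable (fun r => ∫ s in (0 : ℝ)..r, rodExtend f s) volume x 1 :=
    cA.intervalIntegrable
  have i2 : IntervalIntegrable (fun s => (1 / β + 1 - s) * rodExtend f s) volume x 1 :=
    hf2.continuousOn_mul (by fun_prop)
  rw [intervalIntegral.integral_add (by simpa only [neg_one_mul] using! i1.neg) i2] at e4
  simp only [neg_one_mul, intervalIntegral.integral_neg] at e4
  rw [e1, ← intervalIntegral.integral_add_adjacent_intervals (hf1.continuousOn_mul c.continuousOn)
    (hf2.continuousOn_mul c.continuousOn), e2, e3]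
  linear_combination -e4

/-- The Green operator is injective: a function with vanishing second primitive is zero. -/
theorem eq_zero_of_kernelOp_greenKernel_eq_zero {β : ℝ} (f : L2)
    (h : kernelOp (greenKernel β) f = 0) : f = 0 := by
  have hf := intervalIntegrable_rodExtend (L2.integrable f)
  have hW : ∀ x ∈ Icc (0 : ℝ) 1, (∫ s in (0 : ℝ)..1, rodExtend f s) / β
      + ∫ r in x..1, ∫ s in (0 : ℝ)..r, rodExtend f s = 0 := fun x hx => by
    have h1 := kernelOp_greenKernel (β := β) f ⟨x, hx⟩
    rw [h] at h1
    exact h1.symm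
  have cA : ContinuousOn (fun r => ∫ s in (0 : ℝ)..r, rodExtend f s) (uIcc (0 : ℝ) 1) :=
    intervalIntegral.continuousOn_primitive_interval' (μ := volume) hf (a := 0) (by simp)
  have iA : IntervalIntegrable (fun r => ∫ s in (0 : ℝ)..r, rodExtend f s) volume 0 1 :=
    cA.intervalIntegrable
  have hA0 : ∀ x ∈ Ioo (0 : ℝ) 1, ∫ r in (0 : ℝ)..x, ∫ s in (0 : ℝ)..r, rodExtend f s = 0 := by
    intro x hx
    have i1 : IntervalIntegrable (fun r => ∫ s in (0 : ℝ)..r, rodExtend f s) volume 0 x :=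
      iA.mono_set (by
        rw [uIcc_of_le hx.1.le, uIcc_of_le zero_le_one]; exact Icc_subset_Icc_right hx.2.le)
    have i2 : IntervalIntegrable (fun r => ∫ s in (0 : ℝ)..r, rodExtend f s) volume x 1 :=
      iA.mono_set (by
        rw [uIcc_of_le hx.2.le, uIcc_of_le zero_le_one]; exact Icc_subset_Icc_left hx.1.le)
    have h1 := intervalIntegral.integral_add_adjacent_intervals i1 i2
    linarith [hW 0 (by simp), hW x (Ioo_subset_Icc_self hx)]
  have hA : EqOn (fun r => ∫ s in (0 : ℝ)..r, rodExtend f s) (fun _ => (0 : ℝ)) (Ioo 0 1) := by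
    refine Measure.eqOn_open_of_ae_eq (μ := volume) ?_ isOpen_Ioo
      (cA.mono (by rw [uIcc_of_le zero_le_one]; exact Ioo_subset_Icc_self)) continuousOn_const
    exact (ae_restrict_iff' measurableSet_Ioo).mpr (ae_eq_zero_of_primitive_eq_zero iA hA0)
  have hz := ae_eq_zero_of_primitive_eq_zero hf hA
  have hz2 : ∀ᵐ s ∂(volume.restrict (Icc (0 : ℝ) 1)), rodExtend f s = 0 := by
    rw [← Measure.restrict_congr_set (Ioo_ae_eq_Icc (μ := volume) (a := (0 : ℝ)) (b := 1))]
    exact (ae_restrict_iff' measurableSet_Ioo).mpr hz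
  have hz3 : ∀ᵐ x : Rod, rodExtend f x = 0 :=
    unitInterval.measurePreserving_coe.quasiMeasurePreserving.ae hz2
  refine Lp.ext ?_
  filter_upwards [hz3, Lp.coeFn_zero ℝ 2 (volume : Measure Rod)] with x hx h0
  rw [h0, ← rodExtend_coe f x, hx]
  rfl

/-- The root in `(nπ, (n+1/2)π)` is unique: there, up to the common factor `(-1)ⁿ`, `ν sin ν`
increases and `β cos ν` decreases. -/
theorem eq_of_root_mem_Ioo {β a b x y : ℝ} (hβ : 0 < β) (n : ℕ) (ha : (n : ℝ) * Real.pi = a)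
    (hb : ((n : ℝ) + 1 / 2) * Real.pi = b) (hx : x ∈ Ioo a b) (hy : y ∈ Ioo a b)
    (ex : x * Real.sin x = β * Real.cos x) (ey : y * Real.sin y = β * Real.cos y) : x = y := by
  subst ha hb
  wlog hxy : x < y generalizing x y
  · rcases lt_or_eq_of_le (not_lt.mp hxy) with h | h
    · exact (this ey ex hy hx h).symm
    · exact h.symm
  exfalso
  have hpi := Real.pi_pos
  -- with `x = r + nπ`, the equation reads `x sin r = β cos r`
  have red : ∀ z : ℝ, z * Real.sin z = β * Real.cos z →
      z * Real.sin (z - n * Real.pi) = β * Real.cos (z - n * Real.pi) := by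
    intro z hz
    rw [Real.sin_sub_nat_mul_pi, Real.cos_sub_nat_mul_pi]
    linear_combination (-1) ^ n * hz
  have hx1 := red x ex
  have hy1 := red y ey
  have hs : Real.sin (x - n * Real.pi) < Real.sin (y - n * Real.pi) :=
    Real.sin_lt_sin_of_lt_of_le_pi_div_two (by linarith [hx.1]) (by linarith [hy.2]) (by linarith)
  have hc : Real.cos (y - n * Real.pi) < Real.cos (x - n * Real.pi) :=
    Real.cos_lt_cos_of_nonneg_of_le_pi_div_two (by linarith [hx.1]) (by linarith [hy.2])
      (by linarith)
  have hsx : 0 < Real.sin (x - n * Real.pi) :=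
    Real.sin_pos_of_pos_of_lt_pi (by linarith [hx.1]) (by linarith [hx.2])
  have hx0 : 0 < x := lt_of_le_of_lt (by positivity) hx.1
  nlinarith

/-- The `ν_n` are all the positive roots of `ν sin ν = β cos ν`. -/
theorem exists_eq_frequency {β ν : ℝ} (hβ : 0 < β) (hν : 0 < ν)
    (h : ν * Real.sin ν = β * Real.cos ν) : ∃ n, ν = frequency β n := by
  have hpi := Real.pi_pos
  set n := ⌊ν / Real.pi⌋₊ with hn
  have h1 : (n : ℝ) * Real.pi ≤ ν := (le_div_iff₀ hpi).mp (Nat.floor_le (by positivity))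
  have h2 : ν < ((n : ℝ) + 1) * Real.pi := (div_lt_iff₀ hpi).mp (Nat.lt_floor_add_one _)
  have h3 : ν * Real.sin (ν - n * Real.pi) = β * Real.cos (ν - n * Real.pi) := by
    rw [Real.sin_sub_nat_mul_pi, Real.cos_sub_nat_mul_pi]
    linear_combination (-1) ^ n * h
  have h4 : (n : ℝ) * Real.pi < ν := by
    refine lt_of_le_of_ne h1 fun he => ?_
    rw [← he] at h3
    simp only [sub_self, Real.sin_zero, Real.cos_zero] at h3
    linarith
  have h5 : 0 < Real.sin (ν - n * Real.pi) :=
    Real.sin_pos_of_pos_of_lt_pi (by linarith) (by linarith)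
  have h6 : ν - n * Real.pi < Real.pi / 2 := by
    by_contra hcon
    have := Real.cos_nonpos_of_pi_div_two_le_of_le (x := ν - n * Real.pi) (not_lt.mp hcon)
      (by linarith)
    nlinarith [mul_pos hν h5]
  exact ⟨n, eq_of_root_mem_Ioo hβ n rfl rfl ⟨h4, by linarith⟩ (frequency_spec hβ n).1 h
    (frequency_spec hβ n).2⟩

/-- A solution of the eigenvalue problem for the Green operator, written with the primitive `A` of
`Y`, solves `-Y'' = μ⁻¹ Y` with the Robin conditions and is a multiple of an eigenfunction. -/
theorem exists_eq_eigenfunctionExt {β μ : ℝ} (hβ : 0 < β) (hμ : μ ≠ 0) {Y : ℝ → ℝ}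
    (hY : Continuous Y)
    (h : ∀ x ∈ Icc (0 : ℝ) 1, μ * Y x = (∫ s in (0 : ℝ)..1, Y s) / β
      + ∫ r in x..1, ∫ s in (0 : ℝ)..r, Y s) :
    ∃ (n : ℕ) (c : ℝ), ∀ x ∈ Icc (0 : ℝ) 1, Y x = c * eigenfunctionExt β n x := by
  set A : ℝ → ℝ := fun r => ∫ s in (0 : ℝ)..r, Y s with hA
  have dA : ∀ x, HasDerivAt A (Y x) x := fun x =>
    intervalIntegral.integral_hasDerivAt_right (hY.intervalIntegrable _ _)
      (hY.stronglyMeasurableAtFilter _ _) hY.continuousAt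
  have cA : Continuous A := continuous_iff_continuousAt.mpr fun x => (dA x).continuousAt
  set W : ℝ → ℝ := fun x => A 1 / β + ∫ r in x..1, A r with hW
  have dW : ∀ x, HasDerivAt W (-A x) x := fun x =>
    (intervalIntegral.integral_hasDerivAt_left (cA.intervalIntegrable _ _)
      (cA.stronglyMeasurableAtFilter _ _) cA.continuousAt).const_add _
  have cW : Continuous W := continuous_iff_continuousAt.mpr fun x => (dW x).continuousAt
  have hWY : ∀ x ∈ Icc (0 : ℝ) 1, μ * Y x = W x := h
  have A0 : A 0 = 0 := by simp [hA]
  have W1 : W 1 = A 1 / β := by simp [hW]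
  by_cases hz : ∀ x ∈ Icc (0 : ℝ) 1, Y x = 0
  · exact ⟨0, 0, fun x hx => by rw [hz x hx, zero_mul]⟩
  -- the energy identity `A(1)²/β + ∫ A² = μ ∫ Y²` shows that `μ > 0`
  have energy : A 1 ^ 2 / β + ∫ x in (0 : ℝ)..1, A x ^ 2 = μ * ∫ x in (0 : ℝ)..1, Y x ^ 2 := by
    have i1 : IntervalIntegrable (fun x => A x ^ 2) volume 0 1 :=
      (cA.pow 2).intervalIntegrable _ _
    have i2 : IntervalIntegrable (fun x => W x * Y x) volume 0 1 :=
      (cW.mul hY).intervalIntegrable _ _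
    have e1 : ∫ x in (0 : ℝ)..1, (W x * Y x - A x ^ 2) = W 1 * A 1 - W 0 * A 0 := by
      refine intervalIntegral.integral_eq_sub_of_hasDerivAt (f := fun x => W x * A x)
        (fun x _ => ?_) (i2.sub i1)
      convert! (dW x).mul (dA x) using 1
      ring
    have e2 : ∫ x in (0 : ℝ)..1, W x * Y x = μ * ∫ x in (0 : ℝ)..1, Y x ^ 2 := by
      rw [← intervalIntegral.integral_const_mul]
      refine intervalIntegral.integral_congr fun x hx => ?_
      rw [uIcc_of_le zero_le_one] at hx
      simp only [← hWY x hx]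
      ring
    rw [intervalIntegral.integral_sub i2 i1, e2, A0, W1] at e1
    linear_combination -e1
  have hμ0 : 0 < μ := by
    refine lt_of_le_of_ne ?_ hμ.symm
    have hpos : 0 < ∫ x in (0 : ℝ)..1, Y x ^ 2 := by
      push Not at hz
      obtain ⟨x, hx, hxne⟩ := hz
      exact intervalIntegral.integral_pos zero_lt_one (hY.pow 2).continuousOn
        (fun x _ => sq_nonneg _) ⟨x, hx, by positivity⟩
    have hA2 : 0 ≤ ∫ x in (0 : ℝ)..1, A x ^ 2 :=
      intervalIntegral.integral_nonneg zero_le_one fun x _ => sq_nonneg _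
    have : 0 ≤ μ * ∫ x in (0 : ℝ)..1, Y x ^ 2 := by rw [← energy]; positivity
    exact nonneg_of_mul_nonneg_left this hpos
  set ν := Real.sqrt μ⁻¹ with hν
  have hν0 : 0 < ν := Real.sqrt_pos.mpr (inv_pos.mpr hμ0)
  have hν2 : ν ^ 2 * μ = 1 := by
    rw [hν, Real.sq_sqrt (inv_pos.mpr hμ0).le, inv_mul_cancel₀ hμ]
  have hYW : ∀ x ∈ Icc (0 : ℝ) 1, Y x = ν ^ 2 * W x := fun x hx => by
    rw [← hWY x hx, ← mul_assoc, hν2, one_mul]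
  have dc : ∀ x, HasDerivAt (fun x => Real.cos (ν * x)) (-(ν * Real.sin (ν * x))) x := fun x => by
    have := ((hasDerivAt_id x).const_mul ν).cos
    refine this.congr_deriv ?_
    simp only [id, mul_one]; ring
  have ds : ∀ x, HasDerivAt (fun x => Real.sin (ν * x)) (ν * Real.cos (ν * x)) x := fun x => by
    have := ((hasDerivAt_id x).const_mul ν).sin
    refine this.congr_deriv ?_
    simp only [id, mul_one]; ring
  -- rotating `(W, W'/ν)` backwards gives two constants of motion
  have const : ∀ F : ℝ → ℝ, (∀ x ∈ Icc (0 : ℝ) 1, HasDerivAt F 0 x) →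
      ∀ x ∈ Icc (0 : ℝ) 1, F x = F 0 := fun F hF x hx =>
    constant_of_has_deriv_right_zero (fun y hy => (hF y hy).continuousAt.continuousWithinAt)
      (fun y hy => (hF y (Ico_subset_Icc_self hy)).hasDerivWithinAt) x hx
  have k1 := const (fun x => ν * W x * Real.cos (ν * x) + A x * Real.sin (ν * x)) (fun x hx => by
    refine ((((dW x).const_mul ν).mul (dc x)).add ((dA x).mul (ds x))).congr_deriv ?_
    rw [hYW x hx]; ring)
  have k2 := const (fun x => ν * W x * Real.sin (ν * x) - A x * Real.cos (ν * x)) (fun x hx => by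
    refine ((((dW x).const_mul ν).mul (ds x)).sub ((dA x).mul (dc x))).congr_deriv ?_
    rw [hYW x hx]; ring)
  simp only [mul_zero, Real.cos_zero, Real.sin_zero, A0, mul_one, add_zero, sub_zero] at k1 k2
  have solW : ∀ x ∈ Icc (0 : ℝ) 1, W x = W 0 * Real.cos (ν * x) := fun x hx => by
    have := Real.sin_sq_add_cos_sq (ν * x)
    refine mul_left_cancel₀ hν0.ne' ?_
    linear_combination Real.cos (ν * x) * k1 x hx + Real.sin (ν * x) * k2 x hx - ν * W x * this
  have solA : ∀ x ∈ Icc (0 : ℝ) 1, A x = ν * W 0 * Real.sin (ν * x) := fun x hx => by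
    have := Real.sin_sq_add_cos_sq (ν * x)
    linear_combination Real.sin (ν * x) * k1 x hx - Real.cos (ν * x) * k2 x hx - A x * this
  have W0 : W 0 ≠ 0 := fun h0 => hz fun x hx => by
    rw [hYW x hx, solW x hx, h0]; ring
  have hroot : ν * Real.sin ν = β * Real.cos ν := by
    have e1 := solW 1 (by simp)
    have e2 := solA 1 (by simp)
    rw [W1, e2, mul_one] at e1
    field_simp at e1
    linarith
  obtain ⟨n, hn⟩ := exists_eq_frequency hβ hν0 hroot
  have hs : eigenScale β n ≠ 0 := fun h0 => by
    have := one_le_eigenScale_sq hβ n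
    rw [h0] at this
    norm_num at this
  refine ⟨n, ν ^ 2 * W 0 / eigenScale β n, fun x hx => ?_⟩
  rw [hYW x hx, solW x hx, eigenfunctionExt, ← hn]
  field_simp

theorem greenKernel_symm (β : ℝ) (x y : Rod) : greenKernel β (x, y) = greenKernel β (y, x) := by
  simp only [greenKernel, ContinuousMap.coe_mk, max_comm]

/-- The inverse of `-∂ₓ²` with the Robin conditions, as an operator on `L²[0,1]`. -/
def greenOp (β : ℝ) : L2 →L[ℝ] L2 := toL2.comp (kernelOp (greenKernel β))

/-- An eigenvector of the Green operator is a multiple of an eigenfunction `φ_n`; the eigenvalue `0`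
is excluded by injectivity. -/
theorem exists_eq_smul_of_greenOp {β μ : ℝ} (hβ : 0 < β) {f : L2} (hf : greenOp β f = μ • f) :
    ∃ (n : ℕ) (c : ℝ), f = c • toL2 (eigenfunction β n) := by
  change toL2 (kernelOp (greenKernel β) f) = μ • f at hf
  by_cases hμ : μ = 0
  · rw [hμ, zero_smul, ← map_zero toL2] at hf
    have := eq_zero_of_kernelOp_greenKernel_eq_zero f (toL2_injective hf)
    exact ⟨0, 0, by rw [this, zero_smul]⟩
  -- `f` has a continuous representative `y`
  set y : C(Rod, ℝ) := μ⁻¹ • kernelOp (greenKernel β) f with hy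
  have hfy : f = toL2 y := by
    rw [hy, map_smul, hf, smul_smul, inv_mul_cancel₀ hμ, one_smul]
  have hWy : ∀ x : Rod, μ * y x = kernelOp (greenKernel β) f x := fun x => by
    rw [hy, ContinuousMap.smul_apply, smul_eq_mul, mul_inv_cancel_left₀ hμ]
  have hext : ∀ t ∈ Icc (0 : ℝ) 1, ∫ s in (0 : ℝ)..t, rodExtend f s =
      ∫ s in (0 : ℝ)..t, rodExtend y s := by
    intro t ht
    have h1 : ∀ᵐ x : Rod, rodExtend f x = rodExtend y x := by
      filter_upwards [coeFn_toL2 y] with x hx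
      rw [rodExtend_coe, rodExtend_coe, hfy, hx]
    have h2 : ∀ᵐ s ∂(volume.restrict (Icc (0 : ℝ) 1)), rodExtend f s = rodExtend y s := by
      have := unitInterval.measurableEmbedding_coe.ae_map_iff
        (μ := (volume : Measure Rod)) (p := fun s => rodExtend f s = rodExtend y s)
      rw [unitInterval.measurePreserving_coe.map_eq] at this
      exact this.mpr h1
    rw [ae_restrict_iff' measurableSet_Icc] at h2
    refine intervalIntegral.integral_congr_ae ?_
    filter_upwards [h2] with s hs hst
    rw [uIoc_of_le ht.1] at hst
    exact hs ⟨hst.1.le, hst.2.trans ht.2⟩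
  obtain ⟨n, c, hc⟩ := exists_eq_eigenfunctionExt hβ hμ
    (continuous_rodExtend y.continuous) (fun x hx => by
      have h1 := hWy ⟨x, hx⟩
      rw [kernelOp_greenKernel, ← rodExtend_coe y, hext 1 (by simp)] at h1
      rw [h1]
      congr 1
      refine intervalIntegral.integral_congr fun r hr => hext r ?_
      rw [uIcc_of_le hx.2] at hr
      exact ⟨hx.1.trans hr.1, hr.2⟩)
  refine ⟨n, c, ?_⟩
  rw [hfy, ← map_smul]
  congr 1
  ext x
  rw [← rodExtend_coe y, hc x x.2]
  rfl

/-- Completeness, by the spectral theorem for the compact symmetric Green operator. -/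
theorem orthogonal_span_eigenfunction {β : ℝ} (hβ : 0 < β) :
    (Submodule.span ℝ (range fun n => toL2 (eigenfunction β n)))ᗮ = ⊥ := by
  have hc : IsCompactOperator (greenOp β) :=
    (isCompactOperator_kernelOp (greenKernel β)).clm_comp toL2
  have hs : (greenOp β : L2 →ₗ[ℝ] L2).IsSymmetric := fun f g => by
    change inner ℝ (toL2 (kernelOp (greenKernel β) f)) g =
      inner ℝ f (toL2 (kernelOp (greenKernel β) g))
    rw [inner_kernelOp_symm (greenKernel_symm β), real_inner_comm]
  refine eq_bot_iff.mpr ?_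
  rw [← ContinuousLinearMap.orthogonalComplement_iSup_eigenspaces_eq_bot hc hs]
  refine Submodule.orthogonal_le (iSup_le fun μ f hf => ?_)
  obtain ⟨n, c, rfl⟩ := exists_eq_smul_of_greenOp hβ (Module.End.mem_eigenspace_iff.mp hf)
  exact Submodule.smul_mem _ _ (Submodule.subset_span ⟨n, rfl⟩)

/-- The eigenfunctions `φ_n` form a Hilbert basis of `L²[0,1]`. -/
def eigenbasis {β : ℝ} (hβ : 0 < β) : HilbertBasis ℕ ℝ L2 :=
  HilbertBasis.mkOfOrthogonalEqBot (orthonormal_eigenfunction hβ) (orthogonal_span_eigenfunction hβ)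

theorem eigenbasis_apply {β : ℝ} (hβ : 0 < β) (n : ℕ) :
    eigenbasis hβ n = toL2 (eigenfunction β n) := by
  simp [eigenbasis]

/-! ### Eigenfunction expansions of functions and kernels -/

/-- The coordinate `∫ φ_n f` of `f`. -/
def mode (β : ℝ) (n : ℕ) (f : L2) : ℝ := inner ℝ (toL2 (eigenfunction β n)) f

section Modes

variable {β : ℝ}

theorem repr_eigenbasis (hβ : 0 < β) (f : L2) (n : ℕ) : (eigenbasis hβ).repr f n = mode β n f := by
  rw [HilbertBasis.repr_apply_apply, eigenbasis_apply, mode]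

theorem hasSum_mode_smul (hβ : 0 < β) (f : L2) :
    HasSum (fun n => mode β n f • toL2 (eigenfunction β n)) f := by
  simpa only [repr_eigenbasis, eigenbasis_apply] using (eigenbasis hβ).hasSum_repr f

theorem hasSum_mode_mul_mode (hβ : 0 < β) (f g : L2) :
    HasSum (fun n => mode β n f * mode β n g) (inner ℝ f g) := by
  have h := (eigenbasis hβ).hasSum_inner_mul_inner f g
  simp only [eigenbasis_apply] at h
  refine h.congr_fun fun n => ?_
  rw [mode, mode, real_inner_comm f]

theorem hasSum_mode_sq (hβ : 0 < β) (f : L2) : HasSum (fun n => mode β n f ^ 2) (‖f‖ ^ 2) := by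
  have h := hasSum_mode_mul_mode hβ f f
  rw [real_inner_self_eq_norm_sq] at h
  simpa only [sq] using! h

theorem mode_sub (n : ℕ) (f g : L2) : mode β n (f - g) = mode β n f - mode β n g :=
  inner_sub_right _ _ _

theorem summable_mode_smul_eigenfunction (hβ : 0 < β) {z : ℕ → ℝ} (hz : Summable fun n => |z n|) :
    Summable fun n => z n • eigenfunction β n := by
  refine Summable.of_norm_bounded (hz.mul_right 2) fun n => ?_
  rw [norm_smul, Real.norm_eq_abs]
  exact mul_le_mul_of_nonneg_left (norm_eigenfunction_le hβ n) (abs_nonneg _)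

/-- An element of `L²` with summable coordinates has a continuous representative, to which its
eigenfunction expansion converges uniformly. -/
theorem toL2_tsum_mode (hβ : 0 < β) {z : L2} (hz : Summable fun n => |mode β n z|) :
    toL2 (∑' n, mode β n z • eigenfunction β n) = z := by
  have h1 := (summable_mode_smul_eigenfunction hβ hz).hasSum.mapL toL2
  simp only [map_smul] at h1
  exact h1.unique (hasSum_mode_smul hβ z)

theorem hasSum_eigenfunction (hβ : 0 < β) {Z : C(Rod, ℝ)}
    (hz : Summable fun n => |mode β n (toL2 Z)|) :
    HasSum (fun n => mode β n (toL2 Z) • eigenfunction β n) Z := by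
  have h := (summable_mode_smul_eigenfunction hβ hz).hasSum
  rwa [toL2_injective (toL2_tsum_mode hβ hz)] at h

/-- The coordinates of a `C²` function are `O(1/|λ_n|)`, whatever its boundary values: they are
`λ_n⁻¹` times the value at `φ_n` of a bounded functional. -/
theorem abs_eigenvalue_mul_mode_le (hβ : 0 < β) {θ : ℝ → ℝ} (hθ : ContDiff ℝ 2 θ) (n : ℕ) :
    |eigenvalue β n| * |mode β n (toL2 (onRod θ hθ.continuous))| ≤ ‖robinForm β θ hθ‖ * 2 := by
  rw [← abs_mul, mode, ← robinForm_eigenfunction hβ hθ]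
  exact ((robinForm β θ hθ).le_opNorm _).trans
    (mul_le_mul_of_nonneg_left (norm_eigenfunction_le hβ n) (norm_nonneg _))

theorem summable_of_abs_eigenvalue_mul_le (hβ : 0 < β) {a : ℕ → ℝ} {C : ℝ}
    (h : ∀ n, |eigenvalue β n| * |a n| ≤ C) : Summable fun n => |a n| := by
  refine ((summable_inv_abs_eigenvalue hβ).mul_right C).of_nonneg_of_le
    (fun n => abs_nonneg _) fun n => ?_
  rw [inv_mul_eq_div, le_div_iff₀ (abs_eigenvalue_pos hβ n), mul_comm]
  exact h n

theorem summable_mode_onRod (hβ : 0 < β) {θ : ℝ → ℝ} (hθ : ContDiff ℝ 2 θ) :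
    Summable fun n => |mode β n (toL2 (onRod θ hθ.continuous))| :=
  summable_of_abs_eigenvalue_mul_le hβ (abs_eigenvalue_mul_mode_le hβ hθ)

end Modes

theorem hasSum_prod_of_fiberwise {F : ℕ × ℕ → ℝ} {g : ℕ → ℝ} {s : ℝ} (hs : Summable F)
    (hf : ∀ n, HasSum (fun i => F (n, i)) (g n)) (hg : HasSum g s) : HasSum F s := by
  have h := hs.hasSum
  rwa [(h.prod_fiberwise hf).unique hg] at h

section KernelExpansion

variable {β : ℝ} {P : C(Rod × Rod, ℝ)}

theorem coeff_eq_mode (m n : ℕ) :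
    coeff β P m n = mode β m (toL2 (kernelOp P (toL2 (eigenfunction β n)))) := by
  rw [mode, real_inner_comm, inner_kernelOp_toL2, coeff]

theorem coeff_symm (hP : ∀ x y, P (x, y) = P (y, x)) (m n : ℕ) :
    coeff β P m n = coeff β P n m := by
  rw [coeff_eq_mode, coeff_eq_mode, mode, mode, real_inner_comm, inner_kernelOp_symm hP,
    real_inner_comm]

/-- An orthonormal family for which Parseval's identity holds at `x` expands `x`. -/
theorem Orthonormal.hasSum_of_parseval {ι E : Type*} [NormedAddCommGroup E]
    [InnerProductSpace ℝ E] {v : ι → E} (hv : Orthonormal ℝ v) {x : E}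
    (h : HasSum (fun i => inner ℝ (v i) x ^ 2) (‖x‖ ^ 2)) :
    HasSum (fun i => inner ℝ (v i) x • v i) x := by
  have key : ∀ s : Finset ι, ‖(∑ i ∈ s, inner ℝ (v i) x • v i) - x‖ ^ 2 =
      ‖x‖ ^ 2 - ∑ i ∈ s, inner ℝ (v i) x ^ 2 := by
    intro s
    rw [norm_sub_sq_real, ← real_inner_self_eq_norm_sq (∑ i ∈ s, inner ℝ (v i) x • v i),
      hv.inner_sum, sum_inner]
    simp only [inner_smul_left, RCLike.conj_to_real, sq]
    ring
  rw [HasSum, tendsto_iff_norm_sub_tendsto_zero]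
  have h1 : Tendsto (fun s : Finset ι => ‖(∑ i ∈ s, inner ℝ (v i) x • v i) - x‖ ^ 2) atTop
      (𝓝 0) := by
    simp only [key]
    have h0 : Tendsto (fun s : Finset ι => ∑ i ∈ s, inner ℝ (v i) x ^ 2) atTop (𝓝 (‖x‖ ^ 2)) := h
    rw [← sub_self (‖x‖ ^ 2)]
    exact h0.const_sub (‖x‖ ^ 2)
  have h2 := h1.sqrt
  simpa [Real.sqrt_sq (norm_nonneg _)] using h2

/-- The eigenfunction expansion of a continuous kernel in `L²` of the square. -/
theorem hasSum_coeff_smul (hβ : 0 < β) (hP : ∀ x y, P (x, y) = P (y, x)) :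
    HasSum (fun m : ℕ × ℕ => coeff β P m.1 m.2 •
        ContinuousMap.toLp 2 (volume : Measure (Rod × Rod)) ℝ (eigenfunctionProd β m.1 m.2))
      (ContinuousMap.toLp 2 (volume : Measure (Rod × Rod)) ℝ P) := by
  set v : ℕ × ℕ → Lp ℝ 2 (volume : Measure (Rod × Rod)) := fun m =>
    ContinuousMap.toLp 2 (volume : Measure (Rod × Rod)) ℝ (eigenfunctionProd β m.1 m.2) with hv
  have inner_toLp : ∀ f g : C(Rod × Rod, ℝ),
      inner ℝ (ContinuousMap.toLp 2 (volume : Measure (Rod × Rod)) ℝ f)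
        (ContinuousMap.toLp 2 (volume : Measure (Rod × Rod)) ℝ g) = ∫ p : Rod × Rod, f p * g p := by
    intro f g
    rw [ContinuousMap.inner_toLp]
    simp [mul_comm]
  have hon : Orthonormal ℝ v := by
    rw [orthonormal_iff_ite]
    rintro ⟨m, n⟩ ⟨m', n'⟩
    have h1 := orthonormal_iff_ite.mp (orthonormal_eigenfunction hβ)
    simp only [hv, inner_toLp]
    have : ∀ p : Rod × Rod, eigenfunctionProd β m n p * eigenfunctionProd β m' n' p =
        (eigenfunction β m p.1 * eigenfunction β m' p.1) *
          (eigenfunction β n p.2 * eigenfunction β n' p.2) := fun p => by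
      simp only [eigenfunctionProd, ContinuousMap.coe_mk]; ring
    simp only [this]
    rw [Measure.volume_eq_prod, integral_prod_mul
      (fun x => eigenfunction β m x * eigenfunction β m' x)
      (fun x => eigenfunction β n x * eigenfunction β n' x), ← inner_toL2_toL2, ← inner_toL2_toL2,
      h1, h1]
    simp only [Prod.mk.injEq]
    split_ifs <;> simp_all
  have hin : ∀ m : ℕ × ℕ, inner ℝ (v m)
      (ContinuousMap.toLp 2 (volume : Measure (Rod × Rod)) ℝ P) = coeff β P m.1 m.2 := by
    rintro ⟨m, n⟩
    simp only [hv, inner_toLp, coeff]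
    refine integral_congr_ae (Eventually.of_forall fun p => ?_)
    simp only [eigenfunctionProd, ContinuousMap.coe_mk]
    ring
  -- Parseval's identity in `L²` of the square: Parseval in each variable in turn
  have hfib : ∀ n, HasSum (fun m => coeff β P n m ^ 2)
      (∫ x : Rod, kernelOp P (toL2 (eigenfunction β n)) x ^ 2) := by
    intro n
    have h := hasSum_mode_sq hβ (toL2 (kernelOp P (toL2 (eigenfunction β n))))
    rw [← real_inner_self_eq_norm_sq, inner_toL2_toL2] at h
    simp only [← coeff_eq_mode, ← sq] at h
    simpa only [coeff_symm hP n] using! h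
  have hint : HasSum (fun n => ∫ x : Rod, kernelOp P (toL2 (eigenfunction β n)) x ^ 2)
      (∫ x : Rod, ‖toL2 (P.curry x)‖ ^ 2) := by
    have hpt : ∀ x : Rod, HasSum (fun n => kernelOp P (toL2 (eigenfunction β n)) x ^ 2)
        (‖toL2 (P.curry x)‖ ^ 2) := by
      intro x
      refine (hasSum_mode_sq hβ (toL2 (P.curry x))).congr_fun fun n => ?_
      rw [kernelOp_apply, mode, real_inner_comm]
    refine hasSum_integral_of_dominated_convergence
      (fun n x => kernelOp P (toL2 (eigenfunction β n)) x ^ 2)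
      (fun n => ((ContinuousMap.continuous _).pow 2).aestronglyMeasurable)
      (fun n => Eventually.of_forall fun x => by simp)
      (Eventually.of_forall fun x => (hpt x).summable) ?_ (Eventually.of_forall hpt)
    simp only [(hpt _).tsum_eq]
    exact integrable_of_continuous ((toL2.continuous.comp P.curry.continuous).norm.pow 2)
  have hnorm : ∫ x : Rod, ‖toL2 (P.curry x)‖ ^ 2 =
      ‖ContinuousMap.toLp 2 (volume : Measure (Rod × Rod)) ℝ P‖ ^ 2 := by
    rw [← real_inner_self_eq_norm_sq, inner_toLp, Measure.volume_eq_prod, integral_prod]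
    · refine integral_congr_ae (Eventually.of_forall fun x => ?_)
      simp only
      rw [← real_inner_self_eq_norm_sq, inner_toL2_toL2]
      rfl
    · exact (P.continuous.mul P.continuous).integrable_of_hasCompactSupport
        (HasCompactSupport.of_compactSpace _)
  have hsum : Summable fun m : ℕ × ℕ => coeff β P m.1 m.2 ^ 2 := by
    rw [summable_prod_of_nonneg fun m => sq_nonneg _]
    refine ⟨fun n => (hfib n).summable, ?_⟩
    simp only [(hfib _).tsum_eq]
    exact hint.summable
  have := Orthonormal.hasSum_of_parseval hon
    (x := ContinuousMap.toLp 2 (volume : Measure (Rod × Rod)) ℝ P) (by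
      simp only [hin]
      rw [← hnorm]
      exact hasSum_prod_of_fiberwise hsum hfib hint)
  simpa only [hin] using! this

end KernelExpansion

/-! ### The Riccati equation in eigenfunction coordinates -/

section Riccati

variable {β R : ℝ} {Q : C(Rod, ℝ) →L[ℝ] C(Rod, ℝ) →L[ℝ] ℝ} {P : C(Rod × Rod, ℝ)}

theorem integral_robin_slice (hP : ∀ x y, P (x, y) = P (y, x)) {θ : ℝ → ℝ}
    (hθ : ContDiff ℝ 2 θ) :
    (∫ x₂ : Rod, ((∫ x₁ : Rod, P (x₁, x₂) * deriv (deriv θ) x₁)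
      + P (0, x₂) * deriv θ 0 - P (1, x₂) * deriv θ 1 - β * P (1, x₂) * θ 1) * θ x₂) =
      robinForm β θ hθ (kernelOp P (toL2 (onRod θ hθ.continuous))) := by
  have c2 : Continuous (deriv (deriv θ)) := ContDiff.continuous_deriv (n := 1) hθ.deriv' le_rfl
  have hD : ∀ y : Rod, ∫ x₁ : Rod, P (x₁, y) * deriv (deriv θ) x₁ =
      kernelOp P (toL2 (onRod _ c2)) y := fun y => by
    rw [kernelOp_toL2_apply]
    simp only [hP y]
    rfl
  have cθ : Continuous fun x : Rod => θ x := hθ.continuous.comp continuous_subtype_val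
  have cP : ∀ x : Rod, Continuous fun y : Rod => P (x, y) := fun x => by fun_prop
  have e1 : ∀ x : Rod, ∫ y : Rod, P (x, y) * θ y =
      kernelOp P (toL2 (onRod θ hθ.continuous)) x := fun x => by
    rw [kernelOp_toL2_apply]; rfl
  have e2 : ∫ y : Rod, kernelOp P (toL2 (onRod _ c2)) y * θ y =
      ∫ x : Rod, deriv (deriv θ) x * kernelOp P (toL2 (onRod θ hθ.continuous)) x := by
    have h := inner_kernelOp_symm hP (toL2 (onRod _ c2)) (toL2 (onRod θ hθ.continuous))
    rw [inner_toL2_toL2, inner_toL2_toL2] at h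
    refine h.symm.trans ?_
    refine integral_congr_ae (Eventually.of_forall fun x => ?_)
    exact mul_comm _ _
  have split : ∀ y : Rod, ((∫ x₁ : Rod, P (x₁, y) * deriv (deriv θ) x₁)
      + P (0, y) * deriv θ 0 - P (1, y) * deriv θ 1 - β * P (1, y) * θ 1) * θ y =
      kernelOp P (toL2 (onRod _ c2)) y * θ y + deriv θ 0 * (P (0, y) * θ y)
        - (deriv θ 1 + β * θ 1) * (P (1, y) * θ y) := fun y => by
    rw [hD]; ring
  simp only [split]
  have i1 : Integrable fun y : Rod => kernelOp P (toL2 (onRod _ c2)) y * θ y :=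
    integrable_of_continuous ((kernelOp P (toL2 (onRod _ c2))).continuous.mul cθ)
  have i2 : Integrable fun y : Rod => deriv θ 0 * (P (0, y) * θ y) :=
    (integrable_of_continuous ((cP 0).mul cθ)).const_mul _
  have i3 : Integrable fun y : Rod => (deriv θ 1 + β * θ 1) * (P (1, y) * θ y) :=
    (integrable_of_continuous ((cP 1).mul cθ)).const_mul _
  have i12 : Integrable fun y : Rod => kernelOp P (toL2 (onRod _ c2)) y * θ y +
      deriv θ 0 * (P (0, y) * θ y) := i1.add i2
  rw [integral_sub i12 i3, integral_add i1 i2, integral_const_mul, integral_const_mul,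
    e1, e1, robinForm_apply, ← e2]

/-- For a symmetric kernel the two halves of `weakLaplacian` agree: both are the pairing of `θ`
with the Robin Laplacian of `x ↦ ∫ P(x,y) θ(y) dy`. -/
theorem weakLaplacian_eq (hP : ∀ x y, P (x, y) = P (y, x)) {θ : ℝ → ℝ} (hθ : ContDiff ℝ 2 θ) :
    weakLaplacian β P θ = 2 * robinForm β θ hθ (kernelOp P (toL2 (onRod θ hθ.continuous))) := by
  rw [weakLaplacian, integral_robin_slice hP hθ, two_mul]
  congr 1
  rw [← integral_robin_slice hP hθ]
  refine integral_congr_ae (Eventually.of_forall fun x => ?_)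
  simp only [hP x]

theorem integral_quadratic_term (hP : ∀ x y, P (x, y) = P (y, x)) {θ : ℝ → ℝ}
    (hθ : Continuous θ) :
    ∫ p : Rod × Rod, β ^ 2 * R⁻¹ * P (p.1, 1) * P (1, p.2) * θ p.1 * θ p.2 =
      β ^ 2 * R⁻¹ * kernelOp P (toL2 (onRod θ hθ)) 1 ^ 2 := by
  have : ∀ p : Rod × Rod, β ^ 2 * R⁻¹ * P (p.1, 1) * P (1, p.2) * θ p.1 * θ p.2 =
      β ^ 2 * R⁻¹ * ((P (1, p.1) * θ p.1) * (P (1, p.2) * θ p.2)) := fun p => by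
    rw [hP p.1 1]; ring
  simp only [this]
  rw [integral_const_mul, Measure.volume_eq_prod,
    integral_prod_mul (fun x : Rod => P (1, x) * θ x) (fun x : Rod => P (1, x) * θ x),
    kernelOp_toL2_apply, sq (∫ _, _)]
  rfl

/-- The equation for the coefficients `P_{m,n}` with the trace `∫ P(1,x) φ_n(x) dx` left
unexpanded. -/
def IsModalRiccatiSolution (β R : ℝ) (Q : C(Rod, ℝ) →L[ℝ] C(Rod, ℝ) →L[ℝ] ℝ)
    (P : C(Rod × Rod, ℝ)) : Prop :=
  ∀ m n : ℕ, (eigenvalue β m + eigenvalue β n) * coeff β P m n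
      + Q (eigenfunction β m) (eigenfunction β n) =
    β ^ 2 * R⁻¹ * (kernelOp P (toL2 (eigenfunction β m)) 1 *
      kernelOp P (toL2 (eigenfunction β n)) 1)

theorem onRod_add {θ η : ℝ → ℝ} (hθ : Continuous θ) (hη : Continuous η) :
    onRod (fun x => θ x + η x) (hθ.add hη) = onRod θ hθ + onRod η hη := rfl

theorem robinForm_add {θ η : ℝ → ℝ} (hθ : ContDiff ℝ 2 θ) (hη : ContDiff ℝ 2 η)
    (Z : C(Rod, ℝ)) : robinForm β (fun x => θ x + η x) (hθ.add hη) Z =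
      robinForm β θ hθ Z + robinForm β η hη Z := by
  have d1 : deriv (fun x => θ x + η x) = fun x => deriv θ x + deriv η x := funext fun x =>
    ((hasDerivAt_of_contDiff_two hθ x).1.add (hasDerivAt_of_contDiff_two hη x).1).deriv
  have d2 : deriv (fun x => deriv θ x + deriv η x) =
      fun x => deriv (deriv θ) x + deriv (deriv η) x := funext fun x =>
    ((hasDerivAt_of_contDiff_two hθ x).2.add (hasDerivAt_of_contDiff_two hη x).2).deriv
  have c1 : Continuous (deriv (deriv θ)) := ContDiff.continuous_deriv (n := 1) hθ.deriv' le_rfl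
  have c2 : Continuous (deriv (deriv η)) := ContDiff.continuous_deriv (n := 1) hη.deriv' le_rfl
  rw [robinForm_apply, robinForm_apply, robinForm_apply, d1, d2]
  simp only [add_mul]
  rw [integral_add]
  · ring
  · exact integrable_of_continuous ((c1.comp continuous_subtype_val).mul Z.continuous)
  · exact integrable_of_continuous ((c2.comp continuous_subtype_val).mul Z.continuous)

/-- The modal equation is the polarization of the weak equation, evaluated at `φ_m + φ_n`. -/
theorem IsWeakRiccatiSolution.isModalRiccatiSolution (hβ : 0 < β) (hQ : ∀ f g, Q f g = Q g f)
    (hP : ∀ x y, P (x, y) = P (y, x)) (h : IsWeakRiccatiSolution β R Q P) :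
    IsModalRiccatiSolution β R Q P := by
  intro m n
  have hm := contDiff_eigenfunctionExt (β := β) m
  have hn := contDiff_eigenfunctionExt (β := β) n
  have e1 := h _ hm
  have e2 := h _ hn
  have e3 := h _ (hm.add hn)
  rw [weakLaplacian_eq hP hm, integral_quadratic_term hP hm.continuous] at e1
  rw [weakLaplacian_eq hP hn, integral_quadratic_term hP hn.continuous] at e2
  rw [weakLaplacian_eq hP (hm.add hn), integral_quadratic_term hP (hm.add hn).continuous,
    robinForm_add hm hn, onRod_add hm.continuous hn.continuous] at e3
  have o : ∀ k, onRod (eigenfunctionExt β k) (contDiff_eigenfunctionExt (β := β) k).continuous =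
    eigenfunction β k := fun _ => rfl
  simp only [o, map_add, robinForm_eigenfunctionExt hβ, inner_add_right, add_apply,
    ContinuousMap.add_apply] at e1 e2 e3
  have k1 : inner ℝ (toL2 (eigenfunction β m))
      (toL2 (kernelOp P (toL2 (eigenfunction β n)))) = coeff β P m n := (coeff_eq_mode m n).symm
  have k2 : inner ℝ (toL2 (eigenfunction β n))
      (toL2 (kernelOp P (toL2 (eigenfunction β m)))) = coeff β P m n :=
    (coeff_eq_mode n m).symm.trans (coeff_symm hP n m)
  rw [k1, k2, hQ (eigenfunction β n) (eigenfunction β m)] at e3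
  linear_combination (e3 - e1 - e2) / 2

theorem abs_kernelOp_eigenfunction_le (hβ : 0 < β) (P : C(Rod × Rod, ℝ)) (n : ℕ) (x : Rod) :
    |kernelOp P (toL2 (eigenfunction β n)) x| ≤ ‖kernelOp P‖ := by
  refine ((kernelOp P (toL2 (eigenfunction β n))).norm_coe_le_norm x).trans ?_
  simpa [norm_toL2_eigenfunction hβ] using (kernelOp P).le_opNorm (toL2 (eigenfunction β n))

theorem exists_form_bound (Q : C(Rod, ℝ) →L[ℝ] C(Rod, ℝ) →L[ℝ] ℝ) :
    ∃ C, 0 ≤ C ∧ ∀ f g, |Q f g| ≤ C * ‖f‖ * ‖g‖ := by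
  obtain ⟨C, hC⟩ : ∃ C, ∀ f g, ‖Q f g‖ ≤ C * ‖f‖ * ‖g‖ := ⟨_, fun f g => Q.le_opNorm₂ f g⟩
  refine ⟨|C|, abs_nonneg _, fun f g => (hC f g).trans ?_⟩
  have := le_abs_self C
  gcongr

theorem exists_form_eigenfunction_bound (hβ : 0 < β) (Q : C(Rod, ℝ) →L[ℝ] C(Rod, ℝ) →L[ℝ] ℝ) :
    ∃ C, ∀ m n, |Q (eigenfunction β m) (eigenfunction β n)| ≤ C := by
  obtain ⟨C, hC, h⟩ := exists_form_bound Q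
  refine ⟨C * 2 * 2, fun m n => (h _ _).trans ?_⟩
  have := norm_eigenfunction_le hβ m
  have := norm_eigenfunction_le hβ n
  gcongr

/-- A solution of the modal equation has coefficients `P_{m,n} = O(1/|λ_m|)`, uniformly in `n`. -/
theorem IsModalRiccatiSolution.exists_bound (hβ : 0 < β) (h : IsModalRiccatiSolution β R Q P) :
    ∃ C, ∀ m n, |eigenvalue β m| * |coeff β P m n| ≤ C := by
  obtain ⟨CQ, hCQ⟩ := exists_form_eigenfunction_bound hβ Q
  refine ⟨|β ^ 2 * R⁻¹| * (‖kernelOp P‖ * ‖kernelOp P‖) + CQ, fun m n => ?_⟩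
  have h1 : |eigenvalue β m| ≤ |eigenvalue β m + eigenvalue β n| := by
    have hm := eigenvalue_neg hβ m
    have hn := eigenvalue_neg hβ n
    rw [abs_of_neg hm, abs_of_neg (add_neg hm hn)]
    linarith
  calc |eigenvalue β m| * |coeff β P m n| ≤
        |(eigenvalue β m + eigenvalue β n) * coeff β P m n| := by
        rw [abs_mul]; gcongr
    _ = |β ^ 2 * R⁻¹ * (kernelOp P (toL2 (eigenfunction β m)) 1 *
      kernelOp P (toL2 (eigenfunction β n)) 1) - Q (eigenfunction β m) (eigenfunction β n)| := by
        rw [← h m n, add_sub_cancel_right]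
    _ ≤ _ := (abs_sub _ _).trans ?_
  rw [abs_mul, abs_mul (kernelOp P (toL2 (eigenfunction β m)) 1)]
  have := abs_kernelOp_eigenfunction_le hβ P m 1
  have := abs_kernelOp_eigenfunction_le hβ P n 1
  have := hCQ m n
  gcongr

theorem hasSum_kernelOp_eigenfunction (hβ : 0 < β) {n : ℕ}
    (hs : Summable fun i => |coeff β P i n|) :
    HasSum (fun i => coeff β P i n • eigenfunction β i)
      (kernelOp P (toL2 (eigenfunction β n))) := by
  simp only [coeff_eq_mode] at hs ⊢
  exact hasSum_eigenfunction hβ hs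

/-- Each term of the weak equation for `θ` is an absolutely convergent double series in the
coordinates of `θ`, so the weak equation is the sum of the modal equations. -/
theorem IsModalRiccatiSolution.isWeakRiccatiSolution (hβ : 0 < β)
    (hP : ∀ x y, P (x, y) = P (y, x)) (h : IsModalRiccatiSolution β R Q P) :
    IsWeakRiccatiSolution β R Q P := by
  intro θ hθ
  rw [weakLaplacian_eq hP hθ, integral_quadratic_term hP hθ.continuous]
  set Θ := onRod θ hθ.continuous with hΘ
  set a : ℕ → ℝ := fun n => mode β n (toL2 Θ) with ha
  obtain ⟨C, hC⟩ := h.exists_bound hβ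
  obtain ⟨CQ, hCQ⟩ := exists_form_eigenfunction_bound hβ Q
  have sa : Summable fun n => |a n| := summable_mode_onRod hβ hθ
  have hsum : HasSum (fun n => a n • eigenfunction β n) Θ := hasSum_eigenfunction hβ sa
  have hTθ : HasSum (fun n => a n • kernelOp P (toL2 (eigenfunction β n)))
      (kernelOp P (toL2 Θ)) := by
    have := (hasSum_mode_smul hβ (toL2 Θ)).mapL (kernelOp P)
    simpa only [map_smul] using! this
  have saa : Summable fun i : ℕ × ℕ => |a i.1| * |a i.2| :=
    sa.mul_of_nonneg sa (fun _ => abs_nonneg _) (fun _ => abs_nonneg _)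
  -- each of the three terms is a double series in the coordinates of `θ`
  have s1 : HasSum (fun i : ℕ × ℕ => a i.1 * a i.2 * (eigenvalue β i.2 * coeff β P i.2 i.1))
      (robinForm β θ hθ (kernelOp P (toL2 Θ))) := by
    refine hasSum_prod_of_fiberwise (g := fun n => a n *
      robinForm β θ hθ (kernelOp P (toL2 (eigenfunction β n)))) ?_ (fun n => ?_) ?_
    · refine Summable.of_norm_bounded (saa.mul_right C) fun i => ?_
      rw [Real.norm_eq_abs, abs_mul, abs_mul, abs_mul]
      exact mul_le_mul_of_nonneg_left (hC _ _) (by positivity)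
    · have h1 := (hasSum_kernelOp_eigenfunction (P := P) hβ
        (summable_of_abs_eigenvalue_mul_le hβ fun i => hC i n)).mapL (robinForm β θ hθ)
      simp only [map_smul, smul_eq_mul, robinForm_eigenfunction hβ hθ] at h1
      refine (h1.mul_left (a n)).congr_fun fun i => ?_
      simp only [ha, mode, hΘ]
      ring
    · simpa only [map_smul, smul_eq_mul] using! hTθ.mapL (robinForm β θ hθ)
  have s1' : HasSum (fun i : ℕ × ℕ => a i.1 * a i.2 * (eigenvalue β i.1 * coeff β P i.1 i.2))
      (robinForm β θ hθ (kernelOp P (toL2 Θ))) := by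
    refine ((Equiv.prodComm ℕ ℕ).hasSum_iff.mpr s1).congr_fun fun i => ?_
    simp only [Function.comp_apply, Equiv.prodComm_apply, Prod.fst_swap, Prod.snd_swap]
    ring
  have s2 : HasSum (fun i : ℕ × ℕ => a i.1 * a i.2 *
      Q (eigenfunction β i.1) (eigenfunction β i.2)) (Q Θ Θ) := by
    refine hasSum_prod_of_fiberwise (g := fun n => a n * Q (eigenfunction β n) Θ) ?_
      (fun n => ?_) ?_
    · refine Summable.of_norm_bounded (saa.mul_right CQ) fun i => ?_
      rw [Real.norm_eq_abs, abs_mul, abs_mul]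
      exact mul_le_mul_of_nonneg_left (hCQ _ _) (by positivity)
    · have h1 := (hsum.mapL (Q (eigenfunction β n))).mul_left (a n)
      refine h1.congr_fun fun i => ?_
      simp only [map_smul, smul_eq_mul]
      ring
    · have h1 := hsum.mapL (Q.flip Θ)
      simpa only [map_smul, smul_eq_mul, ContinuousLinearMap.flip_apply] using! h1
  have s3 : HasSum (fun i : ℕ × ℕ => a i.1 * a i.2 *
      (kernelOp P (toL2 (eigenfunction β i.1)) 1 * kernelOp P (toL2 (eigenfunction β i.2)) 1))
      (kernelOp P (toL2 Θ) 1 ^ 2) := by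
    have hk : HasSum (fun n => a n * kernelOp P (toL2 (eigenfunction β n)) 1)
        (kernelOp P (toL2 Θ) 1) := by
      have h1 := hTθ.mapL (ContinuousMap.evalCLM ℝ (1 : Rod))
      simpa only [map_smul, smul_eq_mul, ContinuousMap.evalCLM_apply] using! h1
    refine hasSum_prod_of_fiberwise (g := fun n => a n *
      kernelOp P (toL2 (eigenfunction β n)) 1 * kernelOp P (toL2 Θ) 1) ?_ (fun n => ?_) ?_
    · refine Summable.of_norm_bounded (saa.mul_right (‖kernelOp P‖ * ‖kernelOp P‖)) fun i => ?_
      rw [Real.norm_eq_abs, abs_mul, abs_mul, abs_mul]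
      have := abs_kernelOp_eigenfunction_le hβ P i.1 1
      have := abs_kernelOp_eigenfunction_le hβ P i.2 1
      gcongr
    · refine (hk.mul_left (a n * kernelOp P (toL2 (eigenfunction β n)) 1)).congr_fun fun i => ?_
      ring
    · rw [sq]
      exact hk.mul_right _
  rw [two_mul]
  refine HasSum.unique ((s1'.add s1).add s2) ((s3.mul_left (β ^ 2 * R⁻¹)).congr_fun fun i => ?_)
  have := h i.1 i.2
  rw [coeff_symm hP i.2 i.1]
  linear_combination a i.1 * a i.2 * this

/-- If the rows of `(P_{m,n})` are absolutely summable, the expansion of `∫ P(·,x) φ_n(x) dx`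
converges uniformly and may be evaluated at `1`. -/
theorem isModal_iff_isAlgebraic_of_summable (hβ : 0 < β) (hP : ∀ x y, P (x, y) = P (y, x))
    (hs : ∀ n, Summable fun i => |coeff β P n i|) :
    IsModalRiccatiSolution β R Q P ↔ IsAlgebraicRiccatiSolution β R Q (coeff β P) := by
  have hsum : ∀ n, Summable fun i => ‖coeff β P n i * eigenfunction β i 1‖ := fun n => by
    refine ((hs n).mul_right 2).of_nonneg_of_le (fun i => norm_nonneg _) fun i => ?_
    rw [norm_mul]
    exact mul_le_mul_of_nonneg_left (abs_eigenfunction_le hβ i 1) (abs_nonneg _)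
  have hval : ∀ n, ∑' i, coeff β P n i * eigenfunction β i 1 =
      kernelOp P (toL2 (eigenfunction β n)) 1 := fun n => by
    have hs' : Summable fun i => |coeff β P i n| := by simpa only [coeff_symm hP n] using hs n
    have h1 := (hasSum_kernelOp_eigenfunction hβ hs').mapL (ContinuousMap.evalCLM ℝ (1 : Rod))
    simp only [map_smul, smul_eq_mul, ContinuousMap.evalCLM_apply, coeff_symm hP _ n] at h1
    exact h1.tsum_eq
  have hre : ∀ m n, (fun i : ℕ × ℕ => coeff β P m i.1 * coeff β P n i.2 *
      eigenfunction β i.1 1 * eigenfunction β i.2 1) = fun i : ℕ × ℕ =>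
      (coeff β P m i.1 * eigenfunction β i.1 1) * (coeff β P n i.2 * eigenfunction β i.2 1) :=
    fun m n => by funext i; ring
  refine forall₂_congr fun m n => ?_
  rw [hre, ← tsum_mul_tsum_of_summable_norm (hsum m) (hsum n), hval, hval]
  exact ⟨fun h => ⟨summable_mul_of_summable_norm (hsum m) (hsum n), h⟩, fun h => h.2⟩

/-- The double series in the `(n,n)` equation contains a multiple of the series of the terms
`p_{n,i} φ_i(1)`, and the numbers `φ_i(1)` are bounded away from zero. -/
theorem IsAlgebraicRiccatiSolution.summable_abs (hβ : 0 < β) {p : ℕ → ℕ → ℝ}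
    (h : IsAlgebraicRiccatiSolution β R Q p) (n : ℕ) : Summable fun i => |p n i| := by
  have h1 : Summable fun i => |p n i * eigenfunction β i 1| := by
    by_cases hz : ∃ j, p n j * eigenfunction β j 1 ≠ 0
    · obtain ⟨j, hj⟩ := hz
      have h2 := (h n n).1.comp_injective (i := fun i : ℕ => (i, j))
        (fun a b hab => (Prod.mk.inj hab).1)
      have h3 := (h2.mul_right (p n j * eigenfunction β j 1)⁻¹).abs
      refine h3.congr fun i => ?_
      simp only [Function.comp_apply]
      congr 1
      rw [← div_eq_mul_inv, div_eq_iff hj]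
      ring
    · push Not at hz
      simp only [hz, abs_zero]
      exact summable_zero
  obtain ⟨δ, hδ, hle⟩ := exists_le_abs_eigenfunction_one hβ
  refine (h1.mul_right δ⁻¹).of_nonneg_of_le (fun i => abs_nonneg _) fun i => ?_
  rw [← div_eq_mul_inv, le_div_iff₀ hδ, abs_mul]
  exact mul_le_mul_of_nonneg_left (hle i) (abs_nonneg _)

theorem IsModalRiccatiSolution.summable_abs (hβ : 0 < β) (hP : ∀ x y, P (x, y) = P (y, x))
    (h : IsModalRiccatiSolution β R Q P) (n : ℕ) : Summable fun i => |coeff β P n i| := by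
  obtain ⟨C, hC⟩ := h.exists_bound hβ
  simp only [coeff_symm hP n]
  exact summable_of_abs_eigenvalue_mul_le hβ fun i => hC i n

theorem isWeakRiccatiSolution_iff (hβ : 0 < β) (hQ : ∀ f g, Q f g = Q g f)
    (hP : ∀ x y, P (x, y) = P (y, x)) :
    IsWeakRiccatiSolution β R Q P ↔ IsAlgebraicRiccatiSolution β R Q (coeff β P) := by
  constructor
  · intro h
    have hm := h.isModalRiccatiSolution hβ hQ hP
    exact (isModal_iff_isAlgebraic_of_summable hβ hP (hm.summable_abs hβ hP)).mp hm
  · intro h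
    exact ((isModal_iff_isAlgebraic_of_summable hβ hP (h.summable_abs hβ)).mpr
      h).isWeakRiccatiSolution hβ hP

end Riccati

/-! ### The heat equation in eigenfunction coordinates: energy, uniqueness and stability -/

/-- If the integrals of nonnegative functions are summable, the functions are summable almost
everywhere, with an integrable sum. -/
theorem ae_summable_and_integrable_tsum {α : Type*} [MeasurableSpace α] {μ : Measure α}
    {F : ℕ → α → ℝ} (h0 : ∀ n x, 0 ≤ F n x) (hF : ∀ n, Integrable (F n) μ)
    (hs : Summable fun n => ∫ x, F n x ∂μ) :
    (∀ᵐ x ∂μ, Summable fun n => F n x) ∧ Integrable (fun x => ∑' n, F n x) μ := by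
  have hmeas : ∀ n, AEMeasurable (fun x => ENNReal.ofReal (F n x)) μ := fun n =>
    (hF n).aemeasurable.ennreal_ofReal
  have hfin : ∫⁻ x, ∑' n, ENNReal.ofReal (F n x) ∂μ ≠ ⊤ := by
    rw [lintegral_tsum hmeas]
    simp only [← ofReal_integral_eq_lintegral_ofReal (hF _) (Eventually.of_forall (h0 _))]
    exact hs.tsum_ofReal_ne_top
  have hae : ∀ᵐ x ∂μ, Summable fun n => F n x := by
    filter_upwards [ae_lt_top' (AEMeasurable.tsum hmeas) hfin] with x hx
    have := ENNReal.summable_toReal hx.ne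
    simpa only [ENNReal.toReal_ofReal (h0 _ _)] using this
  refine ⟨hae, ?_, ?_⟩
  · refine aestronglyMeasurable_of_tendsto_ae atTop
      (f := fun (N : ℕ) x => ∑ n ∈ Finset.range N, F n x)
      (fun N => (integrable_finsetSum _ fun n _ => hF n).aestronglyMeasurable) ?_
    filter_upwards [hae] with x hx
    exact hx.hasSum.tendsto_sum_nat
  · rw [hasFiniteIntegral_iff_ofReal (Eventually.of_forall fun x => tsum_nonneg fun n => h0 n x)]
    refine lt_of_eq_of_lt ?_ (lt_top_iff_ne_top.mpr hfin)
    refine lintegral_congr_ae ?_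
    filter_upwards [hae] with x hx
    exact ENNReal.ofReal_tsum_of_nonneg (fun n => h0 n x) hx

/-- The energy inequality for the scalar equation `x' = l x + b u`, `l < 0`. -/
theorem sq_add_integral_sq_le {x u : ℝ → ℝ} {l b B s t : ℝ} (hl : l < 0) (hst : s ≤ t)
    (hB : b ^ 2 ≤ B) (hx : ContinuousOn x (Icc s t)) (hu : IntervalIntegrable u volume s t)
    (hu2 : IntervalIntegrable (fun r => u r ^ 2) volume s t)
    (h : ∀ r ∈ Icc s t, x r = x s + ∫ q in s..r, (l * x q + b * u q)) :
    x t ^ 2 + |l| * ∫ r in s..t, x r ^ 2 ≤ x s ^ 2 + |l|⁻¹ * B * ∫ r in s..t, u r ^ 2 := by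
  rw [← uIcc_of_le hst] at hx
  have ix : IntervalIntegrable x volume s t := hx.intervalIntegrable
  have ix2 : IntervalIntegrable (fun r => x r ^ 2) volume s t := (hx.pow 2).intervalIntegrable
  have ixu : IntervalIntegrable (fun r => l * x r + b * u r) volume s t :=
    (ix.const_mul l).add (hu.const_mul b)
  have key := mul_sub_mul_eq_integral hst ixu ixu h h
  have hlpos : 0 < |l| := abs_pos.mpr hl.ne
  have hle : ∫ r in s..t, ((l * x r + b * u r) * x r + x r * (l * x r + b * u r)) ≤
      ∫ r in s..t, (-|l| * x r ^ 2 + |l|⁻¹ * B * u r ^ 2) := by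
    refine intervalIntegral.integral_mono_on hst
      ((ixu.mul_continuousOn hx).add (ixu.continuousOn_mul hx))
      ((ix2.const_mul _).add (hu2.const_mul _)) fun r _ => ?_
    have e : l = -|l| := by rw [abs_of_neg hl, neg_neg]
    have h1 : |l| * x r ^ 2 + |l|⁻¹ * b ^ 2 * u r ^ 2 - 2 * b * u r * x r =
        |l|⁻¹ * (|l| * x r - b * u r) ^ 2 := by
      field_simp
      ring
    have h2 : 0 ≤ |l|⁻¹ * (|l| * x r - b * u r) ^ 2 := by positivity
    have h3 : |l|⁻¹ * b ^ 2 * u r ^ 2 ≤ |l|⁻¹ * B * u r ^ 2 := by gcongr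
    have h4 : (l * x r + b * u r) * x r + x r * (l * x r + b * u r) =
        -2 * |l| * x r ^ 2 + 2 * b * u r * x r := by
      linear_combination 2 * x r ^ 2 * e
    rw [h4]
    linarith
  rw [intervalIntegral.integral_add (ix2.const_mul _) (hu2.const_mul _),
    intervalIntegral.integral_const_mul, intervalIntegral.integral_const_mul] at hle
  nlinarith

/-- The heat equation in eigenfunction coordinates: `z_n' = λ_n z_n + β φ_n(1) u` in integrated
form, for a locally square-integrable control and a continuous curve in `L²`. -/
structure HasModalDynamics (β : ℝ) (u : ℝ → ℝ) (z : ℝ → L2) : Prop where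
  control : ∀ T : ℝ, MemLp u 2 (volume.restrict (Ioc 0 T))
  continuousOn : ContinuousOn z (Ici 0)
  modal : ∀ (n : ℕ) (t : ℝ), 0 ≤ t → mode β n (z t) = mode β n (z 0) +
    ∫ s in (0 : ℝ)..t, (eigenvalue β n * mode β n (z s) + β * eigenfunction β n 1 * u s)

theorem inner_onRod {θ : ℝ → ℝ} (hθ : Continuous θ) (f : L2) :
    inner ℝ (toL2 (onRod θ hθ)) f = ∫ x : Rod, θ x * f x := inner_toL2 _ _

theorem robinForm_add_control (β : ℝ) {θ : ℝ → ℝ} (hθ : ContDiff ℝ 2 θ) (Z : C(Rod, ℝ)) (v : ℝ) :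
    (∫ x : Rod, deriv (deriv θ) x * Z x) + deriv θ 0 * Z 0 - deriv θ 1 * Z 1
      + θ 1 * (β * (v - Z 1)) = robinForm β θ hθ Z + β * θ 1 * v := by
  rw [robinForm_apply]; ring

/-- The weak equation tested with `φ_n`. -/
theorem IsTrajectory.hasModalDynamics {β : ℝ} (hβ : 0 < β) {z0 : L2} {u : ℝ → ℝ} {z : ℝ → L2}
    {Z : ℝ → C(Rod, ℝ)} (h : IsTrajectory β z0 u z Z) : HasModalDynamics β u z where
  control := h.control
  continuousOn := h.continuousOn
  modal n t ht := by
    have hn := contDiff_eigenfunctionExt (β := β) n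
    have hw := h.weak _ hn t ht
    rw [← inner_onRod hn.continuous, ← inner_onRod hn.continuous] at hw
    simp only [robinForm_add_control β hn, robinForm_eigenfunctionExt hβ] at hw
    change mode β n (z t) - mode β n z0 = _ at hw
    rw [h.initial, ← sub_eq_iff_eq_add', hw]
    refine intervalIntegral.integral_congr_ae ?_
    have hr := h.representative
    rw [ae_restrict_iff' measurableSet_Ioi] at hr
    filter_upwards [hr] with s hs hst
    rw [uIoc_of_le ht] at hst
    have hs' : toL2 (Z s) = z s := hs hst.1
    rw [hs']
    rfl

section Dynamics

variable {β : ℝ} {u u' : ℝ → ℝ} {z z' : ℝ → L2}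

theorem continuous_mode (n : ℕ) : Continuous (mode β n) := by
  unfold mode
  fun_prop

theorem integrable_control (hu : ∀ T : ℝ, MemLp u 2 (volume.restrict (Ioc 0 T))) {s t : ℝ}
    (hs : 0 ≤ s) (hst : s ≤ t) : IntervalIntegrable u volume s t := by
  rw [intervalIntegrable_iff_integrableOn_Ioc_of_le hst]
  have h : IntegrableOn u (Ioc 0 t) := (hu t).integrable (by norm_num)
  exact h.mono_set (Ioc_subset_Ioc_left hs)

theorem integrable_control_sq (hu : ∀ T : ℝ, MemLp u 2 (volume.restrict (Ioc 0 T))) {s t : ℝ}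
    (hs : 0 ≤ s) (hst : s ≤ t) : IntervalIntegrable (fun r => u r ^ 2) volume s t := by
  rw [intervalIntegrable_iff_integrableOn_Ioc_of_le hst]
  have h : IntegrableOn (fun r => u r ^ 2) (Ioc 0 t) := (hu t).integrable_sq
  exact h.mono_set (Ioc_subset_Ioc_left hs)

namespace HasModalDynamics

theorem continuousOn_mode (h : HasModalDynamics β u z) (n : ℕ) :
    ContinuousOn (fun t => mode β n (z t)) (Ici 0) :=
  (continuous_mode n).comp_continuousOn h.continuousOn

theorem intervalIntegrable_rhs (h : HasModalDynamics β u z) (n : ℕ) {s t : ℝ} (hs : 0 ≤ s)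
    (hst : s ≤ t) : IntervalIntegrable
      (fun q => eigenvalue β n * mode β n (z q) + β * eigenfunction β n 1 * u q) volume s t := by
  refine IntervalIntegrable.add (IntervalIntegrable.const_mul ?_ _)
    ((integrable_control h.control hs hst).const_mul _)
  refine ((h.continuousOn_mode n).mono ?_).intervalIntegrable
  rw [uIcc_of_le hst]
  exact fun r hr => hs.trans hr.1

theorem modal_from (h : HasModalDynamics β u z) (n : ℕ) {s t : ℝ} (hs : 0 ≤ s) (hst : s ≤ t) :
    mode β n (z t) = mode β n (z s) +
      ∫ q in s..t, (eigenvalue β n * mode β n (z q) + β * eigenfunction β n 1 * u q) := by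
  have h1 := intervalIntegral.integral_add_adjacent_intervals
    (h.intervalIntegrable_rhs n le_rfl hs) (h.intervalIntegrable_rhs n hs hst)
  rw [h.modal n t (hs.trans hst), h.modal n s hs, ← h1]
  ring

theorem sub (h : HasModalDynamics β u z) (h' : HasModalDynamics β u' z') :
    HasModalDynamics β (fun t => u t - u' t) (fun t => z t - z' t) where
  control T := (h.control T).sub (h'.control T)
  continuousOn := h.continuousOn.sub h'.continuousOn
  modal n t ht := by
    simp only [mode_sub]
    rw [h.modal n t ht, h'.modal n t ht, add_sub_add_comm,
      ← intervalIntegral.integral_sub (h.intervalIntegrable_rhs n le_rfl ht)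
        (h'.intervalIntegrable_rhs n le_rfl ht)]
    congr 1
    refine intervalIntegral.integral_congr fun s _ => ?_
    ring

theorem mode_energy (hβ : 0 < β) (h : HasModalDynamics β u z) (n : ℕ) {s t : ℝ} (hs : 0 ≤ s)
    (hst : s ≤ t) :
    mode β n (z t) ^ 2 + |eigenvalue β n| * ∫ r in s..t, mode β n (z r) ^ 2 ≤
      mode β n (z s) ^ 2 + |eigenvalue β n|⁻¹ * (4 * β ^ 2) * ∫ r in s..t, u r ^ 2 := by
  refine sq_add_integral_sq_le (b := β * eigenfunction β n 1) (eigenvalue_neg hβ n) hst ?_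
    ((h.continuousOn_mode n).mono fun r hr => hs.trans hr.1) (integrable_control h.control hs hst)
    (integrable_control_sq h.control hs hst) fun r hr => h.modal_from n hs hr.1
  have h1 := abs_eigenfunction_le hβ n 1
  have h2 : eigenfunction β n 1 ^ 2 ≤ 2 ^ 2 := sq_le_sq' (abs_le.mp h1).1 (abs_le.mp h1).2
  rw [mul_pow]
  nlinarith [sq_nonneg β]

end HasModalDynamics

/-- The constant in the energy inequality: `4 β² ∑ 1/|λ_n|`, where `4` bounds `φ_n(1)²`. -/
def energyConst (β : ℝ) : ℝ := (∑' n, |eigenvalue β n|⁻¹) * (4 * β ^ 2)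

theorem energyConst_nonneg (β : ℝ) : 0 ≤ energyConst β :=
  mul_nonneg (tsum_nonneg fun n => inv_nonneg.mpr (abs_nonneg _)) (by positivity)

namespace HasModalDynamics

/-- The sum of the right hand sides of the modal energy inequalities. -/
theorem hasSum_energy_bound (hβ : 0 < β) (f : L2) (c : ℝ) :
    HasSum (fun n => mode β n f ^ 2 + |eigenvalue β n|⁻¹ * (4 * β ^ 2) * c)
      (‖f‖ ^ 2 + energyConst β * c) :=
  (hasSum_mode_sq hβ f).add
    (((summable_inv_abs_eigenvalue hβ).hasSum.mul_right _).mul_right _)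

theorem norm_sq_le (hβ : 0 < β) (h : HasModalDynamics β u z) {s t : ℝ} (hs : 0 ≤ s)
    (hst : s ≤ t) : ‖z t‖ ^ 2 ≤ ‖z s‖ ^ 2 + energyConst β * ∫ r in s..t, u r ^ 2 := by
  refine hasSum_le (fun n => ?_) (hasSum_mode_sq hβ (z t)) (hasSum_energy_bound hβ (z s) _)
  have h1 := h.mode_energy hβ n hs hst
  have h2 : 0 ≤ |eigenvalue β n| * ∫ r in s..t, mode β n (z r) ^ 2 :=
    mul_nonneg (abs_nonneg _) (intervalIntegral.integral_nonneg hst fun r _ => sq_nonneg _)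
  linarith

theorem summable_mul_integral_sq (hβ : 0 < β) (h : HasModalDynamics β u z) {t : ℝ} (ht : 0 ≤ t) :
    Summable fun n => |eigenvalue β n| * ∫ r in (0 : ℝ)..t, mode β n (z r) ^ 2 := by
  refine (hasSum_energy_bound hβ (z 0) (∫ r in (0 : ℝ)..t, u r ^ 2)).summable.of_nonneg_of_le
    (fun n => mul_nonneg (abs_nonneg _)
      (intervalIntegral.integral_nonneg ht fun r _ => sq_nonneg _)) fun n => ?_
  linarith [h.mode_energy hβ n le_rfl ht, sq_nonneg (mode β n (z t))]

theorem integral_norm_sq_le (hβ : 0 < β) (h : HasModalDynamics β u z) {t : ℝ} (ht : 0 ≤ t) :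
    |eigenvalue β 0| * ∫ r in (0 : ℝ)..t, ‖z r‖ ^ 2 ≤
      ‖z 0‖ ^ 2 + energyConst β * ∫ r in (0 : ℝ)..t, u r ^ 2 := by
  have hc : ContinuousOn z (uIcc 0 t) := h.continuousOn.mono (by
    rw [uIcc_of_le ht]; exact Icc_subset_Ici_self)
  have hcm : ∀ n, ContinuousOn (fun r => mode β n (z r) ^ 2) (uIcc 0 t) := fun n =>
    ((continuous_mode n).comp_continuousOn hc).pow 2
  have hs : HasSum (fun n => ∫ r in (0 : ℝ)..t, mode β n (z r) ^ 2)
      (∫ r in (0 : ℝ)..t, ‖z r‖ ^ 2) := by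
    refine intervalIntegral.hasSum_integral_of_dominated_convergence
      (fun n r => mode β n (z r) ^ 2)
      (fun n => (hcm n).intervalIntegrable.aestronglyMeasurable_restrict_uIoc)
      (fun n => Eventually.of_forall fun r _ => by simp)
      (Eventually.of_forall fun r _ => (hasSum_mode_sq hβ (z r)).summable) ?_
      (Eventually.of_forall fun r _ => hasSum_mode_sq hβ (z r))
    simp only [(hasSum_mode_sq hβ _).tsum_eq]
    exact (hc.norm.pow 2).intervalIntegrable
  refine hasSum_le (fun n => ?_) (hs.mul_left |eigenvalue β 0|) (hasSum_energy_bound hβ (z 0) _)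
  have h1 := h.mode_energy hβ n le_rfl ht
  have h2 : |eigenvalue β 0| * ∫ r in (0 : ℝ)..t, mode β n (z r) ^ 2 ≤
      |eigenvalue β n| * ∫ r in (0 : ℝ)..t, mode β n (z r) ^ 2 :=
    mul_le_mul_of_nonneg_right (abs_eigenvalue_mono hβ (Nat.zero_le n))
      (intervalIntegral.integral_nonneg ht fun r _ => sq_nonneg _)
  linarith [sq_nonneg (mode β n (z t))]

/-- The weighted sum `∑ |λ_n| z_n²`, the squared energy norm of the state, is locally integrable
in time. -/
theorem ae_summable_energy (hβ : 0 < β) (h : HasModalDynamics β u z) {t : ℝ} (ht : 0 ≤ t) :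
    (∀ᵐ s ∂(volume.restrict (Ioc 0 t)), Summable fun n => |eigenvalue β n| * mode β n (z s) ^ 2) ∧
      IntegrableOn (fun s => ∑' n, |eigenvalue β n| * mode β n (z s) ^ 2) (Ioc 0 t) := by
  refine ae_summable_and_integrable_tsum (fun n s => by positivity) (fun n => ?_) ?_
  · have hc : ContinuousOn (fun r => |eigenvalue β n| * mode β n (z r) ^ 2) (uIcc 0 t) := by
      refine (((h.continuousOn_mode n).mono ?_).pow 2).const_mul _
      rw [uIcc_of_le ht]; exact Icc_subset_Ici_self
    have := hc.intervalIntegrable (μ := volume)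
    rwa [intervalIntegrable_iff_integrableOn_Ioc_of_le ht] at this
  · simp only [integral_const_mul]
    simpa only [intervalIntegral.integral_of_le ht] using! h.summable_mul_integral_sq hβ ht

end HasModalDynamics

/-- The Cauchy–Schwarz bound of the `ℓ¹` norm of the coordinates by the energy norm. -/
theorem sum_abs_sq_le (hβ : 0 < β) {x : ℕ → ℝ}
    (hx : Summable fun n => |eigenvalue β n| * x n ^ 2) (s : Finset ℕ) :
    (∑ n ∈ s, |x n|) ^ 2 ≤
      (∑' n, |eigenvalue β n|⁻¹) * ∑' n, |eigenvalue β n| * x n ^ 2 := by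
  have h1 := Finset.sum_sq_le_sum_mul_sum_of_sq_le_mul s (r := fun n => |x n|)
    (f := fun n => |eigenvalue β n|⁻¹) (g := fun n => |eigenvalue β n| * x n ^ 2)
    (fun n _ => by positivity) (fun n _ => by positivity) (fun n _ => by
      rw [inv_mul_cancel_left₀ (abs_eigenvalue_pos hβ n).ne', sq_abs])
  refine h1.trans (mul_le_mul ((summable_inv_abs_eigenvalue hβ).sum_le_tsum s
    fun n _ => by positivity) (hx.sum_le_tsum s fun n _ => by positivity)
    (Finset.sum_nonneg fun n _ => by positivity) (tsum_nonneg fun n => by positivity))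

theorem summable_abs_of_energy (hβ : 0 < β) {x : ℕ → ℝ}
    (hx : Summable fun n => |eigenvalue β n| * x n ^ 2) : Summable fun n => |x n| := by
  refine summable_of_sum_le (fun n => abs_nonneg _) fun s =>
    Real.le_sqrt_of_sq_le (sum_abs_sq_le hβ hx s)

namespace HasModalDynamics

/-- Uniqueness for a linear feedback, by Grönwall's inequality. -/
theorem eq_zero_of_feedback (hβ : 0 < β) {k : L2 →L[ℝ] ℝ}
    (h : HasModalDynamics β u z) (hu : ∀ t, 0 ≤ t → u t = k (z t)) (h0 : z 0 = 0) {t : ℝ}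
    (ht : 0 ≤ t) : z t = 0 := by
  set M := energyConst β * ‖k‖ ^ 2 with hM
  have hM0 : 0 ≤ M := mul_nonneg (energyConst_nonneg β) (sq_nonneg _)
  have hcz : ContinuousOn (fun r => ‖z r‖ ^ 2) (Icc 0 t) :=
    (h.continuousOn.mono Icc_subset_Ici_self).norm.pow 2
  have iz : ∀ r ∈ Icc 0 t, IntervalIntegrable (fun r => ‖z r‖ ^ 2) volume 0 r := fun r hr => by
    refine (hcz.mono ?_).intervalIntegrable
    rw [uIcc_of_le hr.1]
    exact Icc_subset_Icc_right hr.2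
  have hle : ∀ r ∈ Icc 0 t, ‖z r‖ ^ 2 ≤ M * ∫ q in (0 : ℝ)..r, ‖z q‖ ^ 2 := by
    intro r hr
    have h1 := h.norm_sq_le hβ le_rfl hr.1
    rw [h0, norm_zero, zero_pow two_ne_zero, zero_add] at h1
    refine h1.trans ?_
    rw [hM, mul_assoc, ← intervalIntegral.integral_const_mul (‖k‖ ^ 2)]
    refine mul_le_mul_of_nonneg_left ?_ (energyConst_nonneg β)
    refine intervalIntegral.integral_mono_on hr.1 (integrable_control_sq h.control le_rfl hr.1)
      ((iz r hr).const_mul _) fun q hq => ?_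
    rw [hu q hq.1, ← mul_pow, ← sq_abs]
    exact pow_le_pow_left₀ (abs_nonneg _) (k.le_opNorm _) 2
  -- Grönwall's inequality for `∫₀ʳ ‖z‖²`
  have hE : ∀ r ∈ Icc 0 t, ‖∫ q in (0 : ℝ)..r, ‖z q‖ ^ 2‖ ≤ gronwallBound 0 M 0 (r - 0) := by
    refine norm_le_gronwallBound_of_norm_deriv_right_le (f' := fun r => ‖z r‖ ^ 2) ?_ ?_ (by simp)
      ?_
    · have := intervalIntegral.continuousOn_primitive_interval' (μ := volume)
        (iz t (right_mem_Icc.mpr ht)) (a := 0) (by simp)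
      rwa [uIcc_of_le ht] at this
    · intro r hr
      have hr' : r ∈ Icc 0 t := Ico_subset_Icc_self hr
      have hc : ContinuousWithinAt (fun r => ‖z r‖ ^ 2) (Ici r) r :=
        ((h.continuousOn.norm.pow 2) r hr.1).mono (Ici_subset_Ici.mpr hr.1)
      refine intervalIntegral.integral_hasDerivWithinAt_right (iz r hr') (t := Ioi r) ?_
        (hc.mono Ioi_subset_Ici_self)
      refine ⟨Icc 0 t, ?_, (hcz.aestronglyMeasurable measurableSet_Icc)⟩
      exact mem_of_superset (Ioo_mem_nhdsGT hr.2) fun q hq => ⟨hr.1.trans hq.1.le, hq.2.le⟩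
    · intro r hr
      have h1 := hle r (Ico_subset_Icc_self hr)
      have h2 : 0 ≤ ∫ q in (0 : ℝ)..r, ‖z q‖ ^ 2 :=
        intervalIntegral.integral_nonneg hr.1 fun q _ => sq_nonneg _
      rw [Real.norm_of_nonneg (sq_nonneg _), Real.norm_of_nonneg h2, add_zero]
      exact h1
  have h1 := hE t (right_mem_Icc.mpr ht)
  have hg : gronwallBound 0 M 0 (t - 0) = 0 := by
    simp [gronwallBound_ε0]
  rw [hg, norm_le_zero_iff] at h1
  have h2 := hle t (right_mem_Icc.mpr ht)
  rw [h1, mul_zero] at h2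
  have h3 : ‖z t‖ ^ 2 = 0 := le_antisymm h2 (sq_nonneg _)
  exact norm_eq_zero.mp (pow_eq_zero_iff two_ne_zero |>.mp h3)

/-- Controls of finite energy steer the state to zero: `∫ ‖z‖²` is finite, and `‖z‖²` increases by
at most a multiple of `∫ u²`. -/
theorem tendsto_zero (hβ : 0 < β) (h : HasModalDynamics β u z)
    (hu : IntegrableOn (fun t => u t ^ 2) (Ioi 0)) : Tendsto z atTop (𝓝 0) := by
  set E := energyConst β with hE
  have hE0 : 0 ≤ E := energyConst_nonneg β
  have hlim := intervalIntegral_tendsto_integral_Ioi 0 hu tendsto_id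
  set I := ∫ t in Ioi (0 : ℝ), u t ^ 2 with hI
  have hmono : ∀ t, 0 ≤ t → ∫ r in (0 : ℝ)..t, u r ^ 2 ≤ I := fun t ht => by
    rw [intervalIntegral.integral_of_le ht]
    exact setIntegral_mono_set hu (Eventually.of_forall fun r => sq_nonneg _)
      (Ioc_subset_Ioi_self.eventuallyLE)
  set B := ‖z 0‖ ^ 2 + E * I with hB
  have hint : ∀ t, 0 ≤ t → |eigenvalue β 0| * ∫ r in (0 : ℝ)..t, ‖z r‖ ^ 2 ≤ B := fun t ht =>
    (h.integral_norm_sq_le hβ ht).trans (by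
      have := mul_le_mul_of_nonneg_left (hmono t ht) hE0
      linarith)
  rw [Metric.tendsto_atTop]
  intro ε hε
  have hε2 : 0 < ε ^ 2 / 2 := by positivity
  -- after time `s` the control cannot increase `‖z‖²` by `ε²/2`
  obtain ⟨s, hs0, hs⟩ : ∃ s, 0 ≤ s ∧ ∀ a b, s ≤ a → a ≤ b →
      E * ∫ r in a..b, u r ^ 2 < ε ^ 2 / 2 := by
    have h1 : Tendsto (fun t => E * (I - ∫ r in (0 : ℝ)..t, u r ^ 2)) atTop (𝓝 0) := by
      have := (hlim.const_sub I).const_mul E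
      simpa using! this
    obtain ⟨s, hs⟩ := (h1.eventually (gt_mem_nhds hε2)).exists_forall_of_atTop
    refine ⟨max s 0, le_max_right _ _, fun a b ha hab => ?_⟩
    have ha0 : 0 ≤ a := (le_max_right _ _).trans ha
    have h2 := intervalIntegral.integral_add_adjacent_intervals
      (integrable_control_sq h.control le_rfl ha0) (integrable_control_sq h.control ha0 hab)
    have h3 := hmono b (ha0.trans hab)
    refine lt_of_le_of_lt ?_ (hs a ((le_max_left _ _).trans ha))
    refine mul_le_mul_of_nonneg_left ?_ hE0
    linarith
  -- since `∫ ‖z‖²` is finite, `‖z‖² < ε²/2` at some later time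
  obtain ⟨a, ha, hza⟩ : ∃ a, s ≤ a ∧ ‖z a‖ ^ 2 < ε ^ 2 / 2 := by
    by_contra! hcon
    have hl := abs_eigenvalue_pos hβ 0
    set L := B / (|eigenvalue β 0| * (ε ^ 2 / 2)) + 1 with hL
    have hB0 : 0 ≤ B := by
      have := hmono 0 le_rfl
      rw [intervalIntegral.integral_same] at this
      positivity
    have hL0 : 0 ≤ L := by positivity
    have hz2 : ∀ a b, 0 ≤ a → a ≤ b → IntervalIntegrable (fun r => ‖z r‖ ^ 2) volume a b :=
      fun a b ha hab => ((h.continuousOn.norm.pow 2).mono (by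
        rw [uIcc_of_le hab]; exact fun r hr => ha.trans hr.1)).intervalIntegrable
    have h1 : ∫ r in s..(s + L), ε ^ 2 / 2 ≤ ∫ r in s..(s + L), ‖z r‖ ^ 2 :=
      intervalIntegral.integral_mono_on (by linarith) intervalIntegrable_const
        (hz2 _ _ hs0 (by linarith)) fun r hr => hcon r hr.1
    have h2 := intervalIntegral.integral_add_adjacent_intervals (hz2 0 s le_rfl hs0)
      (hz2 s (s + L) hs0 (by linarith))
    have h3 : 0 ≤ ∫ r in (0 : ℝ)..s, ‖z r‖ ^ 2 :=
      intervalIntegral.integral_nonneg hs0 fun r _ => sq_nonneg _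
    have h4 := hint (s + L) (by linarith)
    rw [intervalIntegral.integral_const, smul_eq_mul, add_sub_cancel_left] at h1
    have h5 : |eigenvalue β 0| * (L * (ε ^ 2 / 2)) ≤ B :=
      (mul_le_mul_of_nonneg_left (by linarith) hl.le).trans h4
    have h6 : |eigenvalue β 0| * (L * (ε ^ 2 / 2)) = B + |eigenvalue β 0| * (ε ^ 2 / 2) := by
      rw [hL]
      field_simp
    have : 0 < |eigenvalue β 0| * (ε ^ 2 / 2) := by positivity
    linarith
  refine ⟨a, fun t ht => ?_⟩
  rw [dist_zero_right]
  have h1 := h.norm_sq_le hβ (hs0.trans ha) ht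
  have h2 := hs a t ha ht
  exact lt_of_pow_lt_pow_left₀ 2 hε.le (by linarith)

end HasModalDynamics

end Dynamics

/-! ### The cost identity -/

theorem intervalIntegrable_finsetSum {ι : Type*} (s : Finset ι) {f : ι → ℝ → ℝ} {a b : ℝ}
    (h : ∀ i ∈ s, IntervalIntegrable (f i) volume a b) :
    IntervalIntegrable (fun x => ∑ i ∈ s, f i x) volume a b := by
  rw [← Finset.sum_fn]
  exact IntervalIntegrable.sum s h

section CostIdentity

variable {β R : ℝ} {Q : C(Rod, ℝ) →L[ℝ] C(Rod, ℝ) →L[ℝ] ℝ} {P : C(Rod × Rod, ℝ)}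

/-- The combination `∑_{n < N} x_n φ_n`. -/
def truncation (β : ℝ) (x : ℕ → ℝ) (N : ℕ) : C(Rod, ℝ) :=
  ∑ n ∈ Finset.range N, x n • eigenfunction β n

theorem norm_truncation_le (hβ : 0 < β) (x : ℕ → ℝ) (N : ℕ) :
    ‖truncation β x N‖ ≤ 2 * ∑ n ∈ Finset.range N, |x n| := by
  rw [truncation, Finset.mul_sum]
  refine norm_sum_le_of_le _ fun n _ => ?_
  rw [norm_smul, Real.norm_eq_abs, mul_comm]
  exact mul_le_mul_of_nonneg_right (norm_eigenfunction_le hβ n) (abs_nonneg _)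

theorem quadForm_truncation (x : ℕ → ℝ) (N : ℕ) : quadForm P (toL2 (truncation β x N)) =
    ∑ m ∈ Finset.range N, ∑ n ∈ Finset.range N, coeff β P m n * (x m * x n) := by
  rw [quadForm_eq_inner]
  simp only [truncation, map_sum, map_smul, inner_sum, sum_inner, inner_smul_left,
    inner_smul_right, inner_kernelOp_toL2, RCLike.conj_to_real, Finset.mul_sum]
  refine Finset.sum_congr rfl fun m _ => Finset.sum_congr rfl fun n _ => ?_
  rw [coeff]
  ring

theorem kernelOp_truncation (x : ℕ → ℝ) (N : ℕ) : kernelOp P (toL2 (truncation β x N)) 1 =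
    ∑ n ∈ Finset.range N, x n * kernelOp P (toL2 (eigenfunction β n)) 1 := by
  simp only [truncation, map_sum, map_smul, ContinuousMap.sum_apply, ContinuousMap.smul_apply,
    smul_eq_mul]

theorem form_truncation (x : ℕ → ℝ) (N : ℕ) : Q (truncation β x N) (truncation β x N) =
    ∑ m ∈ Finset.range N, ∑ n ∈ Finset.range N,
      Q (eigenfunction β m) (eigenfunction β n) * (x m * x n) := by
  have h1 : ∀ f, Q (truncation β x N) f =
      ∑ m ∈ Finset.range N, x m * Q (eigenfunction β m) f := fun f => by
    simp only [truncation, map_sum, map_smul, sum_apply, smul_apply, smul_eq_mul]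
  rw [h1]
  refine Finset.sum_congr rfl fun m _ => ?_
  simp only [truncation, map_sum, map_smul, smul_eq_mul, Finset.mul_sum]
  refine Finset.sum_congr rfl fun n _ => ?_
  ring

/-- The truncated boundary pairing `∑_{m,n < N} x_m P_{m,n} φ_n(1)`. -/
def truncatedTrace (β : ℝ) (P : C(Rod × Rod, ℝ)) (x : ℕ → ℝ) (N : ℕ) : ℝ :=
  ∑ m ∈ Finset.range N, ∑ n ∈ Finset.range N, x m * coeff β P m n * eigenfunction β n 1

/-- The time derivative of the truncated quadratic form, simplified by the Riccati equation. -/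
theorem IsModalRiccatiSolution.truncated_derivative (hP : ∀ x y, P (x, y) = P (y, x))
    (h : IsModalRiccatiSolution β R Q P) (x : ℕ → ℝ) (v : ℝ) (N : ℕ) :
    ∑ m ∈ Finset.range N, ∑ n ∈ Finset.range N, coeff β P m n *
      ((eigenvalue β m * x m + β * eigenfunction β m 1 * v) * x n +
        x m * (eigenvalue β n * x n + β * eigenfunction β n 1 * v)) =
    β ^ 2 * R⁻¹ * kernelOp P (toL2 (truncation β x N)) 1 ^ 2
      - Q (truncation β x N) (truncation β x N) + 2 * β * v * truncatedTrace β P x N := by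
  have e1 : truncatedTrace β P x N = ∑ m ∈ Finset.range N, ∑ n ∈ Finset.range N,
      x n * coeff β P m n * eigenfunction β m 1 := by
    rw [truncatedTrace, Finset.sum_comm]
    simp only [coeff_symm hP]
  have e2 : 2 * β * v * truncatedTrace β P x N = ∑ m ∈ Finset.range N, ∑ n ∈ Finset.range N,
      β * v * (x m * coeff β P m n * eigenfunction β n 1 +
        x n * coeff β P m n * eigenfunction β m 1) := by
    simp only [← Finset.mul_sum, Finset.sum_add_distrib]
    rw [← e1, ← truncatedTrace]
    ring
  rw [e2, form_truncation, kernelOp_truncation, sq (∑ n ∈ Finset.range N, _),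
    Finset.sum_mul_sum, Finset.mul_sum,
    ← Finset.sum_sub_distrib, ← Finset.sum_add_distrib]
  refine Finset.sum_congr rfl fun m _ => ?_
  rw [Finset.mul_sum, ← Finset.sum_sub_distrib, ← Finset.sum_add_distrib]
  refine Finset.sum_congr rfl fun n _ => ?_
  linear_combination x m * x n * h m n

/-- The bound `P_{m,n} = O(1/|λ_n|)` makes the truncated boundary pairings bounded by the `ℓ¹`
norm of the coordinates, uniformly in the truncation. -/
theorem IsModalRiccatiSolution.exists_truncatedTrace_bound (hβ : 0 < β)
    (hP : ∀ x y, P (x, y) = P (y, x)) (h : IsModalRiccatiSolution β R Q P) :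
    ∃ D, 0 ≤ D ∧ ∀ (x : ℕ → ℝ) (N : ℕ),
      |truncatedTrace β P x N| ≤ (∑ n ∈ Finset.range N, |x n|) * D := by
  obtain ⟨C, hC⟩ := h.exists_bound hβ
  have hC0 : 0 ≤ C := (mul_nonneg (abs_nonneg _) (abs_nonneg _)).trans (hC 0 0)
  have hsum := summable_inv_abs_eigenvalue hβ
  refine ⟨(∑' n, |eigenvalue β n|⁻¹) * (C * 2), mul_nonneg
    (tsum_nonneg fun n => inv_nonneg.mpr (abs_nonneg _)) (by positivity), fun x N => ?_⟩
  rw [truncatedTrace, Finset.sum_mul]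
  refine (Finset.abs_sum_le_sum_abs _ _).trans (Finset.sum_le_sum fun m _ => ?_)
  simp only [mul_assoc, ← Finset.mul_sum]
  rw [abs_mul]
  refine mul_le_mul_of_nonneg_left ?_ (abs_nonneg _)
  refine (Finset.abs_sum_le_sum_abs _ _).trans ?_
  refine le_trans ?_ (mul_le_mul_of_nonneg_right
    (hsum.sum_le_tsum (Finset.range N) fun n _ => inv_nonneg.mpr (abs_nonneg _)) (by positivity))
  rw [Finset.sum_mul]
  refine Finset.sum_le_sum fun n _ => ?_
  have h1 : |coeff β P m n| ≤ |eigenvalue β n|⁻¹ * C := by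
    rw [inv_mul_eq_div, le_div_iff₀ (abs_eigenvalue_pos hβ n), mul_comm, coeff_symm hP]
    exact hC n m
  have h2 := abs_eigenfunction_le hβ n 1
  rw [abs_mul, ← mul_assoc]
  have := abs_eigenvalue_pos hβ n
  gcongr

/-- The truncated boundary pairings converge to `∫ P(1,x) f(x) dx`. -/
theorem IsModalRiccatiSolution.tendsto_truncatedTrace (hβ : 0 < β)
    (hP : ∀ x y, P (x, y) = P (y, x)) (h : IsModalRiccatiSolution β R Q P) {f : L2}
    (hf : Summable fun n => |mode β n f|) :
    Tendsto (truncatedTrace β P fun n => mode β n f) atTop (𝓝 (kernelOp P f 1)) := by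
  obtain ⟨C, hC⟩ := h.exists_bound hβ
  have hS : HasSum (fun i : ℕ × ℕ => mode β i.1 f * coeff β P i.1 i.2 * eigenfunction β i.2 1)
      (kernelOp P f 1) := by
    refine hasSum_prod_of_fiberwise
      (g := fun m => mode β m f * kernelOp P (toL2 (eigenfunction β m)) 1) ?_ (fun m => ?_) ?_
    · have hs : Summable fun i : ℕ × ℕ => |mode β i.1 f| * |eigenvalue β i.2|⁻¹ :=
        hf.mul_of_nonneg (summable_inv_abs_eigenvalue hβ) (fun _ => abs_nonneg _)
          (fun _ => inv_nonneg.mpr (abs_nonneg _))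
      refine Summable.of_norm_bounded (hs.mul_right (C * 2)) fun i => ?_
      have h1 : |coeff β P i.1 i.2| ≤ |eigenvalue β i.2|⁻¹ * C := by
        rw [inv_mul_eq_div, le_div_iff₀ (abs_eigenvalue_pos hβ _), mul_comm, coeff_symm hP]
        exact hC _ _
      have h2 := abs_eigenfunction_le hβ i.2 1
      have hC0 : 0 ≤ |eigenvalue β i.2|⁻¹ * C := (abs_nonneg _).trans h1
      rw [Real.norm_eq_abs, abs_mul, abs_mul]
      calc |mode β i.1 f| * |coeff β P i.1 i.2| * |eigenfunction β i.2 1| ≤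
            |mode β i.1 f| * (|eigenvalue β i.2|⁻¹ * C) * 2 := by gcongr
        _ = _ := by ring
    · have hs : Summable fun i => |coeff β P i m| := by
        simpa only [coeff_symm hP m] using h.summable_abs hβ hP m
      have h1 := (hasSum_kernelOp_eigenfunction hβ hs).mapL (ContinuousMap.evalCLM ℝ (1 : Rod))
      simp only [map_smul, smul_eq_mul, ContinuousMap.evalCLM_apply] at h1
      refine (h1.mul_left (mode β m f)).congr_fun fun i => ?_
      rw [coeff_symm hP i m]
      ring
    · have h1 := ((hasSum_mode_smul hβ f).mapL (kernelOp P)).mapL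
        (ContinuousMap.evalCLM ℝ (1 : Rod))
      simpa only [map_smul, smul_eq_mul, ContinuousMap.evalCLM_apply] using! h1
  have ht : Tendsto (fun N => Finset.range N ×ˢ Finset.range N) atTop atTop := by
    refine tendsto_atTop_finset_of_monotone (fun a b hab => ?_) fun i => ?_
    · exact Finset.product_subset_product (Finset.range_mono hab) (Finset.range_mono hab)
    · refine ⟨max i.1 i.2 + 1, ?_⟩
      simp only [Finset.mem_product, Finset.mem_range]
      omega
  have h2 : Tendsto (fun s : Finset (ℕ × ℕ) => ∑ i ∈ s,
      mode β i.1 f * coeff β P i.1 i.2 * eigenfunction β i.2 1) atTop (𝓝 (kernelOp P f 1)) := hS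
  refine (h2.comp ht).congr fun N => ?_
  simp only [Function.comp_apply, Finset.sum_product, truncatedTrace]

theorem continuous_quadForm (P : C(Rod × Rod, ℝ)) : Continuous (quadForm P) := by
  have : quadForm P = fun f => inner ℝ (toL2 (kernelOp P f)) f :=
    funext (quadForm_eq_inner P)
  rw [this]
  exact Continuous.inner (𝕜 := ℝ) (E := L2) (toL2.continuous.comp (kernelOp P).continuous)
    continuous_id

/-- Along a trajectory `d/dt ∬ P z z = β² R⁻¹ κ² - ∬ Q z z + 2 β u κ`, where `κ = ∫ P(1,x) z dx`, in
integrated form: the identity passes to the limit from the eigenfunction truncations of `z`. -/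
theorem IsModalRiccatiSolution.quadForm_sub_quadForm (hβ : 0 < β)
    (hP : ∀ x y, P (x, y) = P (y, x)) (h : IsModalRiccatiSolution β R Q P) {z0 : L2}
    {u : ℝ → ℝ} {z : ℝ → L2} {Z : ℝ → C(Rod, ℝ)} (tr : IsTrajectory β z0 u z Z) {t : ℝ}
    (ht : 0 ≤ t) :
    quadForm P (z t) - quadForm P z0 = ∫ s in (0 : ℝ)..t, (β ^ 2 * R⁻¹ * kernelOp P (z s) 1 ^ 2
      - Q (Z s) (Z s) + 2 * β * u s * kernelOp P (z s) 1) := by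
  have dyn := tr.hasModalDynamics hβ
  obtain ⟨CQ, hCQ0, hCQ⟩ := exists_form_bound Q
  obtain ⟨D, hD0, hD⟩ := h.exists_truncatedTrace_bound hβ hP
  obtain ⟨hW, iW⟩ := dyn.ae_summable_energy hβ ht
  set x : ℝ → ℕ → ℝ := fun s n => mode β n (z s) with hx
  set W : ℝ → ℝ := fun s => ∑' n, |eigenvalue β n| * mode β n (z s) ^ 2 with hWdef
  set Λ := ∑' n, |eigenvalue β n|⁻¹ with hΛ
  set F : ℕ → ℝ → ℝ := fun N s =>
    β ^ 2 * R⁻¹ * kernelOp P (toL2 (truncation β (x s) N)) 1 ^ 2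
      - Q (truncation β (x s) N) (truncation β (x s) N)
      + 2 * β * u s * truncatedTrace β P (x s) N with hF
  have hcont : ∀ n, ContinuousOn (fun s => x s n) (uIcc 0 t) := fun n =>
    (dyn.continuousOn_mode n).mono (by rw [uIcc_of_le ht]; exact Icc_subset_Ici_self)
  have iu := integrable_control tr.control le_rfl ht
  have iu2 := integrable_control_sq tr.control le_rfl ht
  have ir : ∀ n, IntervalIntegrable
      (fun s => eigenvalue β n * x s n + β * eigenfunction β n 1 * u s) volume 0 t :=
    fun n => dyn.intervalIntegrable_rhs n le_rfl ht
  have ipair : ∀ m n, IntervalIntegrable (fun s => coeff β P m n *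
      ((eigenvalue β m * x s m + β * eigenfunction β m 1 * u s) * x s n +
        x s m * (eigenvalue β n * x s n + β * eigenfunction β n 1 * u s))) volume 0 t :=
    fun m n => (((ir m).mul_continuousOn (hcont n)).add
      ((ir n).continuousOn_mul (hcont m))).const_mul _
  -- for the truncations the identity is the product rule for the finitely many coordinates
  have trunc : ∀ N, quadForm P (toL2 (truncation β (x t) N)) -
      quadForm P (toL2 (truncation β (x 0) N)) = ∫ s in (0 : ℝ)..t, F N s := by
    intro N
    simp only [hF, ← h.truncated_derivative hP]
    rw [intervalIntegral.integral_finsetSum fun m _ =>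
      intervalIntegrable_finsetSum _ fun n _ => ipair m n]
    rw [quadForm_truncation, quadForm_truncation, ← Finset.sum_sub_distrib]
    refine Finset.sum_congr rfl fun m _ => ?_
    rw [intervalIntegral.integral_finsetSum fun n _ => ipair m n, ← Finset.sum_sub_distrib]
    refine Finset.sum_congr rfl fun n _ => ?_
    rw [intervalIntegral.integral_const_mul, ← mul_sub]
    congr 1
    exact mul_sub_mul_eq_integral ht (ir m) (ir n) (fun r hr => dyn.modal m r hr.1)
      (fun r hr => dyn.modal n r hr.1)
  have lim1 : ∀ s, Tendsto (fun N => quadForm P (toL2 (truncation β (x s) N))) atTop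
      (𝓝 (quadForm P (z s))) := by
    intro s
    refine ((continuous_quadForm P).tendsto _).comp ?_
    have := (hasSum_mode_smul hβ (z s)).tendsto_sum_nat
    simpa only [truncation, map_sum, map_smul] using! this
  have hrep : ∀ᵐ s ∂(volume.restrict (Ioc 0 t)), toL2 (Z s) = z s :=
    ae_restrict_of_ae_restrict_of_subset Ioc_subset_Ioi_self tr.representative
  have hmeasF : ∀ N, AEStronglyMeasurable (F N) (volume.restrict (uIoc 0 t)) := fun N => by
    have : IntervalIntegrable (F N) volume 0 t := by
      simp only [hF, ← h.truncated_derivative hP]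
      exact intervalIntegrable_finsetSum _ fun m _ =>
        intervalIntegrable_finsetSum _ fun n _ => ipair m n
    exact this.aestronglyMeasurable_restrict_uIoc
  -- all the integrands are dominated by the squared energy norm `W` of the state and by `u²`
  have lim2 : Tendsto (fun N => ∫ s in (0 : ℝ)..t, F N s) atTop
      (𝓝 (∫ s in (0 : ℝ)..t, (β ^ 2 * R⁻¹ * kernelOp P (z s) 1 ^ 2
        - Q (Z s) (Z s) + 2 * β * u s * kernelOp P (z s) 1))) := by
    have iW' : IntervalIntegrable W volume 0 t := by
      rwa [intervalIntegrable_iff_integrableOn_Ioc_of_le ht]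
    refine intervalIntegral.tendsto_integral_filter_of_dominated_convergence
      (fun s => (|β ^ 2 * R⁻¹| * (4 * ‖kernelOp P‖ ^ 2) + 4 * CQ + (β * D) ^ 2) * Λ * W s
        + u s ^ 2) (Eventually.of_forall hmeasF) (Eventually.of_forall fun N => ?_)
      ((iW'.const_mul _).add iu2) ?_
    · rw [← ae_restrict_iff' measurableSet_uIoc, uIoc_of_le ht]
      filter_upwards [hW] with s hs
      have hq := sum_abs_sq_le hβ hs (Finset.range N)
      have hn := norm_truncation_le hβ (x s) N
      have hd := hD (x s) N
      set q := ∑ n ∈ Finset.range N, |x s n| with hqdef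
      have hq0 : 0 ≤ q := Finset.sum_nonneg fun n _ => abs_nonneg _
      set S := truncation β (x s) N with hS
      have hk : |kernelOp P (toL2 S) 1| ≤ ‖kernelOp P‖ * (2 * q) :=
        ((kernelOp P (toL2 S)).norm_coe_le_norm 1).trans (((kernelOp P).le_opNorm _).trans
          (mul_le_mul_of_nonneg_left ((norm_toL2_le S).trans hn) (norm_nonneg _)))
      have t1 : |β ^ 2 * R⁻¹ * kernelOp P (toL2 S) 1 ^ 2| ≤
          |β ^ 2 * R⁻¹| * (4 * ‖kernelOp P‖ ^ 2) * q ^ 2 := by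
        rw [abs_mul, abs_pow, mul_assoc]
        refine mul_le_mul_of_nonneg_left ?_ (abs_nonneg _)
        refine (pow_le_pow_left₀ (abs_nonneg _) hk 2).trans (le_of_eq ?_)
        ring
      have t2 : |Q S S| ≤ 4 * CQ * q ^ 2 := by
        refine (hCQ S S).trans ?_
        calc CQ * ‖S‖ * ‖S‖ ≤ CQ * (2 * q) * (2 * q) := by gcongr
          _ = _ := by ring
      have t3 : |2 * β * u s * truncatedTrace β P (x s) N| ≤ u s ^ 2 + (β * D) ^ 2 * q ^ 2 := by
        rw [abs_mul, abs_mul, abs_of_pos (by positivity : 0 < 2 * β)]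
        have h1 : 2 * β * |u s| * |truncatedTrace β P (x s) N| ≤ 2 * β * |u s| * (q * D) := by
          gcongr
        have h2 := two_mul_le_add_sq |u s| (β * D * q)
        rw [sq_abs] at h2
        nlinarith
      have t4 : ‖F N s‖ ≤ |β ^ 2 * R⁻¹ * kernelOp P (toL2 S) 1 ^ 2| + |Q S S| +
          |2 * β * u s * truncatedTrace β P (x s) N| :=
        (norm_add_le _ _).trans (add_le_add_left (norm_sub_le _ _) _)
      refine t4.trans ?_
      have hA : 0 ≤ |β ^ 2 * R⁻¹| * (4 * ‖kernelOp P‖ ^ 2) + 4 * CQ + (β * D) ^ 2 := by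
        positivity
      have t5 := mul_le_mul_of_nonneg_left hq hA
      simp only [← hΛ] at t5
      change _ * q ^ 2 ≤ _ * (Λ * W s) at t5
      rw [mul_assoc _ Λ]
      linarith
    · rw [← ae_restrict_iff' measurableSet_uIoc, uIoc_of_le ht]
      filter_upwards [hW, hrep] with s hs hr
      have hs1 : Summable fun n => |mode β n (z s)| := summable_abs_of_energy hβ hs
      have hZ : Tendsto (truncation β (x s)) atTop (𝓝 (Z s)) := by
        have h1 : Summable fun n => |mode β n (toL2 (Z s))| := by rwa [hr]
        have h2 := (hasSum_eigenfunction hβ h1).tendsto_sum_nat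
        rw [hr] at h2
        exact h2
      have hk : Tendsto (fun N => kernelOp P (toL2 (truncation β (x s) N)) 1) atTop
          (𝓝 (kernelOp P (z s) 1)) := by
        have hc : Continuous fun f : C(Rod, ℝ) => kernelOp P (toL2 f) 1 :=
          (ContinuousMap.evalCLM ℝ (1 : Rod)).continuous.comp
            ((kernelOp P).continuous.comp toL2.continuous)
        rw [← hr]
        exact (hc.tendsto _).comp hZ
      have hQc : Continuous fun f : C(Rod, ℝ) => Q f f := by fun_prop
      exact (((hk.pow 2).const_mul _).sub ((hQc.tendsto _).comp hZ)).add
        ((h.tendsto_truncatedTrace hβ hP hs1).const_mul _)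
  have lim3 := (lim1 t).sub (lim1 0)
  rw [tr.initial] at lim3
  refine tendsto_nhds_unique lim3 ?_
  simp only [trunc]
  exact lim2

theorem feedback_gain (hP : ∀ x y, P (x, y) = P (y, x)) (z : ℝ → L2) (t : ℝ) :
    feedback (gain β R P) z t = -β * R⁻¹ * kernelOp P (z t) 1 := by
  rw [feedback, kernelOp_apply_eq_integral, ← integral_const_mul]
  refine integral_congr_ae (Eventually.of_forall fun x => ?_)
  simp only [gain, hP x 1, mul_assoc]

theorem IsTrajectory.integrable_form {z0 : L2} {u : ℝ → ℝ} {z : ℝ → L2} {Z : ℝ → C(Rod, ℝ)}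
    (tr : IsTrajectory β z0 u z Z) (Q : C(Rod, ℝ) →L[ℝ] C(Rod, ℝ) →L[ℝ] ℝ) {t : ℝ}
    (ht : 0 ≤ t) : IntervalIntegrable (fun s => Q (Z s) (Z s)) volume 0 t := by
  obtain ⟨C, hC0, hC⟩ := exists_form_bound Q
  rw [intervalIntegrable_iff_integrableOn_Ioc_of_le ht]
  have hQc : Continuous fun f : C(Rod, ℝ) => Q f f := by fun_prop
  refine Integrable.mono' (((tr.memLp t).integrable_norm_pow two_ne_zero).const_mul C)
    (hQc.comp_aestronglyMeasurable (tr.memLp t).1) (Eventually.of_forall fun s => ?_)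
  rw [sq, ← mul_assoc]
  exact hC _ _

/-- Completion of squares: the cost up to time `t` is
`∬ P z⁰ z⁰ - ∬ P z(t) z(t) + ∫₀ᵗ R (u - ∫ K z)²`. -/
theorem IsModalRiccatiSolution.integral_cost (hβ : 0 < β) (hR : 0 < R)
    (hP : ∀ x y, P (x, y) = P (y, x)) (h : IsModalRiccatiSolution β R Q P) {z0 : L2}
    {u : ℝ → ℝ} {z : ℝ → L2} {Z : ℝ → C(Rod, ℝ)} (tr : IsTrajectory β z0 u z Z) {t : ℝ}
    (ht : 0 ≤ t) :
    ∫ s in (0 : ℝ)..t, (Q (Z s) (Z s) + R * u s ^ 2) = quadForm P z0 - quadForm P (z t) +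
      ∫ s in (0 : ℝ)..t, R * (u s - feedback (gain β R P) z s) ^ 2 := by
  have iQ := tr.integrable_form Q ht
  have iu := integrable_control tr.control le_rfl ht
  have iu2 := integrable_control_sq tr.control le_rfl ht
  have hk : ContinuousOn (fun s => kernelOp P (z s) 1) (uIcc 0 t) := by
    have hc : Continuous fun f : L2 => kernelOp P f 1 :=
      (ContinuousMap.evalCLM ℝ (1 : Rod)).continuous.comp (kernelOp P).continuous
    exact hc.comp_continuousOn (tr.continuousOn.mono (by
      rw [uIcc_of_le ht]; exact Icc_subset_Ici_self))
  have i1 : IntervalIntegrable (fun s => Q (Z s) (Z s) + R * u s ^ 2) volume 0 t :=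
    iQ.add (iu2.const_mul R)
  have i2 : IntervalIntegrable (fun s => β ^ 2 * R⁻¹ * kernelOp P (z s) 1 ^ 2
      - Q (Z s) (Z s) + 2 * β * u s * kernelOp P (z s) 1) volume 0 t :=
    (((hk.pow 2).intervalIntegrable.const_mul _).sub iQ).add
      ((iu.const_mul (2 * β)).mul_continuousOn hk)
  have key := h.quadForm_sub_quadForm hβ hP tr ht
  have e : ∀ s, R * (u s - feedback (gain β R P) z s) ^ 2 = (Q (Z s) (Z s) + R * u s ^ 2) +
      (β ^ 2 * R⁻¹ * kernelOp P (z s) 1 ^ 2 - Q (Z s) (Z s)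
        + 2 * β * u s * kernelOp P (z s) 1) := fun s => by
    rw [feedback_gain hP]
    field_simp
    ring
  simp only [e]
  rw [intervalIntegral.integral_add i1 i2, ← key]
  ring

end CostIdentity

/-! ### Existence of trajectories -/

section Existence

variable {β : ℝ}

/-- The Riesz–Fischer theorem for the basis of eigenfunctions. -/
theorem exists_of_summable_sq (hβ : 0 < β) {x : ℕ → ℝ} (hx : Summable fun n => x n ^ 2) :
    ∃ f : L2, ∀ n, mode β n f = x n := by
  have hm : Memℓp x 2 := memℓp_gen (by simpa using hx)
  refine ⟨(eigenbasis hβ).repr.symm ⟨x, hm⟩, fun n => ?_⟩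
  rw [← repr_eigenbasis hβ, LinearIsometryEquiv.apply_symm_apply]

/-- Modal dynamics give a trajectory of the heat equation: the eigenfunction expansion of `z(t)`
converges uniformly for almost every `t`, and the weak equation for a test function `θ` is the sum
of the modal equations with weights `∫ φ_n θ`. -/
theorem HasModalDynamics.exists_isTrajectory (hβ : 0 < β) {u : ℝ → ℝ} {z : ℝ → L2}
    (h : HasModalDynamics β u z) : ∃ Z, IsTrajectory β (z 0) u z Z := by
  set Z : ℝ → C(Rod, ℝ) := fun t => ∑' n, mode β n (z t) • eigenfunction β n with hZ
  have hrepT : ∀ T : ℝ, 0 ≤ T → ∀ᵐ t ∂(volume.restrict (Ioc 0 T)), toL2 (Z t) = z t := by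
    intro T hT
    filter_upwards [(h.ae_summable_energy hβ hT).1] with s hs
    exact toL2_tsum_mode hβ (summable_abs_of_energy hβ hs)
  have hmemT : ∀ T : ℝ, 0 ≤ T → MemLp Z 2 (volume.restrict (Ioc 0 T)) := by
    intro T hT
    obtain ⟨hW, iW⟩ := h.ae_summable_energy hβ hT
    have hmeas : AEStronglyMeasurable Z (volume.restrict (Ioc 0 T)) := by
      refine aestronglyMeasurable_of_tendsto_ae atTop
        (f := fun N t => truncation β (fun n => mode β n (z t)) N) (fun N => ?_) ?_
      · have hc : ContinuousOn (fun t => truncation β (fun n => mode β n (z t)) N) (Ioc 0 T) := by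
          refine continuousOn_finsetSum _ fun n _ => ?_
          have h1 : ContinuousOn (fun t => mode β n (z t)) (Ioc 0 T) :=
            (h.continuousOn_mode n).mono fun r hr => hr.1.le
          exact h1.smul continuousOn_const
        exact hc.aestronglyMeasurable measurableSet_Ioc
      · filter_upwards [hW] with s hs
        exact (summable_mode_smul_eigenfunction hβ
          (summable_abs_of_energy hβ hs)).hasSum.tendsto_sum_nat
    refine (memLp_two_iff_integrable_sq_norm hmeas).mpr ?_
    refine Integrable.mono' (iW.const_mul (4 * ∑' n, |eigenvalue β n|⁻¹)) (hmeas.norm.pow 2) ?_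
    filter_upwards [hW] with s hs
    have h1 := (summable_mode_smul_eigenfunction hβ
      (summable_abs_of_energy hβ hs)).hasSum.tendsto_sum_nat
    rw [Real.norm_of_nonneg (sq_nonneg _)]
    refine le_of_tendsto ((h1.norm).pow 2) (Eventually.of_forall fun N => ?_)
    refine (pow_le_pow_left₀ (norm_nonneg _)
      (norm_truncation_le hβ (fun n => mode β n (z s)) N) 2).trans ?_
    rw [mul_pow, mul_assoc]
    have := sum_abs_sq_le hβ hs (Finset.range N)
    linarith
  refine ⟨Z, h.control, h.continuousOn, rfl, ?_, fun T => ?_, fun θ hθ t ht => ?_⟩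
  · have h1 : ∀ n : ℕ, ∀ᵐ t ∂(volume.restrict (Ioc (0 : ℝ) n)), toL2 (Z t) = z t := fun n =>
      hrepT n (Nat.cast_nonneg n)
    have h2 := (ae_restrict_iUnion_iff (fun n : ℕ => Ioc (0 : ℝ) n) _).mpr h1
    refine ae_restrict_of_ae_restrict_of_subset ?_ h2
    intro t ht
    obtain ⟨n, hn⟩ := exists_nat_ge t
    exact mem_iUnion.mpr ⟨n, ht, hn⟩
  · rcases le_or_gt 0 T with hT | hT
    · exact hmemT T hT
    · rw [Ioc_eq_empty (not_lt.mpr hT.le), Measure.restrict_empty]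
      exact memLp_measure_zero
  · rw [← inner_onRod hθ.continuous, ← inner_onRod hθ.continuous]
    simp only [robinForm_add_control β hθ]
    set Θ := onRod θ hθ.continuous with hΘ
    set a : ℕ → ℝ := fun n => mode β n (toL2 Θ) with ha
    set F : ℕ → ℝ → ℝ := fun n s =>
      a n * (eigenvalue β n * mode β n (z s) + β * eigenfunction β n 1 * u s) with hF
    have sa : Summable fun n => |a n| := summable_mode_onRod hβ hθ
    have hΘsum : HasSum (fun n => a n * eigenfunction β n 1) (θ 1) := by
      have h1 := (hasSum_eigenfunction hβ sa).mapL (ContinuousMap.evalCLM ℝ (1 : Rod))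
      simpa only [map_smul, smul_eq_mul, ContinuousMap.evalCLM_apply] using! h1
    have iF : ∀ n, IntegrableOn (F n) (Ioc 0 t) := fun n => by
      have := (h.intervalIntegrable_rhs n le_rfl ht).const_mul (a n)
      rwa [intervalIntegrable_iff_integrableOn_Ioc_of_le ht] at this
    have hleft : HasSum (fun n => ∫ s in Ioc 0 t, F n s)
        (inner ℝ (toL2 Θ) (z t) - inner ℝ (toL2 Θ) (z 0)) := by
      refine ((hasSum_mode_mul_mode hβ (toL2 Θ) (z t)).sub
        (hasSum_mode_mul_mode hβ (toL2 Θ) (z 0))).congr_fun fun n => ?_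
      rw [← intervalIntegral.integral_of_le ht, intervalIntegral.integral_const_mul,
        h.modal n t ht]
      ring
    have iu : IntegrableOn u (Ioc 0 t) := (h.control t).integrable (by norm_num)
    have hnorm : Summable fun n => ∫ s in Ioc 0 t, ‖F n s‖ := by
      set B := ‖robinForm β θ hθ‖ * 2 with hB
      have hB0 : 0 ≤ B := by positivity
      have hs1 := (summable_inv_abs_eigenvalue hβ).mul_right t
      have hs2 := h.summable_mul_integral_sq hβ ht
      have hs3 := sa.mul_right (2 * β * ∫ s in Ioc 0 t, |u s|)
      refine (((hs1.add hs2).mul_left B).add hs3).of_nonneg_of_le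
        (fun n => integral_nonneg fun s => norm_nonneg _) fun n => ?_
      have ix : IntegrableOn (fun s => mode β n (z s) ^ 2) (Ioc 0 t) := by
        have hc : ContinuousOn (fun s => mode β n (z s) ^ 2) (uIcc 0 t) :=
          ((h.continuousOn_mode n).mono (by
            rw [uIcc_of_le ht]; exact Icc_subset_Ici_self)).pow 2
        have := hc.intervalIntegrable (μ := volume)
        rwa [intervalIntegrable_iff_integrableOn_Ioc_of_le ht] at this
      have i1 : IntegrableOn (fun s => B * (|eigenvalue β n|⁻¹ + |eigenvalue β n| *
          mode β n (z s) ^ 2)) (Ioc 0 t) :=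
        ((integrable_const _).add (ix.const_mul _)).const_mul _
      have i2 : IntegrableOn (fun s => |a n| * (2 * β * |u s|)) (Ioc 0 t) :=
        (iu.abs.const_mul _).const_mul _
      have hle : ∫ s in Ioc 0 t, ‖F n s‖ ≤ ∫ s in Ioc 0 t, (B * (|eigenvalue β n|⁻¹ +
          |eigenvalue β n| * mode β n (z s) ^ 2) + |a n| * (2 * β * |u s|)) := by
        refine integral_mono (iF n).norm (i1.add i2) fun s => ?_
        have hl := abs_eigenvalue_pos hβ n
        have hb : |eigenvalue β n| * |a n| ≤ B := abs_eigenvalue_mul_mode_le hβ hθ n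
        have hφ := abs_eigenfunction_le hβ n 1
        -- `|x| ≤ 1/|λ| + |λ| x²`
        -- `λ_n a_n` is only bounded, but `|z_n| ≤ |λ_n|⁻¹ + |λ_n| z_n²` has a summable integral
        have hx : |mode β n (z s)| ≤
            |eigenvalue β n|⁻¹ + |eigenvalue β n| * mode β n (z s) ^ 2 := by
          have h1 : |eigenvalue β n|⁻¹ + |eigenvalue β n| * mode β n (z s) ^ 2 -
              2 * |mode β n (z s)| =
              |eigenvalue β n|⁻¹ * (1 - |eigenvalue β n| * |mode β n (z s)|) ^ 2 := by
            rw [← sq_abs (mode β n (z s))]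
            field_simp
            ring
          have h2 : 0 ≤ |eigenvalue β n|⁻¹ * (1 - |eigenvalue β n| * |mode β n (z s)|) ^ 2 := by
            positivity
          linarith [abs_nonneg (mode β n (z s))]
        simp only [hF]
        rw [Real.norm_eq_abs, abs_mul]
        calc |a n| * |eigenvalue β n * mode β n (z s) + β * eigenfunction β n 1 * u s| ≤
              |a n| * (|eigenvalue β n| * |mode β n (z s)| + β * 2 * |u s|) := by
              refine mul_le_mul_of_nonneg_left ((abs_add_le _ _).trans ?_) (abs_nonneg _)
              rw [abs_mul, abs_mul, abs_mul, abs_of_pos hβ]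
              gcongr
          _ = (|eigenvalue β n| * |a n|) * |mode β n (z s)| + |a n| * (2 * β * |u s|) := by ring
          _ ≤ _ := by gcongr
      refine hle.trans (le_of_eq ?_)
      rw [integral_add i1 i2, integral_const_mul, integral_const_mul, integral_const_mul,
        integral_add (integrable_const _) (ix.const_mul _), integral_const_mul,
        ← intervalIntegral.integral_of_le ht, intervalIntegral.integral_const,
        intervalIntegral.integral_of_le ht]
      simp only [sub_zero, smul_eq_mul]
      ring
    have hright := hasSum_integral_of_summable_integral_norm iF hnorm
    rw [hleft.unique hright, intervalIntegral.integral_of_le ht]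
    refine integral_congr_ae ?_
    filter_upwards [(h.ae_summable_energy hβ ht).1, hrepT t ht] with s hs hr
    have s1 : HasSum (fun n => a n * (eigenvalue β n * mode β n (z s)))
        (robinForm β θ hθ (Z s)) := by
      have h1 := (summable_mode_smul_eigenfunction hβ
        (summable_abs_of_energy hβ hs)).hasSum.mapL (robinForm β θ hθ)
      refine h1.congr_fun fun n => ?_
      rw [map_smul, robinForm_eigenfunction hβ hθ, smul_eq_mul]
      simp only [ha, mode, hΘ]
      ring
    have s2 := (hΘsum.mul_left β).mul_right (u s)
    refine ((s1.add s2).congr_fun fun n => ?_).tsum_eq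
    simp only [hF]
    ring

/-- The solution of `x' = l x + b u`, `x(0) = x0`, by variation of constants. -/
def scalarFlow (l b x0 : ℝ) (u : ℝ → ℝ) (t : ℝ) : ℝ :=
  Real.exp (l * t) * (x0 + b * ∫ s in (0 : ℝ)..t, Real.exp (-(l * s)) * u s)

theorem hasDerivAt_scalarFlow (l b x0 : ℝ) {u : ℝ → ℝ} (hu : Continuous u) (t : ℝ) :
    HasDerivAt (scalarFlow l b x0 u) (l * scalarFlow l b x0 u t + b * u t) t := by
  have hc : Continuous fun s => Real.exp (-(l * s)) * u s := by fun_prop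
  have h1 : HasDerivAt (fun t => ∫ s in (0 : ℝ)..t, Real.exp (-(l * s)) * u s)
      (Real.exp (-(l * t)) * u t) t :=
    intervalIntegral.integral_hasDerivAt_right (hc.intervalIntegrable _ _)
      (hc.stronglyMeasurableAtFilter _ _) hc.continuousAt
  have h2 := ((hasDerivAt_id t).const_mul l).exp
  have h3 := h2.mul ((h1.const_mul b).const_add x0)
  refine h3.congr_deriv ?_
  have h4 : Real.exp (l * t) * Real.exp (-(l * t)) = 1 := by
    rw [← Real.exp_add, add_neg_cancel, Real.exp_zero]
  simp only [scalarFlow, id, mul_one]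
  linear_combination b * u t * h4

/-- Existence for a continuous control. The modal equations are solved one by one; the energy
inequality bounds the squares of the solutions by a summable sequence, locally uniformly in time.
-/
theorem exists_hasModalDynamics (hβ : 0 < β) (z0 : L2) {u : ℝ → ℝ} (hu : Continuous u) :
    ∃ z : ℝ → L2, z 0 = z0 ∧ HasModalDynamics β u z := by
  set x : ℕ → ℝ → ℝ := fun n =>
    scalarFlow (eigenvalue β n) (β * eigenfunction β n 1) (mode β n z0) u with hx
  have dx : ∀ n t, HasDerivAt (x n) (eigenvalue β n * x n t + β * eigenfunction β n 1 * u t) t :=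
    fun n t => hasDerivAt_scalarFlow _ _ _ hu t
  have cx : ∀ n, Continuous (x n) := fun n =>
    continuous_iff_continuousAt.mpr fun t => (dx n t).continuousAt
  have x0 : ∀ n, x n 0 = mode β n z0 := fun n => by simp [hx, scalarFlow]
  have hint : ∀ n t, x n t = x n 0 +
      ∫ s in (0 : ℝ)..t, (eigenvalue β n * x n s + β * eigenfunction β n 1 * u s) := fun n t => by
    have hc : Continuous fun s => eigenvalue β n * x n s + β * eigenfunction β n 1 * u s :=
      ((cx n).const_mul _).add (hu.const_mul _)
    rw [intervalIntegral.integral_eq_sub_of_hasDerivAt (fun s _ => dx n s)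
      (hc.intervalIntegrable _ _)]
    ring
  have hle : ∀ n t T, 0 ≤ t → t ≤ T → x n t ^ 2 ≤ mode β n z0 ^ 2 +
      |eigenvalue β n|⁻¹ * (4 * β ^ 2) * ∫ s in (0 : ℝ)..T, u s ^ 2 := by
    intro n t T ht htT
    have h1 := sq_add_integral_sq_le (B := 4 * β ^ 2) (eigenvalue_neg hβ n) ht (by
      have h1 := abs_eigenfunction_le hβ n 1
      have h2 : eigenfunction β n 1 ^ 2 ≤ 2 ^ 2 := sq_le_sq' (abs_le.mp h1).1 (abs_le.mp h1).2
      rw [mul_pow]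
      nlinarith [sq_nonneg β]) (cx n).continuousOn (hu.intervalIntegrable _ _)
      ((hu.pow 2).intervalIntegrable _ _) (fun r _ => hint n r)
    have h2 : 0 ≤ |eigenvalue β n| * ∫ r in (0 : ℝ)..t, x n r ^ 2 :=
      mul_nonneg (abs_nonneg _) (intervalIntegral.integral_nonneg ht fun r _ => sq_nonneg _)
    have h3 : ∫ s in (0 : ℝ)..t, u s ^ 2 ≤ ∫ s in (0 : ℝ)..T, u s ^ 2 :=
      intervalIntegral.integral_mono_interval le_rfl ht htT
        (Eventually.of_forall fun s => sq_nonneg _) ((hu.pow 2).intervalIntegrable _ _)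
    have h4 : |eigenvalue β n|⁻¹ * (4 * β ^ 2) * ∫ s in (0 : ℝ)..t, u s ^ 2 ≤
        |eigenvalue β n|⁻¹ * (4 * β ^ 2) * ∫ s in (0 : ℝ)..T, u s ^ 2 := by gcongr
    rw [x0] at h1
    linarith
  have hsum : ∀ T, Summable fun n => mode β n z0 ^ 2 +
      |eigenvalue β n|⁻¹ * (4 * β ^ 2) * ∫ s in (0 : ℝ)..T, u s ^ 2 := fun T =>
    (HasModalDynamics.hasSum_energy_bound hβ z0 _).summable
  -- for negative times, where nothing is required, the state is frozen
  have hex : ∀ t, ∃ f : L2, ∀ n, mode β n f = x n (max t 0) := fun t =>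
    exists_of_summable_sq hβ ((hsum (max t 0)).of_nonneg_of_le (fun n => sq_nonneg _)
      fun n => hle n _ _ (le_max_right _ _) le_rfl)
  choose z hz using hex
  have hz' : ∀ t, 0 ≤ t → ∀ n, mode β n (z t) = x n t := fun t ht n => by
    rw [hz, max_eq_left ht]
  refine ⟨z, ?_, ⟨fun T => ?_, ?_, fun n t ht => ?_⟩⟩
  · have h1 : ∀ n, mode β n (z 0) = mode β n z0 := fun n => by rw [hz' 0 le_rfl, x0]
    have h2 := hasSum_mode_smul hβ (z 0)
    simp only [h1] at h2
    exact h2.unique (hasSum_mode_smul hβ z0)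
  · exact (memLp_two_iff_integrable_sq hu.aestronglyMeasurable).mpr
      ((hu.pow 2).integrableOn_Ioc (a := 0) (b := T))
  · intro t ht
    have ht0 : 0 ≤ t := ht
    rw [ContinuousWithinAt, tendsto_iff_norm_sub_tendsto_zero]
    have hn : ∀ s, ‖z s - z t‖ ^ 2 = ∑' n, (mode β n (z s) - mode β n (z t)) ^ 2 := fun s => by
      rw [← (hasSum_mode_sq hβ (z s - z t)).tsum_eq]
      simp only [mode_sub]
    have hlim : Tendsto (fun s => ∑' n, (mode β n (z s) - mode β n (z t)) ^ 2) (𝓝[Ici 0] t)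
        (𝓝 (∑' _ : ℕ, (0 : ℝ))) := by
      refine tendsto_tsum_of_dominated_convergence ((hsum (t + 1)).mul_left 4) (fun n => ?_) ?_
      · have h1 : Tendsto (fun s => (x n s - x n t) ^ 2) (𝓝[Ici 0] t) (𝓝 ((x n t - x n t) ^ 2)) :=
          ((((cx n).tendsto t).mono_left nhdsWithin_le_nhds).sub_const _).pow 2
        rw [sub_self, zero_pow two_ne_zero] at h1
        refine h1.congr' ?_
        filter_upwards [self_mem_nhdsWithin] with s hs
        rw [hz' s hs, hz' t ht0]
      · have h1 : ∀ᶠ s in 𝓝[Ici 0] t, s < t + 1 :=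
          nhdsWithin_le_nhds (gt_mem_nhds (by linarith))
        filter_upwards [self_mem_nhdsWithin, h1] with s hs hs1 n
        rw [hz' s hs, hz' t ht0, Real.norm_of_nonneg (sq_nonneg _)]
        have h2 := hle n s (t + 1) hs hs1.le
        have h3 := hle n t (t + 1) ht0 (by linarith)
        nlinarith [sq_nonneg (x n s + x n t)]
    rw [tsum_zero] at hlim
    have h2 := hlim.sqrt
    rw [Real.sqrt_zero] at h2
    refine h2.congr fun s => ?_
    rw [← hn, Real.sqrt_sq (norm_nonneg _)]
  · rw [hz' t ht, hz' 0 le_rfl, hint n t]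
    congr 1
    refine intervalIntegral.integral_congr fun s hs => ?_
    rw [uIcc_of_le ht] at hs
    simp only [hz' s hs.1]

theorem HasModalDynamics.congr_control {u u' : ℝ → ℝ} {z : ℝ → L2} (h : HasModalDynamics β u z)
    (hu : u =ᵐ[volume.restrict (Ioi 0)] u') : HasModalDynamics β u' z where
  control T := (memLp_congr_ae (ae_restrict_of_ae_restrict_of_subset Ioc_subset_Ioi_self hu)).mp
    (h.control T)
  continuousOn := h.continuousOn
  modal n t ht := by
    rw [h.modal n t ht]
    congr 1
    refine intervalIntegral.integral_congr_ae ?_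
    filter_upwards [(ae_restrict_iff' measurableSet_Ioi).mp hu] with s hs hst
    rw [uIoc_of_le ht] at hst
    rw [hs hst.1]

/-- Existence for the closed loop `u = k(z)`. In the norm `sup e^{-γt} |u(t)|`, with `γ` large, the
map sending a control `u` to the feedback along the trajectory of `u` is a contraction. -/
theorem exists_hasModalDynamics_feedback (hβ : 0 < β) (k : L2 →L[ℝ] ℝ) (z0 : L2) :
    ∃ z : ℝ → L2, z 0 = z0 ∧ HasModalDynamics β (fun t => k (z t)) z := by
  set E := energyConst β with hE
  have hE0 : 0 ≤ E := energyConst_nonneg β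
  -- large enough for the contraction factor `‖k‖ √(E / (2γ))` to be at most `1/2`
  set γ := 2 * (E * ‖k‖ ^ 2) + 1 with hγ
  have hγ0 : 0 < γ := by positivity
  -- the growth of a state driven by an exponentially bounded control
  have growth : ∀ {u : ℝ → ℝ} {z : ℝ → L2}, HasModalDynamics β u z → ∀ {M : ℝ}, 0 ≤ M →
      (∀ s, 0 ≤ s → |u s| ≤ Real.exp (γ * s) * M) → ∀ t, 0 ≤ t →
      (Real.exp (-(γ * t)) * ‖z t‖) ^ 2 ≤ ‖z 0‖ ^ 2 + E / (2 * γ) * M ^ 2 := by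
    intro u z h M hM hu t ht
    have h1 := h.norm_sq_le hβ le_rfl ht
    have h2 : ∫ s in (0 : ℝ)..t, u s ^ 2 ≤ ∫ s in (0 : ℝ)..t, Real.exp (2 * γ * s) * M ^ 2 := by
      refine intervalIntegral.integral_mono_on ht (integrable_control_sq h.control le_rfl ht)
        (Continuous.intervalIntegrable (by fun_prop) _ _) fun s hs => ?_
      rw [← sq_abs]
      refine (pow_le_pow_left₀ (abs_nonneg _) (hu s hs.1) 2).trans (le_of_eq ?_)
      rw [mul_pow, ← Real.exp_nat_mul]
      congr 2
      push_cast
      ring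
    have h3 : ∫ s in (0 : ℝ)..t, Real.exp (2 * γ * s) * M ^ 2 ≤
        Real.exp (2 * γ * t) * M ^ 2 / (2 * γ) := by
      rw [intervalIntegral.integral_eq_sub_of_hasDerivAt
        (f := fun s => Real.exp (2 * γ * s) * M ^ 2 / (2 * γ)) (fun s _ => ?_)
        (Continuous.intervalIntegrable (by fun_prop) _ _)]
      · have : 0 ≤ Real.exp (2 * γ * 0) * M ^ 2 / (2 * γ) := by positivity
        linarith
      · have h4 := ((((hasDerivAt_id s).const_mul (2 * γ)).exp).mul_const (M ^ 2)).div_const (2 * γ)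
        refine h4.congr_deriv ?_
        simp only [id, mul_one]
        field_simp
    have hexp : Real.exp (-(γ * t)) ^ 2 * Real.exp (2 * γ * t) = 1 := by
      rw [← Real.exp_nat_mul, ← Real.exp_add, Real.exp_eq_one_iff]
      push_cast
      ring
    have hexp1 : Real.exp (-(γ * t)) ^ 2 ≤ 1 := by
      rw [← Real.exp_nat_mul, Real.exp_le_one_iff]
      have : 0 ≤ γ * t := by positivity
      push_cast
      linarith
    have h5 : ‖z t‖ ^ 2 ≤ ‖z 0‖ ^ 2 + E * (Real.exp (2 * γ * t) * M ^ 2 / (2 * γ)) :=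
      h1.trans (add_le_add_right (mul_le_mul_of_nonneg_left (h2.trans h3) hE0) _)
    calc (Real.exp (-(γ * t)) * ‖z t‖) ^ 2 = Real.exp (-(γ * t)) ^ 2 * ‖z t‖ ^ 2 := mul_pow _ _ _
      _ ≤ Real.exp (-(γ * t)) ^ 2 *
          (‖z 0‖ ^ 2 + E * (Real.exp (2 * γ * t) * M ^ 2 / (2 * γ))) := by gcongr
      _ = Real.exp (-(γ * t)) ^ 2 * ‖z 0‖ ^ 2 +
          E / (2 * γ) * M ^ 2 * (Real.exp (-(γ * t)) ^ 2 * Real.exp (2 * γ * t)) := by ring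
      _ ≤ 1 * ‖z 0‖ ^ 2 + E / (2 * γ) * M ^ 2 * 1 := by rw [hexp]; gcongr
      _ = _ := by ring
  -- `v` stands for the control `e^{γt} v(t)`; the map is extended to `t < 0` by a constant
  let ctrl : BoundedContinuousFunction ℝ ℝ → ℝ → ℝ := fun v s => Real.exp (γ * s) * v s
  have hctrl : ∀ v, Continuous (ctrl v) := fun v =>
    (Real.continuous_exp.comp (continuous_const.mul continuous_id)).mul v.continuous
  choose flow flow0 hflow using fun v => exists_hasModalDynamics hβ z0 (hctrl v)
  have hbound : ∀ v t, |Real.exp (-(γ * max t 0)) * k (flow v (max t 0))| ≤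
      ‖k‖ * Real.sqrt (‖z0‖ ^ 2 + E / (2 * γ) * ‖v‖ ^ 2) := by
    intro v t
    have h1 := growth (hflow v) (norm_nonneg v) (fun s _ => by
      rw [abs_mul, abs_of_pos (Real.exp_pos _)]
      exact mul_le_mul_of_nonneg_left (v.norm_coe_le_norm s) (Real.exp_pos _).le) (max t 0)
      (le_max_right _ _)
    rw [flow0] at h1
    rw [abs_mul, abs_of_pos (Real.exp_pos _)]
    calc Real.exp (-(γ * max t 0)) * |k (flow v (max t 0))| ≤
          Real.exp (-(γ * max t 0)) * (‖k‖ * ‖flow v (max t 0)‖) :=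
          mul_le_mul_of_nonneg_left (k.le_opNorm _) (Real.exp_pos _).le
      _ = ‖k‖ * (Real.exp (-(γ * max t 0)) * ‖flow v (max t 0)‖) := by ring
      _ ≤ _ := mul_le_mul_of_nonneg_left (Real.le_sqrt_of_sq_le h1) (norm_nonneg _)
  have hcont : ∀ v, Continuous fun t => Real.exp (-(γ * max t 0)) * k (flow v (max t 0)) := by
    intro v
    refine Continuous.mul (by fun_prop) (k.continuous.comp ?_)
    exact (hflow v).continuousOn.comp_continuous (by fun_prop)
      fun t => mem_Ici.mpr (le_max_right _ _)
  let Φ : BoundedContinuousFunction ℝ ℝ → BoundedContinuousFunction ℝ ℝ := fun v =>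
    BoundedContinuousFunction.ofNormedAddCommGroup _ (hcont v) _ (hbound v)
  have hcontr : ContractingWith (1 / 2) Φ := by
    refine ⟨by
      rw [← NNReal.coe_lt_coe]
      norm_num, LipschitzWith.of_dist_le_mul fun v w => ?_⟩
    rw [BoundedContinuousFunction.dist_le (by positivity)]
    intro t
    have h1 := growth ((hflow v).sub (hflow w)) (dist_nonneg (x := v) (y := w)) (fun s _ => by
      change |Real.exp (γ * s) * v s - Real.exp (γ * s) * w s| ≤ _
      rw [← mul_sub, abs_mul, abs_of_pos (Real.exp_pos _)]
      refine mul_le_mul_of_nonneg_left ?_ (Real.exp_pos _).le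
      rw [← Real.dist_eq]
      exact BoundedContinuousFunction.dist_coe_le_dist s) (max t 0) (le_max_right _ _)
    rw [flow0, flow0, sub_self, norm_zero, zero_pow two_ne_zero, zero_add] at h1
    change |Real.exp (-(γ * max t 0)) * k (flow v (max t 0)) -
      Real.exp (-(γ * max t 0)) * k (flow w (max t 0))| ≤ _
    rw [← mul_sub, ← map_sub, abs_mul, abs_of_pos (Real.exp_pos _)]
    set y := Real.exp (-(γ * max t 0)) * ‖flow v (max t 0) - flow w (max t 0)‖ with hy
    have hy0 : 0 ≤ y := by positivity
    have h2 : Real.exp (-(γ * max t 0)) * |k (flow v (max t 0) - flow w (max t 0))| ≤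
        ‖k‖ * y := by
      refine (mul_le_mul_of_nonneg_left (k.le_opNorm _) (Real.exp_pos _).le).trans (le_of_eq ?_)
      rw [hy]; ring
    refine h2.trans ?_
    have h3 : (‖k‖ * y) ^ 2 ≤ (1 / 2 * dist v w) ^ 2 := by
      have h4 : ‖k‖ ^ 2 * (E / (2 * γ)) ≤ 1 / 4 := by
        rw [← mul_div_assoc, div_le_iff₀ (by positivity), hγ]
        linarith
      calc (‖k‖ * y) ^ 2 = ‖k‖ ^ 2 * y ^ 2 := mul_pow _ _ _
        _ ≤ ‖k‖ ^ 2 * (E / (2 * γ) * dist v w ^ 2) := by gcongr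
        _ = (‖k‖ ^ 2 * (E / (2 * γ))) * dist v w ^ 2 := by ring
        _ ≤ 1 / 4 * dist v w ^ 2 := by gcongr
        _ = _ := by ring
    have h5 := abs_le_of_sq_le_sq h3 (by positivity)
    have h6 := (le_abs_self _).trans h5
    simpa using h6
  set v := ContractingWith.fixedPoint Φ hcontr with hv
  have hfix : Φ v = v := hcontr.fixedPoint_isFixedPt
  refine ⟨flow v, flow0 v, (hflow v).congr_control ?_⟩
  refine (ae_restrict_iff' measurableSet_Ioi).mpr (Eventually.of_forall fun t ht => ?_)
  have h1 : v t = Real.exp (-(γ * max t 0)) * k (flow v (max t 0)) := by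
    conv_lhs => rw [← hfix]
    rfl
  rw [max_eq_left (le_of_lt ht)] at h1
  change Real.exp (γ * t) * v t = _
  rw [h1, ← mul_assoc, ← Real.exp_add, add_neg_cancel, Real.exp_zero, one_mul]

end Existence

/-! ### Optimality of the feedback -/

section Optimality

variable {β R : ℝ} {Q : C(Rod, ℝ) →L[ℝ] C(Rod, ℝ) →L[ℝ] ℝ} {P : C(Rod × Rod, ℝ)}

theorem aestronglyMeasurable_Ioi_of_intervalIntegrable {g : ℝ → ℝ}
    (hg : ∀ t, 0 ≤ t → IntervalIntegrable g volume 0 t) :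
    AEStronglyMeasurable g (volume.restrict (Ioi 0)) := by
  have h1 : ∀ n : ℕ, AEStronglyMeasurable g (volume.restrict (Ioc (0 : ℝ) n)) := fun n =>
    ((intervalIntegrable_iff_integrableOn_Ioc_of_le n.cast_nonneg).mp
      (hg n n.cast_nonneg)).aestronglyMeasurable
  refine (aestronglyMeasurable_iUnion_iff.mpr h1).mono_measure (Measure.restrict_mono ?_ le_rfl)
  intro t ht
  obtain ⟨n, hn⟩ := exists_nat_ge t
  exact mem_iUnion.mpr ⟨n, ht, hn⟩

theorem tendsto_ofReal_integral_Ioi {g : ℝ → ℝ} (hg0 : ∀ t, 0 ≤ g t)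
    (hg : ∀ t, 0 ≤ t → IntervalIntegrable g volume 0 t) :
    Tendsto (fun t => ENNReal.ofReal (∫ s in (0 : ℝ)..t, g s)) atTop
      (𝓝 (∫⁻ s in Ioi (0 : ℝ), ENNReal.ofReal (g s))) := by
  have hcov : AECover (volume.restrict (Ioi (0 : ℝ))) atTop fun t : ℝ => Iic t :=
    aecover_Iic tendsto_id
  refine (hcov.lintegral_tendsto_of_countably_generated
    (aestronglyMeasurable_Ioi_of_intervalIntegrable hg).aemeasurable.ennreal_ofReal).congr' ?_
  filter_upwards [eventually_ge_atTop 0] with t ht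
  rw [Measure.restrict_restrict measurableSet_Iic, inter_comm, Ioi_inter_Iic,
    intervalIntegral.integral_of_le ht, ofReal_integral_eq_lintegral_ofReal
      ((intervalIntegrable_iff_integrableOn_Ioc_of_le ht).mp (hg t ht))
      (Eventually.of_forall hg0)]

/-- The feedback along `z`, as a continuous linear functional of the state. -/
def feedbackCLM (β R : ℝ) (P : C(Rod × Rod, ℝ)) : L2 →L[ℝ] ℝ :=
  (-β * R⁻¹) • (ContinuousMap.evalCLM ℝ (1 : Rod)).comp (kernelOp P)

theorem feedback_gain_eq_feedbackCLM (hP : ∀ x y, P (x, y) = P (y, x)) (z : ℝ → L2) (t : ℝ) :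
    feedback (gain β R P) z t = feedbackCLM β R P (z t) :=
  feedback_gain hP z t

theorem exists_closedLoop (hβ : 0 < β) (hP : ∀ x y, P (x, y) = P (y, x)) (z0 : L2) :
    ∃ z Z, IsTrajectory β z0 (feedback (gain β R P) z) z Z := by
  obtain ⟨z, hz0, hz⟩ := exists_hasModalDynamics_feedback hβ (feedbackCLM β R P) z0
  obtain ⟨Z, tr⟩ := hz.exists_isTrajectory hβ
  refine ⟨z, Z, ?_⟩
  rw [hz0] at tr
  have hk : feedback (gain β R P) z = fun t => feedbackCLM β R P (z t) :=
    funext (feedback_gain_eq_feedbackCLM hP z)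
  rwa [hk]

/-- Uniqueness for the closed loop, also for controls that satisfy the feedback relation only for
almost every `t`. -/
theorem IsTrajectory.eqOn_of_feedback (hβ : 0 < β) (hP : ∀ x y, P (x, y) = P (y, x)) {z0 : L2}
    {u u' : ℝ → ℝ} {z z' : ℝ → L2} {Z Z' : ℝ → C(Rod, ℝ)} (tr : IsTrajectory β z0 u z Z)
    (tr' : IsTrajectory β z0 u' z' Z')
    (hu : u =ᵐ[volume.restrict (Ioi 0)] feedback (gain β R P) z)
    (hu' : u' =ᵐ[volume.restrict (Ioi 0)] feedback (gain β R P) z') : EqOn z z' (Ici 0) := by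
  intro t ht
  have h := ((tr.hasModalDynamics hβ).congr_control hu).sub
    ((tr'.hasModalDynamics hβ).congr_control hu')
  refine sub_eq_zero.mp (h.eq_zero_of_feedback hβ (k := feedbackCLM β R P) (fun s _ => ?_) ?_ ht)
  · simp only [feedback_gain_eq_feedbackCLM hP, map_sub]
  · simp only [tr.initial, tr'.initial, sub_self]

theorem IsTrajectory.integrable_running_cost {z0 : L2} {u : ℝ → ℝ} {z : ℝ → L2}
    {Z : ℝ → C(Rod, ℝ)} (tr : IsTrajectory β z0 u z Z) (Q : C(Rod, ℝ) →L[ℝ] C(Rod, ℝ) →L[ℝ] ℝ)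
    (R : ℝ) {t : ℝ} (ht : 0 ≤ t) :
    IntervalIntegrable (fun s => Q (Z s) (Z s) + R * u s ^ 2) volume 0 t :=
  (tr.integrable_form Q ht).add ((integrable_control_sq tr.control le_rfl ht).const_mul R)

theorem running_cost_nonneg (hR : 0 < R) (hQ : ∀ f, 0 ≤ Q f f) (u : ℝ → ℝ) (Z : ℝ → C(Rod, ℝ))
    (t : ℝ) : 0 ≤ Q (Z t) (Z t) + R * u t ^ 2 :=
  add_nonneg (hQ _) (mul_nonneg hR.le (sq_nonneg _))

theorem IsTrajectory.tendsto_cost (hR : 0 < R) (hQ : ∀ f, 0 ≤ Q f f) {z0 : L2} {u : ℝ → ℝ}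
    {z : ℝ → L2} {Z : ℝ → C(Rod, ℝ)} (tr : IsTrajectory β z0 u z Z) :
    Tendsto (fun t => ENNReal.ofReal (∫ s in (0 : ℝ)..t, (Q (Z s) (Z s) + R * u s ^ 2))) atTop
      (𝓝 (cost Q R u Z)) :=
  tendsto_ofReal_integral_Ioi (running_cost_nonneg hR hQ u Z)
    fun _ ht => tr.integrable_running_cost Q R ht

/-- A control of finite cost is square-integrable, so that the exponentially stable open loop
dynamics take the state to zero. -/
theorem IsTrajectory.tendsto_zero_of_cost_ne_top (hβ : 0 < β) (hR : 0 < R)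
    (hQ : ∀ f, 0 ≤ Q f f) {z0 : L2} {u : ℝ → ℝ} {z : ℝ → L2} {Z : ℝ → C(Rod, ℝ)}
    (tr : IsTrajectory β z0 u z Z) (hc : cost Q R u Z ≠ ⊤) : Tendsto z atTop (𝓝 0) := by
  refine (tr.hasModalDynamics hβ).tendsto_zero hβ ?_
  have hm : AEStronglyMeasurable (fun t => R * u t ^ 2) (volume.restrict (Ioi 0)) :=
    aestronglyMeasurable_Ioi_of_intervalIntegrable fun t ht =>
      (integrable_control_sq tr.control le_rfl ht).const_mul R
  have h1 : ∫⁻ t in Ioi (0 : ℝ), ENNReal.ofReal (R * u t ^ 2) ≠ ⊤ :=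
    ne_top_of_le_ne_top hc (lintegral_mono fun t =>
      ENNReal.ofReal_le_ofReal (le_add_of_nonneg_left (hQ _)))
  have h2 := (lintegral_ofReal_ne_top_iff_integrable hm
    (Eventually.of_forall fun t => mul_nonneg hR.le (sq_nonneg _))).mp h1
  refine (h2.const_mul R⁻¹).congr (Eventually.of_forall fun t => ?_)
  simp only [inv_mul_cancel_left₀ hR.ne']

theorem tendsto_quadForm_zero (P : C(Rod × Rod, ℝ)) {z : ℝ → L2} (hz : Tendsto z atTop (𝓝 0)) :
    Tendsto (fun t => quadForm P (z t)) atTop (𝓝 0) := by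
  have h1 := ((continuous_quadForm P).tendsto 0).comp hz
  have h0 : quadForm P 0 = 0 := by rw [quadForm_eq_inner, inner_zero_right]
  rwa [h0] at h1

theorem IsModalRiccatiSolution.cost_of_feedback (hβ : 0 < β) (hR : 0 < R)
    (hQ : ∀ f, 0 ≤ Q f f) (hP : ∀ x y, P (x, y) = P (y, x)) (h : IsModalRiccatiSolution β R Q P)
    {z0 : L2} {u : ℝ → ℝ} {z : ℝ → L2} {Z : ℝ → C(Rod, ℝ)} (tr : IsTrajectory β z0 u z Z)
    (hu : u =ᵐ[volume.restrict (Ioi 0)] feedback (gain β R P) z)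
    (hz : Tendsto z atTop (𝓝 0)) :
    0 ≤ quadForm P z0 ∧ cost Q R u Z = ENNReal.ofReal (quadForm P z0) := by
  have h1 : ∀ t, 0 ≤ t → ∫ s in (0 : ℝ)..t, (Q (Z s) (Z s) + R * u s ^ 2) =
      quadForm P z0 - quadForm P (z t) := fun t ht => by
    have h2 : ∫ s in (0 : ℝ)..t, R * (u s - feedback (gain β R P) z s) ^ 2 =
        ∫ _ in (0 : ℝ)..t, (0 : ℝ) := by
      refine intervalIntegral.integral_congr_ae ?_
      filter_upwards [(ae_restrict_iff' measurableSet_Ioi).mp hu] with s hs hst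
      rw [uIoc_of_le ht] at hst
      rw [hs hst.1, sub_self, zero_pow two_ne_zero, mul_zero]
    rw [h.integral_cost hβ hR hP tr ht, h2, intervalIntegral.integral_zero, add_zero]
  have h2 : Tendsto (fun t => ∫ s in (0 : ℝ)..t, (Q (Z s) (Z s) + R * u s ^ 2)) atTop
      (𝓝 (quadForm P z0)) := by
    have h3 := (tendsto_quadForm_zero P hz).const_sub (quadForm P z0)
    rw [sub_zero] at h3
    refine h3.congr' ?_
    filter_upwards [eventually_ge_atTop 0] with t ht
    rw [h1 t ht]
  refine ⟨ge_of_tendsto h2 ?_,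
    tendsto_nhds_unique (tr.tendsto_cost hR hQ) (ENNReal.tendsto_ofReal h2)⟩
  filter_upwards [eventually_ge_atTop 0] with t ht
  exact intervalIntegral.integral_nonneg ht fun s _ => running_cost_nonneg hR hQ u Z s

theorem IsTrajectory.integrable_sq_sub_feedback (hP : ∀ x y, P (x, y) = P (y, x)) {z0 : L2}
    {u : ℝ → ℝ} {z : ℝ → L2} {Z : ℝ → C(Rod, ℝ)} (tr : IsTrajectory β z0 u z Z) {t : ℝ}
    (ht : 0 ≤ t) :
    IntervalIntegrable (fun s => R * (u s - feedback (gain β R P) z s) ^ 2) volume 0 t := by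
  have hk : ContinuousOn (fun s => feedbackCLM β R P (z s)) (uIcc 0 t) :=
    (feedbackCLM β R P).continuous.comp_continuousOn (tr.continuousOn.mono (by
      rw [uIcc_of_le ht]; exact Icc_subset_Ici_self))
  have iu := integrable_control tr.control le_rfl ht
  have iu2 := integrable_control_sq tr.control le_rfl ht
  have h1 : IntervalIntegrable (fun s => u s ^ 2 - 2 * (u s * feedbackCLM β R P (z s)) +
      feedbackCLM β R P (z s) ^ 2) volume 0 t :=
    (iu2.sub ((iu.mul_continuousOn hk).const_mul 2)).add (hk.pow 2).intervalIntegrable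
  simp only [feedback_gain_eq_feedbackCLM hP, sub_sq, ← mul_assoc] at h1 ⊢
  exact h1.const_mul R

/-- The excess of a finite cost over `∬ P z⁰ z⁰` is the weighted distance of the control from the
feedback. -/
theorem IsModalRiccatiSolution.cost_of_ne_top (hβ : 0 < β) (hR : 0 < R)
    (hQ : ∀ f, 0 ≤ Q f f) (hP : ∀ x y, P (x, y) = P (y, x)) (h : IsModalRiccatiSolution β R Q P)
    {z0 : L2} (h0 : 0 ≤ quadForm P z0) {u : ℝ → ℝ} {z : ℝ → L2} {Z : ℝ → C(Rod, ℝ)}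
    (tr : IsTrajectory β z0 u z Z) (hc : cost Q R u Z ≠ ⊤) :
    cost Q R u Z = ENNReal.ofReal (quadForm P z0) +
      ∫⁻ t in Ioi (0 : ℝ), ENNReal.ofReal (R * (u t - feedback (gain β R P) z t) ^ 2) := by
  have hz := tr.tendsto_zero_of_cost_ne_top hβ hR hQ hc
  have h1 : Tendsto (fun t => ∫ s in (0 : ℝ)..t, (Q (Z s) (Z s) + R * u s ^ 2)) atTop
      (𝓝 (cost Q R u Z).toReal) := by
    refine ((ENNReal.tendsto_toReal hc).comp (tr.tendsto_cost hR hQ)).congr' ?_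
    filter_upwards [eventually_ge_atTop 0] with t ht
    exact ENNReal.toReal_ofReal (intervalIntegral.integral_nonneg ht
      fun s _ => running_cost_nonneg hR hQ u Z s)
  have h2 := ENNReal.tendsto_ofReal (h1.add (tendsto_quadForm_zero P hz))
  rw [add_zero, ENNReal.ofReal_toReal hc] at h2
  have h3 : ∀ t, 0 ≤ R * (u t - feedback (gain β R P) z t) ^ 2 := fun t =>
    mul_nonneg hR.le (sq_nonneg _)
  refine tendsto_nhds_unique h2 ?_
  refine (tendsto_const_nhds.add (tendsto_ofReal_integral_Ioi h3 fun _ ht =>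
    tr.integrable_sq_sub_feedback hP ht)).congr' ?_
  filter_upwards [eventually_ge_atTop 0] with t ht
  rw [← ENNReal.ofReal_add h0 (intervalIntegral.integral_nonneg ht fun s _ => h3 s),
    h.integral_cost hβ hR hP tr ht]
  congr 1
  ring

theorem IsModalRiccatiSolution.quadForm_le_cost (hβ : 0 < β) (hR : 0 < R)
    (hQ : ∀ f, 0 ≤ Q f f) (hP : ∀ x y, P (x, y) = P (y, x)) (h : IsModalRiccatiSolution β R Q P)
    {z0 : L2} (h0 : 0 ≤ quadForm P z0) {u : ℝ → ℝ} {z : ℝ → L2} {Z : ℝ → C(Rod, ℝ)}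
    (tr : IsTrajectory β z0 u z Z) : ENNReal.ofReal (quadForm P z0) ≤ cost Q R u Z := by
  by_cases hc : cost Q R u Z = ⊤
  · rw [hc]
    exact le_top
  · rw [h.cost_of_ne_top hβ hR hQ hP h0 tr hc]
    exact le_self_add

theorem IsModalRiccatiSolution.ae_eq_feedback_of_cost_eq (hβ : 0 < β) (hR : 0 < R)
    (hQ : ∀ f, 0 ≤ Q f f) (hP : ∀ x y, P (x, y) = P (y, x)) (h : IsModalRiccatiSolution β R Q P)
    {z0 : L2} (h0 : 0 ≤ quadForm P z0) {u : ℝ → ℝ} {z : ℝ → L2} {Z : ℝ → C(Rod, ℝ)}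
    (tr : IsTrajectory β z0 u z Z) (hc : cost Q R u Z = ENNReal.ofReal (quadForm P z0)) :
    u =ᵐ[volume.restrict (Ioi 0)] feedback (gain β R P) z := by
  have h1 := h.cost_of_ne_top hβ hR hQ hP h0 tr (hc ▸ ENNReal.ofReal_ne_top)
  rw [hc] at h1
  have h2 := ENNReal.add_right_inj ENNReal.ofReal_ne_top |>.mp ((add_zero _).trans h1)
  have hm : AEMeasurable (fun t => R * (u t - feedback (gain β R P) z t) ^ 2)
      (volume.restrict (Ioi 0)) := (aestronglyMeasurable_Ioi_of_intervalIntegrable fun _ ht =>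
    tr.integrable_sq_sub_feedback hP ht).aemeasurable
  filter_upwards [(lintegral_eq_zero_iff' hm.ennreal_ofReal).mp h2.symm] with t ht
  have h3 : R * (u t - feedback (gain β R P) z t) ^ 2 = 0 :=
    le_antisymm (ENNReal.ofReal_eq_zero.mp ht) (mul_nonneg hR.le (sq_nonneg _))
  exact sub_eq_zero.mp (pow_eq_zero_iff two_ne_zero |>.mp
    ((mul_eq_zero.mp h3).resolve_left hR.ne'))

/-- For a nonnegative `P` the closed loop has cost at most `∬ P z⁰ z⁰`, hence is stable. -/
theorem IsModalRiccatiSolution.tendsto_zero_of_nonneg (hβ : 0 < β) (hR : 0 < R)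
    (hQ : ∀ f, 0 ≤ Q f f) (hP : ∀ x y, P (x, y) = P (y, x)) (h : IsModalRiccatiSolution β R Q P)
    (hP0 : ∀ f, 0 ≤ quadForm P f) {z0 : L2} {z : ℝ → L2} {Z : ℝ → C(Rod, ℝ)}
    (tr : IsTrajectory β z0 (feedback (gain β R P) z) z Z) : Tendsto z atTop (𝓝 0) := by
  refine tr.tendsto_zero_of_cost_ne_top (Q := Q) hβ hR hQ
    (ne_top_of_le_ne_top (ENNReal.ofReal_ne_top (r := quadForm P z0)) ?_)
  refine le_of_tendsto (tr.tendsto_cost hR hQ) ?_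
  filter_upwards [eventually_ge_atTop 0] with t ht
  refine ENNReal.ofReal_le_ofReal ?_
  rw [h.integral_cost hβ hR hP tr ht]
  simp only [sub_self, zero_pow two_ne_zero, mul_zero, intervalIntegral.integral_zero, add_zero]
  linarith [hP0 (z t)]

end Optimality

end HeatLQR

end

theorem mainTheorem1 (β R : ℝ) (hβ : 0 < β) (hR : 0 < R)
    (Q : C(HeatLQR.Rod, ℝ) →L[ℝ] C(HeatLQR.Rod, ℝ) →L[ℝ] ℝ)
    (hQsymm : ∀ f g, Q f g = Q g f) (hQnonneg : ∀ f, 0 ≤ Q f f)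
    (P : C(HeatLQR.Rod × HeatLQR.Rod, ℝ)) (hPsymm : ∀ x y, P (x, y) = P (y, x)) :
    -- the Riccati equation in eigenfunction coordinates
    HasSum (fun m : ℕ × ℕ => HeatLQR.coeff β P m.1 m.2 •
        ContinuousMap.toLp 2 (volume : Measure (HeatLQR.Rod × HeatLQR.Rod)) ℝ
          (HeatLQR.eigenfunctionProd β m.1 m.2))
      (ContinuousMap.toLp 2 (volume : Measure (HeatLQR.Rod × HeatLQR.Rod)) ℝ P) ∧
    (∀ m n, HeatLQR.coeff β P m n = HeatLQR.coeff β P n m) ∧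
    (HeatLQR.IsWeakRiccatiSolution β R Q P ↔
      HeatLQR.IsAlgebraicRiccatiSolution β R Q (HeatLQR.coeff β P)) ∧
    -- optimal cost and optimal feedback
    (HeatLQR.IsWeakRiccatiSolution β R Q P →
      (∀ z0 : HeatLQR.L2,
        -- the closed loop has exactly one trajectory from `z0`
        (∃ z Z, HeatLQR.IsTrajectory β z0
          (HeatLQR.feedback (HeatLQR.gain β R P) z) z Z) ∧
        (∀ z Z z' Z',
          HeatLQR.IsTrajectory β z0 (HeatLQR.feedback (HeatLQR.gain β R P) z) z Z →
          HeatLQR.IsTrajectory β z0 (HeatLQR.feedback (HeatLQR.gain β R P) z') z' Z' →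
          EqOn z z' (Ici 0)) ∧
        -- if this trajectory tends to zero, then the feedback is optimal
        (∀ z Z, HeatLQR.IsTrajectory β z0 (HeatLQR.feedback (HeatLQR.gain β R P) z) z Z →
          Tendsto z atTop (𝓝 0) →
          0 ≤ HeatLQR.quadForm P z0 ∧
          HeatLQR.cost Q R (HeatLQR.feedback (HeatLQR.gain β R P) z) Z =
            ENNReal.ofReal (HeatLQR.quadForm P z0) ∧
          IsLeast {J : ENNReal | ∃ u' z' Z', HeatLQR.IsTrajectory β z0 u' z' Z' ∧
              J = HeatLQR.cost Q R u' Z'}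
            (ENNReal.ofReal (HeatLQR.quadForm P z0)) ∧
          (∀ u' z' Z', HeatLQR.IsTrajectory β z0 u' z' Z' →
            (HeatLQR.cost Q R u' Z' = ENNReal.ofReal (HeatLQR.quadForm P z0) ↔
              u' =ᵐ[volume.restrict (Ioi 0)]
                HeatLQR.feedback (HeatLQR.gain β R P) z')))) ∧
      -- and if `P` is nonnegative, then it tends to zero, for every `z0`
      ((∀ f : HeatLQR.L2, 0 ≤ HeatLQR.quadForm P f) →
        ∀ z0 z Z, HeatLQR.IsTrajectory β z0 (HeatLQR.feedback (HeatLQR.gain β R P) z) z Z →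
          Tendsto z atTop (𝓝 0))) := by
  refine ⟨HeatLQR.hasSum_coeff_smul hβ hPsymm, HeatLQR.coeff_symm hPsymm,
    HeatLQR.isWeakRiccatiSolution_iff hβ hQsymm hPsymm, fun hweak => ?_⟩
  have h := hweak.isModalRiccatiSolution hβ hQsymm hPsymm
  refine ⟨fun z0 => ⟨HeatLQR.exists_closedLoop hβ hPsymm z0, fun z Z z' Z' tr tr' =>
      tr.eqOn_of_feedback hβ hPsymm tr' (EventuallyEq.refl _ _) (EventuallyEq.refl _ _),
    fun z Z tr hz => ?_⟩, fun hP0 z0 z Z tr =>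
      h.tendsto_zero_of_nonneg hβ hR hQnonneg hPsymm hP0 tr⟩
  obtain ⟨h0, hc⟩ := h.cost_of_feedback hβ hR hQnonneg hPsymm tr (EventuallyEq.refl _ _) hz
  refine ⟨h0, hc, ⟨⟨_, z, Z, tr, hc.symm⟩, ?_⟩, fun u' z' Z' tr' =>
    ⟨h.ae_eq_feedback_of_cost_eq hβ hR hQnonneg hPsymm h0 tr', fun hu => ?_⟩⟩
  · rintro _ ⟨u', z', Z', tr', rfl⟩
    exact h.quadForm_le_cost hβ hR hQnonneg hPsymm h0 tr'
  · have heq := tr.eqOn_of_feedback hβ hPsymm tr' (EventuallyEq.refl _ _) hu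
    have hz' : Tendsto z' atTop (𝓝 0) := by
      refine hz.congr' ?_
      filter_upwards [eventually_ge_atTop 0] with t ht
      exact heq ht
    exact (h.cost_of_feedback hβ hR hQnonneg hPsymm tr' hu hz').2
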